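/- **Theorem 2.1 (Classification of decay rates).** Let $H$ be a (real or complex) Hilbert space with norm $|\cdot|$, and let $A$ be a self-adjoint nonnegative linear operator on $H$ with dense domain $D(A)$, whose spectrum consists of eigenvalues and is either a finite set or an increasing sequence. Let $A^{1/2}$ be the nonnegative self-adjoint square root of $A$, and let $|x|_{D(A^{1/2})}:=(|x|^2+|A^{1/2}x|^2)^{1/2}$ for $x\in D(A^{1/2})$. Let $g\in L^2((0,T),H)$ for every $T>0$, and let $u\in C^0([0,+\infty),D(A^{1/2}))$ be a global strong solution of $u'(t)+Au(t)=g(t)$; that is, for every $T>0$, * $u\in W^{1,2}((0,T),H)\cap L^2((0,T),D(A))$; * the function $t\mapsto|A^{1/2}u(t)|^2$ is absolutely continuous in $[0,T]$; * for almost every $t\in(0,T)$ the derivative $u'(t)$ exists, $u(t)\in D(A)$, and the equation holds at $t$. Assume that $|u(t)|_{D(A^{1/2})}\to0$ as $t\to+\infty$, and that there are $p>0$, $q>0$ and $K_0\ge0$ such that $$|g(t)|\le K_0\left(|u(t)|^{1+p}+|A^{1/2}u(t)|^{1+q}\right)\qquad\forall t\ge0.$$ Then one and only one of the following statements holds. 1.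 (Null solution) $u(t)=0$ for every $t\ge0$. 2. (Slow solution) There are constants $M_1>0$ and $M_2>0$ such that $$|u(t)|\ge\frac{M_1}{(1+t)^{1/p}}\quad\text{and}\quad|A^{1/2}u(t)|\le M_2|u(t)|^{1+p}\qquad\forall t\ge0.$$ 3. (Spectral fast solution) There are an eigenvalue $\lambda>0$ of $A$ and a corresponding eigenvector $v_0\ne0$ such that $$\lim_{t\to+\infty}\left|u(t)-v_0e^{-\lambda t}\right|_{D(A^{1/2})}e^{\gamma t}=0$$ for every real $\gamma<\min\{\beta,(1+p)\lambda,(1+q)\lambda\}$, where $\beta$ is the smallest eigenvalue of $A$ larger than $\lambda$, and $\beta=+\infty$ if there is no such eigenvalue. -/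

import Mathlib

open MeasureTheory Filter Topology Set
open scoped InnerProductSpace

namespace DecayRates

noncomputable section

section Operators

variable {𝕜 H : Type*} [RCLike 𝕜] [NormedAddCommGroup H] [InnerProductSpace 𝕜 H]

/-- Nonnegativity of a (possibly unbounded) operator: `⟨A x, x⟩ ≥ 0` for every `x ∈ D(A)`.
(For self-adjoint operators the inner product is real, so its real part is all of it.) -/
def IsNonneg (A : H →ₗ.[𝕜] H) : Prop :=
  ∀ x : A.domain, 0 ≤ RCLike.re (inner 𝕜 (A x) (x : H))

/-- The value `A x` when `x ∈ D(A)`, extended by `0` outside of `D(A)`. -/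
def val (A : H →ₗ.[𝕜] H) (x : H) : H :=
  open Classical in if h : x ∈ A.domain then A ⟨x, h⟩ else 0

/-- `v` is an eigenvector of `A` with eigenvalue `z`: `v ≠ 0`, `v ∈ D(A)` and `A v = z v`. -/
def IsEigenvector (A : H →ₗ.[𝕜] H) (z : 𝕜) (v : H) : Prop :=
  v ≠ 0 ∧ ∃ h : v ∈ A.domain, A ⟨v, h⟩ = z • v

/-- `z` is an eigenvalue of `A`. -/
def IsEigenvalue (A : H →ₗ.[𝕜] H) (z : 𝕜) : Prop :=
  ∃ v : H, IsEigenvector A z v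

/-- `z` is in the resolvent set of `A`: the map `A - z : D(A) → H` is a bijection whose inverse
is a bounded operator `R` on `H`. -/
def InResolventSet (A : H →ₗ.[𝕜] H) (z : 𝕜) : Prop :=
  ∃ R : H →L[𝕜] H,
    (∀ x : A.domain, R (A x - z • (x : H)) = x) ∧
    (∀ y : H, ∃ h : R y ∈ A.domain, A ⟨R y, h⟩ - z • R y = y)

/-- The spectrum of a (possibly unbounded) operator. -/
def spec (A : H →ₗ.[𝕜] H) : Set 𝕜 := {z | ¬ InResolventSet A z}

/-- The spectrum of `A` consists of eigenvalues, and it is either a finite set or (the set of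
values of) an increasing sequence of real numbers. -/
def HasDiscreteSpectrum (A : H →ₗ.[𝕜] H) : Prop :=
  (∀ z ∈ spec A, IsEigenvalue A z) ∧
  ((spec A).Finite ∨
    ∃ e : ℕ → ℝ, StrictMono e ∧ spec A = Set.range (fun n => ((e n : ℝ) : 𝕜)))

/-- The number `β` attached to `r`: the smallest eigenvalue of `A` larger than `r`, and `+∞` if
there is no such eigenvalue. -/
def nextEigenvalue (A : H →ₗ.[𝕜] H) (r : ℝ) : EReal :=
  sInf {b : EReal | ∃ m : ℝ, r < m ∧ IsEigenvalue A ((m : ℝ) : 𝕜) ∧ b = (m : EReal)}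

variable [CompleteSpace H]

/-- `B` is a nonnegative self-adjoint square root of `A`: `B ∘ B = A` as unbounded operators,
that is, `x ∈ D(A)` if and only if `x ∈ D(B)` and `B x ∈ D(B)`, and then `B (B x) = A x`. -/
structure IsNonnegSqrt (A B : H →ₗ.[𝕜] H) : Prop where
  selfAdjoint : IsSelfAdjoint B
  nonneg : IsNonneg B
  sq : ∀ x z : H, (x, z) ∈ A.graph ↔ ∃ y : H, (x, y) ∈ B.graph ∧ (y, z) ∈ B.graph

/-- The operator `A^{1/2}`: the nonnegative self-adjoint square root of `A`. It is classical that
every nonnegative self-adjoint operator has one and only one such square root; for other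
operators the definition returns the zero operator. -/
def sqrtOp (A : H →ₗ.[𝕜] H) : H →ₗ.[𝕜] H :=
  open Classical in if h : ∃ B : H →ₗ.[𝕜] H, IsNonnegSqrt A B then h.choose else 0

/-- The norm `|x|_{D(A^{1/2})} = (|x|² + |A^{1/2} x|²)^{1/2}`, for `x ∈ D(A^{1/2})`. -/
def normSqrt (A : H →ₗ.[𝕜] H) (x : H) : ℝ :=
  Real.sqrt (‖x‖ ^ 2 + ‖val (sqrtOp A) x‖ ^ 2)

variable [NormedSpace ℝ H]

/-- `u` is a strong solution of `u' + A u = g` in `[0, T]`, with the usual regularity.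
Only the values of `u` on `[0, T]` and of `g` on `(0, T)` matter. -/
structure IsStrongSolution (A : H →ₗ.[𝕜] H) (g u : ℝ → H) (T : ℝ) : Prop where
  /-- `u(t) ∈ D(A^{1/2})` for every `t ∈ [0, T]`, -/
  mem_sqrt : ∀ t ∈ Icc 0 T, u t ∈ (sqrtOp A).domain
  /-- and `u` is continuous in `[0, T]` with values in `D(A^{1/2})`, with its graph norm. -/
  continuousOn : ContinuousOn u (Icc 0 T)
  continuousOn_sqrt : ContinuousOn (fun t => val (sqrtOp A) (u t)) (Icc 0 T)
  /-- `u ∈ W^{1,2}((0, T), H)`: since `u` is continuous, this means that `u` is the integral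
  function of its derivative, which lies in `L²((0, T), H)`. -/
  sobolev : ∃ v : ℝ → H, MemLp v 2 (volume.restrict (Ioo 0 T)) ∧
    ∀ t ∈ Icc 0 T, u t = u 0 + ∫ s in (0 : ℝ)..t, v s
  /-- `u ∈ L²((0, T), D(A))`, where `D(A)` has the graph norm. -/
  mem_ae : ∀ᵐ t ∂(volume.restrict (Ioo 0 T)), u t ∈ A.domain
  memLp : MemLp u 2 (volume.restrict (Ioo 0 T))
  memLp_val : MemLp (fun t => val A (u t)) 2 (volume.restrict (Ioo 0 T))
  /-- The function `|A^{1/2} u(t)|²` is absolutely continuous in `[0, T]`. -/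
  absCont : AbsolutelyContinuousOnInterval (fun t => ‖val (sqrtOp A) (u t)‖ ^ 2) 0 T
  /-- For almost every `t`, the derivative `u'(t)` exists and `u'(t) + A u(t) = g(t)`. -/
  equation : ∀ᵐ t ∂(volume.restrict (Ioo 0 T)),
    ∃ u' : H, HasDerivAt u u' t ∧ u' + val A (u t) = g t

/-- `u` is a global strong solution of `u' + A u = g` on `[0, +∞)`. -/
def IsGlobalSolution (A : H →ₗ.[𝕜] H) (g u : ℝ → H) : Prop :=
  ∀ T : ℝ, 0 < T → IsStrongSolution A g u T

/-- The null solution. -/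
def IsNull (u : ℝ → H) : Prop := ∀ t : ℝ, 0 ≤ t → u t = 0

/-- Slow solutions: `|u(t)| ≥ M₁ (1+t)^{-1/p}` and `|A^{1/2} u(t)| ≤ M₂ |u(t)|^{1+p}`. -/
def IsSlow (A : H →ₗ.[𝕜] H) (p : ℝ) (u : ℝ → H) : Prop :=
  ∃ M₁ M₂ : ℝ, 0 < M₁ ∧ 0 < M₂ ∧
    (∀ t : ℝ, 0 ≤ t → M₁ / (1 + t) ^ (1 / p) ≤ ‖u t‖) ∧
    (∀ t : ℝ, 0 ≤ t → ‖val (sqrtOp A) (u t)‖ ≤ M₂ * ‖u t‖ ^ (1 + p))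

/-- Spectral fast solutions: there are an eigenvalue `r > 0` and an eigenvector `v₀` such that
`|u(t) - v₀ e^{-r t}|_{D(A^{1/2})} e^{γ t} → 0` for all `γ < min {β, (1+p) r, (1+q) r}`, where
`β` is the next eigenvalue. -/
def IsSpectralFast (A : H →ₗ.[𝕜] H) (p q : ℝ) (u : ℝ → H) : Prop :=
  ∃ (r : ℝ) (v₀ : H), 0 < r ∧ IsEigenvector A ((r : ℝ) : 𝕜) v₀ ∧
    ∀ γ : ℝ,
      (γ : EReal) < min (nextEigenvalue A r)
        (min (((1 + p) * r : ℝ) : EReal) (((1 + q) * r : ℝ) : EReal)) →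
      Tendsto (fun t : ℝ => normSqrt A (u t - Real.exp (-r * t) • v₀) * Real.exp (γ * t))
        atTop (𝓝 0)

end Operators

end

end DecayRates

/-! The proof follows the Dirichlet quotient `Q = |A^{1/2}u|² / |u|²`. Along a nonzero solution `Q'
≤ -|Au - Qu|²/|u|² + |g|²/|u|²`. The last term is at most `2α² + 2β²Q` with `α = K|u|^p` and `β =
K|A^{1/2}u|^q`, and both coefficients tend to 0. The dissipative term is at least the square of the
distance of `Q` from the spectrum, and also at least `(ν - Q)Q` if no point of the spectrum lies in
`(0, ν)` (`FlowAt.quot_deriv`). So `Q` is pushed towards the spectrum. Since `Q` stays bounded on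
bounded intervals, `|u|` cannot reach 0 in finite time (`pos_of_pos`), so a solution that is not
null never vanishes.

Late enough there are two regimes. If `Q ≤ ν/2` at one time, then `Q` is trapped there
(`quot_le_half`) and tends to 0 (`quot_tendsto_zero`). Moreover `Q|u|^{-2p}` obeys a linear
inequality with constant forcing, so it is bounded, which is `|A^{1/2}u| ≤ M|u|^{1+p}`
(`exists_z_le`). Then `|u|^{-p}` grows at most linearly (`slow`). If instead `Q > ν/2` forever, then
`|A^{1/2}u|` decays exponentially, the perturbation of `Q` is integrable in time, and `Q` converges.
Its limit `r > 0` must be in the spectrum, since otherwise the dissipation would drive `Q` below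
zero (`fast`).

In the second regime `|u|` is `e^{-rt}` up to factors `e^{±εt}`, so `g` is `O(e^{-γt})` for every
`γ` below `(1+p)r` and `(1+q)r`. Each rescaled component `e^{st}P_s u` with `s < γ` then converges
with a rate (`mode_estimate`). The limit is 0 if `s < r`, and it is `v₀` if `s = r`. The components
with eigenvalues beyond `γ` are controlled together by an energy estimate (`high_modes`). If `v₀`
were 0, the expansion would contradict the lower bound on `|u|`.

On the operator side, isolated spectral points make the eigenvectors total
(`iSup_eigenspace_orthogonal`). Thus `A` is diagonal, and every nonnegative square root of `A`
multiplies by `√r` on the eigenspace of `r`. The three alternatives exclude each other because their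
decay rates differ. -/

namespace DecayRates

/-! ### Absolutely continuous functions, Gronwall inequalities and a barrier principle. -/

section AbsolutelyContinuous

/-- A function whose increments are dominated by those of an absolutely continuous function is
absolutely continuous. -/
lemma absolutelyContinuousOnInterval_of_dist_le {X Y : Type*} [PseudoMetricSpace X]
    [PseudoMetricSpace Y] {f : ℝ → X} {g : ℝ → Y} {a b C : ℝ}
    (hg : AbsolutelyContinuousOnInterval g a b)
    (h : ∀ x ∈ uIcc a b, ∀ y ∈ uIcc a b, dist (f x) (f y) ≤ C * dist (g x) (g y)) :
    AbsolutelyContinuousOnInterval f a b := by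
  unfold AbsolutelyContinuousOnInterval at hg ⊢
  refine squeeze_zero' ?_ ?_ (by simpa using hg.const_mul C)
  · exact Eventually.of_forall fun _ => Finset.sum_nonneg fun i _ => dist_nonneg
  · rw [eventually_inf_principal]
    refine Eventually.of_forall fun E hE => ?_
    rw [Finset.mul_sum]
    exact Finset.sum_le_sum fun i hi => h _ (hE.1 i hi).1 _ (hE.1 i hi).2

lemma absolutelyContinuousOnInterval_comp {f φ : ℝ → ℝ} {a b m M : ℝ}
    (hf : AbsolutelyContinuousOnInterval f a b) (hm : ∀ x ∈ uIcc a b, f x ∈ Icc m M)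
    (hφ : ContDiffOn ℝ 1 φ (Icc m M)) :
    AbsolutelyContinuousOnInterval (fun x => φ (f x)) a b := by
  obtain ⟨K, hK⟩ := hφ.exists_lipschitzOnWith (by decide) (convex_Icc _ _) isCompact_Icc
  exact absolutelyContinuousOnInterval_of_dist_le (C := K) hf
    fun x hx y hy => hK.dist_le_mul _ (hm x hx) _ (hm y hy)

lemma absolutelyContinuousOnInterval_rpow {f : ℝ → ℝ} {a b : ℝ} (r : ℝ)
    (hf : AbsolutelyContinuousOnInterval f a b) (hpos : ∀ x ∈ uIcc a b, 0 < f x) :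
    AbsolutelyContinuousOnInterval (fun x => f x ^ r) a b := by
  obtain ⟨x₀, hx₀, hmin⟩ := isCompact_uIcc.exists_isMinOn nonempty_uIcc hf.continuousOn
  obtain ⟨x₁, hx₁, hmax⟩ := isCompact_uIcc.exists_isMaxOn nonempty_uIcc hf.continuousOn
  refine absolutelyContinuousOnInterval_comp (φ := fun y => y ^ r) hf
    (fun x hx => ⟨hmin hx, hmax hx⟩) ?_
  intro y hy
  exact (Real.contDiffAt_rpow_const_of_ne (((hpos _ hx₀).trans_le hy.1).ne')).contDiffWithinAt

lemma absolutelyContinuousOnInterval_inv {f : ℝ → ℝ} {a b : ℝ}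
    (hf : AbsolutelyContinuousOnInterval f a b) (hpos : ∀ x ∈ uIcc a b, 0 < f x) :
    AbsolutelyContinuousOnInterval (fun x => (f x)⁻¹) a b := by
  simpa only [Real.rpow_neg_one] using absolutelyContinuousOnInterval_rpow (-1) hf hpos

lemma absolutelyContinuousOnInterval_of_contDiff {f : ℝ → ℝ} (hf : ContDiff ℝ 1 f) (a b : ℝ) :
    AbsolutelyContinuousOnInterval f a b :=
  hf.contDiffOn.absolutelyContinuousOnInterval

/-- By the fundamental theorem of calculus for absolutely continuous functions, the sign of the
derivative almost everywhere suffices. All the differential inequalities below are integrated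
through this lemma. -/
lemma le_of_absolutelyContinuous_of_deriv_nonpos {f : ℝ → ℝ} {a b : ℝ} (hab : a ≤ b)
    (hf : AbsolutelyContinuousOnInterval f a b)
    (h : ∀ᵐ t, t ∈ Ioo a b → ∃ f', HasDerivAt f f' t ∧ f' ≤ 0) : f b ≤ f a := by
  have h1 := hf.integral_deriv_eq_sub
  have h2 : ∫ x in a..b, deriv f x ≤ 0 := by
    rw [intervalIntegral.integral_of_le hab, integral_Ioc_eq_integral_Ioo]
    refine integral_nonpos_of_ae ?_
    rw [EventuallyLE, ae_restrict_iff' measurableSet_Ioo]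
    filter_upwards [h] with t ht hmem
    obtain ⟨f', hd, hle⟩ := ht hmem
    simpa [hd.deriv] using hle
  linarith

/-- Absolute continuity on the compact subintervals of `[a, +∞)`. -/
def LocallyAC (f : ℝ → ℝ) (a : ℝ) : Prop :=
  ∀ b c, a ≤ b → b ≤ c → AbsolutelyContinuousOnInterval f b c

lemma LocallyAC.mono {f : ℝ → ℝ} {a b : ℝ} (hf : LocallyAC f a) (h : a ≤ b) : LocallyAC f b :=
  fun _ _ h1 h2 => hf _ _ (h.trans h1) h2

lemma LocallyAC.continuousOn {f : ℝ → ℝ} {a : ℝ} (hf : LocallyAC f a) :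
    ContinuousOn f (Ici a) := by
  intro x hx
  have h1 := (hf a (x + 1) le_rfl (by linarith [mem_Ici.1 hx])).continuousOn
  rw [uIcc_of_le (by linarith [mem_Ici.1 hx])] at h1
  refine (h1 x ⟨hx, by linarith⟩).mono_of_mem_nhdsWithin ?_
  filter_upwards [self_mem_nhdsWithin, mem_nhdsWithin_of_mem_nhds (Iio_mem_nhds (lt_add_one x))]
    with y hy hy'
  exact ⟨hy, le_of_lt hy'⟩

lemma LocallyAC.add {f g : ℝ → ℝ} {a : ℝ} (hf : LocallyAC f a) (hg : LocallyAC g a) :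
    LocallyAC (fun t => f t + g t) a := fun b c h1 h2 => (hf b c h1 h2).fun_add (hg b c h1 h2)

lemma LocallyAC.sub {f g : ℝ → ℝ} {a : ℝ} (hf : LocallyAC f a) (hg : LocallyAC g a) :
    LocallyAC (fun t => f t - g t) a := fun b c h1 h2 => (hf b c h1 h2).fun_sub (hg b c h1 h2)

lemma LocallyAC.mul {f g : ℝ → ℝ} {a : ℝ} (hf : LocallyAC f a) (hg : LocallyAC g a) :
    LocallyAC (fun t => f t * g t) a := fun b c h1 h2 => (hf b c h1 h2).fun_mul (hg b c h1 h2)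

lemma LocallyAC.rpow {f : ℝ → ℝ} {a : ℝ} (hf : LocallyAC f a) (hpos : ∀ t, a ≤ t → 0 < f t)
    (r : ℝ) : LocallyAC (fun t => f t ^ r) a := fun b c h1 h2 =>
  absolutelyContinuousOnInterval_rpow r (hf b c h1 h2) fun x hx => by
    rw [uIcc_of_le h2] at hx
    exact hpos x (h1.trans hx.1)

lemma absolutelyContinuousOnInterval_mono_nonneg {X : Type*} [PseudoMetricSpace X] {f : ℝ → X}
    (hf : ∀ T, 0 < T → AbsolutelyContinuousOnInterval f 0 T) {b c : ℝ} (hb : 0 ≤ b)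
    (hbc : b ≤ c) : AbsolutelyContinuousOnInterval f b c := by
  refine (hf (c + 1) (by linarith)).mono ?_
  rw [uIcc_of_le hbc, uIcc_of_le (by linarith)]
  exact Icc_subset_Icc hb (by linarith)

lemma locallyAC_norm_sq {E : Type*} [SeminormedAddCommGroup E] {f : ℝ → E}
    (hf : ∀ T, 0 < T → AbsolutelyContinuousOnInterval f 0 T) :
    LocallyAC (fun t => ‖f t‖ ^ 2) 0 := by
  have h : LocallyAC (fun t => ‖f t‖) 0 := fun b c h1 h2 =>
    absolutelyContinuousOnInterval_of_dist_le (C := 1)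
      (absolutelyContinuousOnInterval_mono_nonneg hf h1 h2) fun x _ y _ => by
        rw [one_mul, Real.dist_eq, dist_eq_norm]
        exact abs_norm_sub_norm_le _ _
  simpa only [pow_two] using h.mul h

lemma locallyAC_of_contDiff {f : ℝ → ℝ} (hf : ContDiff ℝ 1 f) (a : ℝ) : LocallyAC f a :=
  fun b c _ _ => absolutelyContinuousOnInterval_of_contDiff hf b c

/-- Gronwall lemma for absolutely continuous functions, with exponential forcing term. -/
lemma gronwall_Icc {f : ℝ → ℝ} {a b c d m : ℝ} (hcd : c ≠ d) (hab : a ≤ b)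
    (hf : AbsolutelyContinuousOnInterval f a b)
    (h : ∀ᵐ t, t ∈ Ioo a b →
      ∃ f', HasDerivAt f f' t ∧ f' ≤ -c * f t + m * Real.exp (-d * t)) :
    (f b - m / (c - d) * Real.exp (-d * b)) * Real.exp (c * b) ≤
      (f a - m / (c - d) * Real.exp (-d * a)) * Real.exp (c * a) := by
  have hexp : ∀ k : ℝ, AbsolutelyContinuousOnInterval (fun t => Real.exp (k * t)) a b := fun k =>
    absolutelyContinuousOnInterval_of_contDiff (by fun_prop) a b
  -- `m / (c - d) * exp (-d t)` solves the equation with equality. Subtracting it and multiplying by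
  -- the integrating factor `exp (c t)` leaves a nonincreasing function.
  refine le_of_absolutelyContinuous_of_deriv_nonpos
    (f := fun t => (f t - m / (c - d) * Real.exp (-d * t)) * Real.exp (c * t)) hab
    ((hf.fun_sub ((hexp (-d)).const_mul _)).fun_mul (hexp c)) ?_
  filter_upwards [h] with t ht hmem
  obtain ⟨f', hd, hle⟩ := ht hmem
  have he : ∀ k : ℝ, HasDerivAt (fun t => Real.exp (k * t)) (Real.exp (k * t) * k) t := fun k => by
    simpa using ((hasDerivAt_id t).const_mul k).exp
  refine ⟨_, (hd.sub ((he (-d)).const_mul _)).mul (he c), ?_⟩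
  have hne : c - d ≠ 0 := sub_ne_zero.2 hcd
  have key : (f' - m / (c - d) * (Real.exp (-d * t) * -d)) * Real.exp (c * t) +
      (f t - m / (c - d) * Real.exp (-d * t)) * (Real.exp (c * t) * c) =
      (f' - (-c * f t + m * Real.exp (-d * t))) * Real.exp (c * t) := by
    field_simp
    ring
  exact key.trans_le (mul_nonpos_of_nonpos_of_nonneg (by linarith) (Real.exp_pos _).le)

/-- Gronwall lemma on a half-line, with exponential forcing term. -/
lemma gronwall {f : ℝ → ℝ} {a c d m : ℝ} (hcd : c ≠ d) (hf : LocallyAC f a)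
    (h : ∀ᵐ t, a < t → ∃ f', HasDerivAt f f' t ∧ f' ≤ -c * f t + m * Real.exp (-d * t)) :
    AntitoneOn (fun t => (f t - m / (c - d) * Real.exp (-d * t)) * Real.exp (c * t)) (Ici a) := by
  intro x hx y hy hxy
  refine gronwall_Icc hcd hxy (hf x y hx hxy) ?_
  filter_upwards [h] with t ht hmem
  exact ht (lt_of_le_of_lt hx hmem.1)

lemma antitoneOn_of_deriv_nonpos {f : ℝ → ℝ} {a : ℝ} (hf : LocallyAC f a)
    (h : ∀ᵐ t, a < t → ∃ f', HasDerivAt f f' t ∧ f' ≤ 0) : AntitoneOn f (Ici a) := by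
  intro x hx y hy hxy
  refine le_of_absolutelyContinuous_of_deriv_nonpos hxy (hf x y hx hxy) ?_
  filter_upwards [h] with t ht hmem
  exact ht (lt_of_le_of_lt hx hmem.1)

/-- Gronwall lemma with constant forcing term. -/
lemma gronwall_const {f : ℝ → ℝ} {a c m : ℝ} (hc : 0 < c) (hf : LocallyAC f a)
    (h : ∀ᵐ t, a < t → ∃ f', HasDerivAt f f' t ∧ f' ≤ -c * f t + m) (t : ℝ) (ht : a ≤ t) :
    f t ≤ m / c + (f a - m / c) * Real.exp (-c * (t - a)) := by
  have h1 := gronwall (d := 0) (m := m) hc.ne' hf (by simpa using h) (mem_Ici.2 le_rfl)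
    (mem_Ici.2 ht) ht
  simp only [sub_zero, neg_zero, zero_mul, Real.exp_zero, mul_one] at h1
  have h2 : Real.exp (-c * (t - a)) = Real.exp (c * a) / Real.exp (c * t) := by
    rw [← Real.exp_sub]
    ring_nf
  rw [h2, ← mul_div_assoc, ← sub_le_iff_le_add', le_div_iff₀ (Real.exp_pos _)]
  exact h1

/-- A continuous function cannot cross a level from below if it does not increase right after
the times when it attains the level. -/
lemma le_of_barrier {f : ℝ → ℝ} {a m : ℝ} (hf : ContinuousOn f (Ici a)) (ha : f a ≤ m)
    (h : ∀ x, a ≤ x → f x = m → ∀ᶠ y in 𝓝[>] x, f y ≤ m) (t : ℝ) (ht : a ≤ t) : f t ≤ m := by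
  have hc : IsClosed ({x | f x ≤ m} ∩ Icc a t) := by
    have := (hf.mono (Icc_subset_Ici_self : Icc a t ⊆ Ici a)).preimage_isClosed_of_isClosed isClosed_Icc
      (isClosed_Iic (a := m))
    rwa [inter_comm] at this
  refine hc.Icc_subset_of_forall_mem_nhdsWithin (s := {x | f x ≤ m}) ha ?_ ⟨ht, le_rfl⟩
  rintro x ⟨hx, hx1, hx2⟩
  rcases eq_or_lt_of_le (show f x ≤ m from hx) with h1 | h1
  · exact h x hx1 h1
  · have h2 : ∀ᶠ y in 𝓝[Ici a] x, f y < m := (hf x hx1).eventually (gt_mem_nhds h1)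
    have h3 : ∀ᶠ y in 𝓝[>] x, f y < m :=
      h2.filter_mono (nhdsWithin_mono _ fun y hy => le_trans hx1 (le_of_lt hy))
    exact h3.mono fun y hy => hy.le

end AbsolutelyContinuous

/-! ### The scalar inequalities behind the equation, and nonvanishing of nonzero solutions. -/

section ScalarFlow

/-- The relations between `w = |u|`, `z = |A^{1/2} u|`, `a = |A u|`, `h = |g|`,
`G₁ = Re ⟨g, u⟩`, `G₂ = Re ⟨g, A u⟩` at a time when the equation `u' + A u = g` holds. Here `σ` is
the spectrum of `A`. -/
structure FlowAt (σ : Set ℝ) (K p q : ℝ) (w z : ℝ → ℝ) (t a h G₁ G₂ : ℝ) : Prop where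
  a_nonneg : 0 ≤ a
  h_nonneg : 0 ≤ h
  h_le : h ≤ K * (w t ^ (1 + p) + z t ^ (1 + q))
  deriv_w : HasDerivAt (fun s => w s ^ 2) (2 * (G₁ - z t ^ 2)) t
  deriv_z : HasDerivAt (fun s => z s ^ 2) (2 * (G₂ - a ^ 2)) t
  abs_G₁_le : |G₁| ≤ h * w t
  -- The expression under the root, here and in `gap`, is `|A u - c u|²`; `G₂ - c G₁` is `Re ⟨g, A u
  -- - c u⟩`.
  abs_sub_le : ∀ c : ℝ, |G₂ - c * G₁| ≤ h * √(a ^ 2 - 2 * c * z t ^ 2 + c ^ 2 * w t ^ 2)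
  gap : ∀ c d : ℝ, 0 ≤ d → (∀ s ∈ σ, d ≤ |s - c|) →
    d ^ 2 * w t ^ 2 ≤ a ^ 2 - 2 * c * z t ^ 2 + c ^ 2 * w t ^ 2

/-- The dichotomy between slow and fast solutions uses nothing about the Hilbert space beyond these
relations. -/
structure ScalarFlow (σ : Set ℝ) (K p q : ℝ) (w z : ℝ → ℝ) : Prop where
  w_nonneg : ∀ t, 0 ≤ w t
  z_nonneg : ∀ t, 0 ≤ z t
  ac_w : LocallyAC (fun t => w t ^ 2) 0
  ac_z : LocallyAC (fun t => z t ^ 2) 0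
  flow : ∀ᵐ t, 0 < t → ∃ a h G₁ G₂, FlowAt σ K p q w z t a h G₁ G₂

/-- The Dirichlet quotient. -/
noncomputable def quot (w z : ℝ → ℝ) (t : ℝ) : ℝ := z t ^ 2 * (w t ^ 2)⁻¹

variable {σ : Set ℝ} {K p q ν : ℝ} {w z : ℝ → ℝ}

lemma quot_nonneg (t : ℝ) : 0 ≤ quot w z t := by
  unfold quot; positivity

lemma quot_mul {t : ℝ} (h : 0 < w t) : quot w z t * w t ^ 2 = z t ^ 2 := by
  unfold quot; field_simp

lemma sq_rpow {x : ℝ} (hx : 0 ≤ x) (r : ℝ) : (x ^ 2) ^ r = x ^ (2 * r) := by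
  rw [← Real.rpow_natCast, ← Real.rpow_mul hx]; norm_num

lemma FlowAt.h_le' {t a h G₁ G₂ : ℝ} (hf : FlowAt σ K p q w z t a h G₁ G₂) (hw : 0 ≤ w t)
    (hz : 0 ≤ z t) (hp : 0 < p) (hq : 0 < q) :
    h ≤ K * w t ^ p * w t + K * z t ^ q * z t := by
  refine hf.h_le.trans (le_of_eq ?_)
  rw [Real.rpow_one_add' hw (by linarith), Real.rpow_one_add' hz (by linarith)]
  ring

/-- The mixed term is split by Young's inequality `2βwz ≤ β²w² + z²`. -/
lemma FlowAt.deriv_w_bounds {t a h G₁ G₂ α β : ℝ} (hf : FlowAt σ K p q w z t a h G₁ G₂)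
    (hw : 0 ≤ w t) (hh : h ≤ α * w t + β * z t) :
    2 * (G₁ - z t ^ 2) ≤ (2 * α + β ^ 2) * w t ^ 2 - z t ^ 2 ∧
      -(2 * α + β ^ 2) * w t ^ 2 - 3 * z t ^ 2 ≤ 2 * (G₁ - z t ^ 2) := by
  have h1 := abs_le.1 hf.abs_G₁_le
  have h2 : h * w t ≤ (α * w t + β * z t) * w t := mul_le_mul_of_nonneg_right hh hw
  constructor <;> nlinarith [sq_nonneg (β * w t - z t)]

lemma FlowAt.deriv_z_le {t a h G₁ G₂ : ℝ} (hf : FlowAt σ K p q w z t a h G₁ G₂) :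
    2 * (G₂ - a ^ 2) ≤ -a ^ 2 + h ^ 2 := by
  have h1 := hf.abs_sub_le 0
  rw [show a ^ 2 - 2 * 0 * z t ^ 2 + 0 ^ 2 * w t ^ 2 = a ^ 2 by ring, Real.sqrt_sq hf.a_nonneg,
    zero_mul, sub_zero] at h1
  nlinarith [(abs_le.1 h1).2, sq_nonneg (h - a)]

lemma sq_h_le {h α β x y : ℝ} (h0 : 0 ≤ h) (hh : h ≤ α * x + β * y) :
    h ^ 2 ≤ 2 * α ^ 2 * x ^ 2 + 2 * β ^ 2 * y ^ 2 := by
  nlinarith [sq_nonneg (α * x - β * y), pow_le_pow_left₀ h0 hh 2]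

lemma FlowAt.le_sq_a {t a h G₁ G₂ : ℝ} (hf : FlowAt σ K p q w z t a h G₁ G₂) (hν : 0 ≤ ν)
    (hσ : ∀ x ∈ σ, x ≤ 0 ∨ ν ≤ x) : ν * z t ^ 2 ≤ a ^ 2 := by
  -- A spectrum avoiding `(0, ν)` is at distance at least `ν / 2` from `ν / 2`; the terms in `w²`
  -- then cancel.
  have h1 := hf.gap (ν / 2) (ν / 2) (by linarith) fun s hs => by
    rcases hσ s hs with h | h
    · rw [abs_of_nonpos (by linarith)]; linarith
    · rw [abs_of_nonneg (by linarith)]; linarith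
  nlinarith

/-- Differential inequality for the Dirichlet quotient. -/
lemma FlowAt.quot_deriv {t a h G₁ G₂ α β : ℝ} (hf : FlowAt σ K p q w z t a h G₁ G₂)
    (hw : 0 < w t) (hh : h ≤ α * w t + β * z t) :
    ∃ Q' s : ℝ, HasDerivAt (quot w z) Q' t ∧
      Q' ≤ -s + 2 * α ^ 2 + 2 * β ^ 2 * quot w z t ∧
      (∀ d : ℝ, 0 ≤ d → (∀ x ∈ σ, d ≤ |x - quot w z t|) → d ^ 2 ≤ s) ∧
      (∀ ν : ℝ, 0 ≤ ν → (∀ x ∈ σ, x ≤ 0 ∨ ν ≤ x) → (ν - quot w z t) * quot w z t ≤ s) := by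
  set Q := quot w z t with hQ
  have hX : 0 < w t ^ 2 := by positivity
  have hQX : Q * w t ^ 2 = z t ^ 2 := quot_mul hw
  -- `S = |A u - Q u|²`. The derivative of `Q` is `(2 Re ⟨g, A u - Q u⟩ - 2S) / w²`, and Young's
  -- inequality spends one of the two copies of `S` on the forcing term.
  set S := a ^ 2 - 2 * Q * z t ^ 2 + Q ^ 2 * w t ^ 2 with hS
  have hS' : S = a ^ 2 - Q * z t ^ 2 := by rw [hS, ← hQX]; ring
  have hS0 : 0 ≤ S := by simpa using hf.gap Q 0 le_rfl fun s _ => abs_nonneg _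
  refine ⟨_, S / w t ^ 2, hf.deriv_z.mul (hf.deriv_w.inv hX.ne'), ?_, fun d hd hdist => ?_,
    fun ν hν hσ => ?_⟩
  · have h1 := hf.abs_sub_le Q
    have h2 : 2 * (h * √S) ≤ S + h ^ 2 := by
      nlinarith [sq_nonneg (h - √S), Real.sq_sqrt hS0]
    have h3 := sq_h_le hf.h_nonneg hh
    have h4 : 2 * (G₂ - a ^ 2) * (w t ^ 2)⁻¹ +
        z t ^ 2 * (-(2 * (G₁ - z t ^ 2)) / (w t ^ 2) ^ 2) =
        (2 * (G₂ - Q * G₁) - 2 * S) / w t ^ 2 := by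
      rw [hS', ← hQX]
      field_simp
      ring
    rw [h4, div_le_iff₀ hX]
    have h5 : (-(S / w t ^ 2) + 2 * α ^ 2 + 2 * β ^ 2 * Q) * w t ^ 2 =
        -S + 2 * α ^ 2 * w t ^ 2 + 2 * β ^ 2 * z t ^ 2 := by
      rw [← hQX]
      field_simp
    rw [h5]
    linarith [(abs_le.1 h1).2]
  · rw [le_div_iff₀ hX]
    exact hf.gap Q d hd hdist
  · rw [le_div_iff₀ hX, hS']
    have := hf.le_sq_a hν hσ
    rw [show (ν - Q) * Q * w t ^ 2 = (ν - Q) * (Q * w t ^ 2) by ring, hQX]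
    linarith

namespace ScalarFlow

lemma continuousOn_w (hF : ScalarFlow σ K p q w z) : ContinuousOn w (Ici 0) := by
  have h := hF.ac_w.continuousOn.sqrt
  simpa only [Real.sqrt_sq (hF.w_nonneg _)] using h

lemma continuousOn_z (hF : ScalarFlow σ K p q w z) : ContinuousOn z (Ici 0) := by
  have h := hF.ac_z.continuousOn.sqrt
  simpa only [Real.sqrt_sq (hF.z_nonneg _)] using h

lemma exists_bound (hF : ScalarFlow σ K p q w z) (hK : 0 ≤ K) (hp : 0 < p) (hq : 0 < q)
    {a b : ℝ} (ha : 0 ≤ a) : ∃ C : ℝ, 0 ≤ C ∧ ∀ᵐ t, t ∈ Ioo a b →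
      ∃ x h G₁ G₂, FlowAt σ K p q w z t x h G₁ G₂ ∧ h ≤ C * w t + C * z t := by
  have hsub : Icc a b ⊆ Ici (0 : ℝ) := fun x hx => ha.trans hx.1
  obtain ⟨C₁, h1⟩ := isCompact_Icc.exists_bound_of_continuousOn (hF.continuousOn_w.mono hsub)
  obtain ⟨C₂, h2⟩ := isCompact_Icc.exists_bound_of_continuousOn (hF.continuousOn_z.mono hsub)
  refine ⟨max (K * |C₁| ^ p) (K * |C₂| ^ q), le_max_of_le_left (by positivity), ?_⟩
  filter_upwards [hF.flow] with t ht hmem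
  obtain ⟨x, h, G₁, G₂, hf⟩ := ht (ha.trans_lt hmem.1)
  refine ⟨x, h, G₁, G₂, hf, (hf.h_le' (hF.w_nonneg t) (hF.z_nonneg t) hp hq).trans ?_⟩
  have hm : t ∈ Icc a b := ⟨hmem.1.le, hmem.2.le⟩
  have h3 : w t ≤ |C₁| := (le_abs_self _).trans ((h1 t hm).trans (le_abs_self _))
  have h4 : z t ≤ |C₂| := (le_abs_self _).trans ((h2 t hm).trans (le_abs_self _))
  refine add_le_add (mul_le_mul_of_nonneg_right (le_max_of_le_left ?_) (hF.w_nonneg t))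
    (mul_le_mul_of_nonneg_right (le_max_of_le_right ?_) (hF.z_nonneg t))
  · exact mul_le_mul_of_nonneg_left (Real.rpow_le_rpow (hF.w_nonneg t) h3 hp.le) hK
  · exact mul_le_mul_of_nonneg_left (Real.rpow_le_rpow (hF.z_nonneg t) h4 hq.le) hK

/-- Forward uniqueness of the null solution. -/
lemma eq_zero_of_eq_zero (hF : ScalarFlow σ K p q w z) (hK : 0 ≤ K) (hp : 0 < p) (hq : 0 < q)
    {a b : ℝ} (ha : 0 ≤ a) (hab : a ≤ b) (h0 : w a = 0) : w b = 0 := by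
  obtain ⟨C, hC, h⟩ := hF.exists_bound hK hp hq (b := b) ha
  -- With `m = 0` the value of `d` plays no role; it only has to differ from `c`.
  have h1 := gronwall_Icc (f := fun t => w t ^ 2) (c := -(2 * C + C ^ 2)) (d := 1) (m := 0)
    (by nlinarith) hab (hF.ac_w a b ha hab) (by
      filter_upwards [h] with t ht hmem
      obtain ⟨x, h, G₁, G₂, hf, hh⟩ := ht hmem
      refine ⟨_, hf.deriv_w, ?_⟩
      have := (hf.deriv_w_bounds (hF.w_nonneg t) hh).1
      nlinarith [sq_nonneg (z t)])
  simp only [h0, zero_div, zero_mul, sub_zero, ne_eq, OfNat.ofNat_ne_zero, not_false_eq_true,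
    zero_pow] at h1
  have h2 : w b ^ 2 ≤ 0 := by
    by_contra hcon
    exact absurd h1 (not_le.2 (mul_pos (not_le.1 hcon) (Real.exp_pos _)))
  exact pow_eq_zero_iff (two_ne_zero) |>.1 (le_antisymm h2 (sq_nonneg _))

lemma ac_quot (hF : ScalarFlow σ K p q w z) {a b : ℝ} (ha : 0 ≤ a) (hab : a ≤ b)
    (hpos : ∀ t ∈ Icc a b, 0 < w t) : AbsolutelyContinuousOnInterval (quot w z) a b := by
  refine (hF.ac_z a b ha hab).fun_mul (absolutelyContinuousOnInterval_inv (hF.ac_w a b ha hab) ?_)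
  intro x hx
  rw [uIcc_of_le hab] at hx
  exact pow_pos (hpos x hx) 2

/-- A solution which is nonzero at a given time does not vanish afterwards. -/
lemma pos_of_pos (hF : ScalarFlow σ K p q w z) (hK : 0 ≤ K) (hp : 0 < p) (hq : 0 < q)
    {a b : ℝ} (ha : 0 ≤ a) (hab : a ≤ b) (h0 : 0 < w a) : 0 < w b := by
  by_contra hcon
  have hb : w b = 0 := le_antisymm (not_lt.1 hcon) (hF.w_nonneg b)
  have hcont : ContinuousOn w (Icc a b) := hF.continuousOn_w.mono fun x hx => ha.trans hx.1
  have hcl : IsClosed (Icc a b ∩ w ⁻¹' {0}) :=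
    hcont.preimage_isClosed_of_isClosed isClosed_Icc isClosed_singleton
  obtain ⟨c, ⟨hc, hc0⟩, hleast⟩ := (isCompact_Icc.of_isClosed_subset hcl
    -- `c` is the first zero of `w`. Before it, `(1 + Q)' ≤ 2C²(1 + Q)` bounds `Q` by a constant,
    -- hence `(w²)' ≥ -D w²`, and `w² exp (D t)` cannot decrease to 0 at `c`.
    inter_subset_left).exists_isLeast ⟨b, ⟨hab, le_rfl⟩, hb⟩
  have hac : a < c := lt_of_le_of_ne hc.1 fun h => by
    rw [← h] at hc0
    exact h0.ne' hc0
  have hpos : ∀ t, a ≤ t → t < c → 0 < w t := fun t h1 h2 =>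
    lt_of_le_of_ne (hF.w_nonneg t) fun h =>
      absurd (hleast ⟨⟨h1, h2.le.trans hc.2⟩, h.symm⟩) (not_le.2 h2)
  obtain ⟨C, hC, hflow⟩ := hF.exists_bound hK hp hq (b := c) ha
  set M := (1 + quot w z a) * Real.exp (2 * C ^ 2 * (c - a)) with hM
  have hQa := quot_nonneg (w := w) (z := z) a
  have hMpos : 0 < M := by positivity
  have hQ : ∀ s, a ≤ s → s < c → 1 + quot w z s ≤ M := by
    intro s h1 h2
    have h3 := gronwall_Icc (f := fun t => 1 + quot w z t) (c := -(2 * C ^ 2)) (d := 1) (m := 0)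
      (by nlinarith) h1 (((absolutelyContinuousOnInterval_of_contDiff contDiff_const a s)).fun_add
        (hF.ac_quot ha h1 fun t ht => hpos t ht.1 (ht.2.trans_lt h2))) (by
        filter_upwards [hflow] with t ht hmem
        obtain ⟨x, h, G₁, G₂, hf, hh⟩ := ht ⟨hmem.1, hmem.2.trans h2⟩
        obtain ⟨Q', s', hQ', hle, hs', -⟩ :=
          hf.quot_deriv (hpos t hmem.1.le (hmem.2.trans h2)) hh
        refine ⟨_, hQ'.const_add 1, ?_⟩
        have := hs' 0 le_rfl fun _ _ => abs_nonneg _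
        nlinarith)
    simp only [zero_div, zero_mul, sub_zero] at h3
    have h4 : 1 + quot w z s ≤ (1 + quot w z a) * Real.exp (2 * C ^ 2 * (s - a)) := by
      have h5 : Real.exp (2 * C ^ 2 * (s - a)) =
          Real.exp (-(2 * C ^ 2) * a) / Real.exp (-(2 * C ^ 2) * s) := by
        rw [← Real.exp_sub]; ring_nf
      rw [h5, ← mul_div_assoc, le_div_iff₀ (Real.exp_pos _)]
      exact h3
    refine h4.trans ?_
    rw [hM]
    gcongr
  -- Chosen so that `2C + C² + 3Q ≤ (3 + 2C + C²)(1 + Q) ≤ D`.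
  set D := (3 + 2 * C + C ^ 2) * M with hD
  have hDpos : 0 < D := by positivity
  have hX : ∀ s, a ≤ s → s < c → w a ^ 2 * Real.exp (D * a) ≤ w s ^ 2 * Real.exp (D * s) := by
    intro s h1 h2
    have h3 := gronwall_Icc (f := fun t => -1 * w t ^ 2) (c := D) (d := -1) (m := 0)
      (by linarith) h1 ((hF.ac_w a s ha h1).const_mul (-1)) (by
        filter_upwards [hflow] with t ht hmem
        have htc := hmem.2.trans h2
        obtain ⟨x, h, G₁, G₂, hf, hh⟩ := ht ⟨hmem.1, htc⟩
        refine ⟨_, hf.deriv_w.const_mul (-1), ?_⟩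
        have h4 := (hf.deriv_w_bounds (hF.w_nonneg t) hh).2
        have h5 := hQ t hmem.1.le htc
        have h6 := quot_mul (z := z) (hpos t hmem.1.le htc)
        have h7 : (2 * C + C ^ 2) * w t ^ 2 + 3 * z t ^ 2 ≤ D * w t ^ 2 := by
          rw [← h6, hD, ← mul_assoc, ← add_mul]
          refine mul_le_mul_of_nonneg_right ?_ (sq_nonneg _)
          nlinarith [quot_nonneg (w := w) (z := z) t, sq_nonneg C]
        linarith)
    simp only [zero_div, zero_mul, sub_zero] at h3
    linarith
  have hlim : Tendsto (fun s => w s ^ 2 * Real.exp (D * s)) (𝓝[Ico a c] c)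
      (𝓝 (w c ^ 2 * Real.exp (D * c))) := by
    have h1 : ContinuousWithinAt (fun s => w s ^ 2 * Real.exp (D * s)) (Icc a b) c :=
      ((hcont c hc).pow 2).mul (by fun_prop)
    exact h1.mono fun x hx => ⟨hx.1, hx.2.le.trans hc.2⟩
  have hne : (𝓝[Ico a c] c).NeBot := by
    rw [← mem_closure_iff_nhdsWithin_neBot, closure_Ico hac.ne]
    exact ⟨hac.le, le_rfl⟩
  have h1 := ge_of_tendsto hlim (by
    filter_upwards [self_mem_nhdsWithin] with s hs
    exact hX s hs.1 hs.2)
  rw [show w c = 0 from hc0] at h1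
  have h2 : 0 < w a ^ 2 * Real.exp (D * a) := by positivity
  norm_num at h1
  linarith

end ScalarFlow

end ScalarFlow

/-! ### The dichotomy: `Q` tends to 0 (slow), or to a positive point of the spectrum (fast). -/

section ScalarAsymptotics

variable {σ : Set ℝ} {K p q ν : ℝ} {w z : ℝ → ℝ}

namespace ScalarFlow

lemma locallyAC_quot (hF : ScalarFlow σ K p q w z) (hw : ∀ t, 0 ≤ t → 0 < w t) :
    LocallyAC (quot w z) 0 := fun _ _ h1 h2 =>
  hF.ac_quot h1 h2 fun t ht => hw t (h1.trans ht.1)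

lemma ae_flow (hF : ScalarFlow σ K p q w z) (hp : 0 < p) (hq : 0 < q) :
    ∀ᵐ t, 0 < t → ∃ a h G₁ G₂, FlowAt σ K p q w z t a h G₁ G₂ ∧
      h ≤ K * w t ^ p * w t + K * z t ^ q * z t := by
  filter_upwards [hF.flow] with t ht hpos
  obtain ⟨a, h, G₁, G₂, hf⟩ := ht hpos
  exact ⟨a, h, G₁, G₂, hf, hf.h_le' (hF.w_nonneg t) (hF.z_nonneg t) hp hq⟩

lemma tendsto_const_mul_rpow {f : ℝ → ℝ} (hf : Tendsto f atTop (𝓝 0)) (hp : 0 < p) (K : ℝ) :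
    Tendsto (fun t => K * f t ^ p) atTop (𝓝 0) := by
  simpa [Real.zero_rpow hp.ne'] using (hf.rpow_const (p := p) (Or.inr hp.le)).const_mul K

/-- The Dirichlet quotient stays small once it is small at a late time. -/
lemma quot_le_half (hF : ScalarFlow σ K p q w z) (hp : 0 < p) (hq : 0 < q) (hν : 0 < ν)
    (hσ : ∀ x ∈ σ, x ≤ 0 ∨ ν ≤ x) (hw : ∀ t, 0 ≤ t → 0 < w t) {T : ℝ} (hT : 0 ≤ T)
    (hα : ∀ t, T ≤ t → (K * w t ^ p) ^ 2 ≤ ν ^ 2 / 32)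
    (hβ : ∀ t, T ≤ t → (K * z t ^ q) ^ 2 ≤ ν / 12) (h0 : quot w z T ≤ ν / 2) (t : ℝ)
    (ht : T ≤ t) : quot w z t ≤ ν / 2 := by
  have hac := (hF.locallyAC_quot hw).mono hT
  refine le_of_barrier hac.continuousOn h0 (fun x hx hxν => ?_) t ht
  have hcont : ContinuousWithinAt (quot w z) (Ici x) x :=
    (hac.continuousOn x hx).mono (Ici_subset_Ici.2 hx)
  -- In this window the dissipation `(ν - Q)Q` is at least `3ν²/16`, and the forcing is at most
  -- `2ν²/32 + 2(ν/12)(3ν/4) = 3ν²/16`. Hence `Q` cannot increase after reaching the level `ν / 2`.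
  have hnear : ∀ᶠ y in 𝓝[≥] x, quot w z y ∈ Icc (ν / 4) (3 * ν / 4) :=
    hcont.eventually (by rw [hxν]; exact Icc_mem_nhds (by linarith) (by linarith))
  obtain ⟨b, hb, hsub⟩ := mem_nhdsGE_iff_exists_Icc_subset.1 hnear
  filter_upwards [Ioo_mem_nhdsGT (show x < b from hb)] with y hy
  rw [← hxν]
  refine le_of_absolutelyContinuous_of_deriv_nonpos hy.1.le (hac x y hx hy.1.le) ?_
  filter_upwards [hF.ae_flow hp hq] with s hs hmem
  have hTs : T ≤ s := hx.trans hmem.1.le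
  have hs0 : 0 < s := hT.trans_lt (hx.trans_lt hmem.1)
  obtain ⟨a, h, G₁, G₂, hf, hh⟩ := hs hs0
  obtain ⟨Q', S, hQ', hle, -, hS⟩ := hf.quot_deriv (hw s hs0.le) hh
  refine ⟨Q', hQ', ?_⟩
  have h1 := hS ν hν.le hσ
  have h2 : quot w z s ∈ Icc (ν / 4) (3 * ν / 4) :=
    hsub ⟨hmem.1.le, (hmem.2.trans hy.2).le⟩
  have h3 := hα s hTs
  have h4 := mul_le_mul (hβ s hTs) h2.2 (quot_nonneg s) (by positivity)
  nlinarith [mul_nonneg (sub_nonneg.2 h2.1) (sub_nonneg.2 h2.2)]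

/-- While `Q ≤ ν/2`, dissipation is at least `(ν/2)Q` and the forcing proportional to `Q` costs at
most `(ν/6)Q`. So `Q' ≤ -(ν/4)Q + 2α²` with `α → 0`, and Gronwall pushes `Q` below `δ` once `2α² ≤
(ν/4)(δ/2)`. -/
lemma quot_tendsto_zero (hF : ScalarFlow σ K p q w z) (hp : 0 < p) (hq : 0 < q) (hν : 0 < ν)
    (hσ : ∀ x ∈ σ, x ≤ 0 ∨ ν ≤ x) (hw : ∀ t, 0 ≤ t → 0 < w t)
    (hw0 : Tendsto w atTop (𝓝 0)) {T : ℝ} (hT : 0 ≤ T)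
    (hβ : ∀ t, T ≤ t → (K * z t ^ q) ^ 2 ≤ ν / 12) (h0 : ∀ t, T ≤ t → quot w z t ≤ ν / 2)
    {δ : ℝ} (hδ : 0 < δ) : ∀ᶠ t in atTop, quot w z t ≤ δ := by
  have h1 : ∀ᶠ t in atTop, 2 * (K * w t ^ p) ^ 2 ≤ ν / 4 * (δ / 2) := by
    have h2 := ((tendsto_const_mul_rpow hw0 hp K).pow 2).const_mul 2
    norm_num at h2
    exact (h2.eventually (gt_mem_nhds (by positivity : (0 : ℝ) < ν / 4 * (δ / 2)))).mono
      fun t ht => ht.le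
  obtain ⟨T₁, hT₁⟩ := eventually_atTop.1 h1
  set S := max T T₁ with hS
  have hTS : T ≤ S := le_max_left _ _
  have h3 := gronwall_const (c := ν / 4) (m := ν / 4 * (δ / 2)) (by positivity)
    ((hF.locallyAC_quot hw).mono (hT.trans hTS)) (by
      filter_upwards [hF.ae_flow hp hq] with s hs hmem
      have hTs : T ≤ s := hTS.trans hmem.le
      have hs0 : 0 < s := (hT.trans hTS).trans_lt hmem
      obtain ⟨a, h, G₁, G₂, hf, hh⟩ := hs hs0
      obtain ⟨Q', r, hQ', hle, -, hr⟩ := hf.quot_deriv (hw s hs0.le) hh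
      refine ⟨Q', hQ', ?_⟩
      have h4 := hr ν hν.le hσ
      have h5 := hT₁ s ((le_max_right _ _).trans hmem.le)
      have h6 := mul_le_mul_of_nonneg_right (hβ s hTs) (quot_nonneg (w := w) (z := z) s)
      have h7 := mul_le_mul_of_nonneg_right (h0 s hTs) (quot_nonneg (w := w) (z := z) s)
      nlinarith [quot_nonneg (w := w) (z := z) s])
  have h4 : Tendsto (fun t => (ν / 4 * (δ / 2)) / (ν / 4) +
      (quot w z S - (ν / 4 * (δ / 2)) / (ν / 4)) * Real.exp (-(ν / 4) * (t - S))) atTop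
      (𝓝 ((ν / 4 * (δ / 2)) / (ν / 4) +
      (quot w z S - (ν / 4 * (δ / 2)) / (ν / 4)) * 0)) := by
    refine tendsto_const_nhds.add (Tendsto.const_mul _ (Real.tendsto_exp_atBot.comp ?_))
    exact (tendsto_atTop_add_const_right _ _ tendsto_id).const_mul_atTop_of_neg (by linarith)
  rw [mul_zero, add_zero] at h4
  simp only [mul_div_cancel_left₀ (δ / 2) (by positivity : ν / 4 ≠ 0)] at h3 h4
  filter_upwards [h4.eventually (gt_mem_nhds (half_lt_self hδ)), eventually_ge_atTop S] with t h5 h6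
  exact (h3 t h6).trans h5.le

/-- In the slow regime `z ≤ M w^{1+p}` for large times. -/
lemma exists_z_le (hF : ScalarFlow σ K p q w z) (hp : 0 < p) (hq : 0 < q) (hν : 0 < ν)
    (hσ : ∀ x ∈ σ, x ≤ 0 ∨ ν ≤ x) (hw : ∀ t, 0 ≤ t → 0 < w t)
    (hw0 : Tendsto w atTop (𝓝 0)) (hz0 : Tendsto z atTop (𝓝 0)) {T : ℝ} (hT : 0 ≤ T)
    (hβ : ∀ t, T ≤ t → (K * z t ^ q) ^ 2 ≤ ν / 12) (h0 : ∀ t, T ≤ t → quot w z t ≤ ν / 2) :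
    ∃ M S : ℝ, 0 < M ∧ 0 ≤ S ∧ ∀ t, S ≤ t → z t ≤ M * w t ^ (1 + p) := by
  -- Eventually `α`, `β²` and `Q` are below `δ`, so `-(w²)' ≤ (2α + β² + 3Q) w² ≤ 6δ w²`. With this
  -- `δ`, differentiating the weight `(w²)^(-p)` costs `6pδ = ν/8`, half of the decay rate `ν/4` of
  -- `Q`.
  set δ := ν / (48 * p) with hδdef
  have hδ : 0 < δ := by positivity
  have hpδ : p * (6 * δ) = ν / 8 := by rw [hδdef]; field_simp; norm_num
  have hα1 := (tendsto_const_mul_rpow hw0 hp K).eventually (gt_mem_nhds hδ)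
  have hβ1 : ∀ᶠ t in atTop, (K * z t ^ q) ^ 2 < δ := by
    have := (tendsto_const_mul_rpow hz0 hq K).pow 2
    norm_num at this
    exact this.eventually (gt_mem_nhds hδ)
  obtain ⟨T₁, hT₁⟩ := eventually_atTop.1
    ((hα1.and hβ1).and (hF.quot_tendsto_zero hp hq hν hσ hw hw0 hT hβ h0 hδ))
  set S := max T T₁ with hS
  have hTS : T ≤ S := le_max_left _ _
  have hS0 : 0 ≤ S := hT.trans hTS
  have hXpos : ∀ t, S ≤ t → 0 < w t ^ 2 := fun t ht => pow_pos (hw t (hS0.trans ht)) 2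
  have hacF : LocallyAC (fun t => quot w z t * (w t ^ 2) ^ (-p)) S :=
    ((hF.locallyAC_quot hw).mono hS0).mul ((hF.ac_w.mono hS0).rpow hXpos (-p))
  -- The weight is tuned so that `α² (w²)^(-p) = K²`: the forcing becomes constant, and `Q (w²)^(-p)
  -- = (z / w^(1+p))²` stays bounded.
  have h3 := gronwall_const (c := ν / 8) (m := 2 * K ^ 2) (by positivity) hacF (by
      filter_upwards [hF.ae_flow hp hq] with s hs hmem
      have hTs : T ≤ s := hTS.trans hmem.le
      have hs0 : 0 < s := hS0.trans_lt hmem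
      obtain ⟨a, h, G₁, G₂, hf, hh⟩ := hs hs0
      obtain ⟨Q', r, hQ', hle, -, hr⟩ := hf.quot_deriv (hw s hs0.le) hh
      have hX := hXpos s hmem.le
      refine ⟨_, hQ'.mul (hf.deriv_w.rpow_const (Or.inl hX.ne')), ?_⟩
      obtain ⟨⟨hα2, hβ2⟩, hQδ⟩ := hT₁ s ((le_max_right _ _).trans hmem.le)
      have h4 := hr ν hν.le hσ
      have h6 := mul_le_mul_of_nonneg_right (hβ s hTs) (quot_nonneg (w := w) (z := z) s)
      have h7 := mul_le_mul_of_nonneg_right (h0 s hTs) (quot_nonneg (w := w) (z := z) s)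
      have h8 := (hf.deriv_w_bounds (hw s hs0.le).le hh).2
      set Q := quot w z s
      set X := w s ^ 2
      have hQ0 : 0 ≤ Q := quot_nonneg s
      have hQX : Q * X = z s ^ 2 := quot_mul (hw s hs0.le)
      set α := K * w s ^ p
      set β := K * z s ^ q
      have hY : 0 < X ^ (-p) := Real.rpow_pos_of_pos hX _
      have hαY : α ^ 2 * X ^ (-p) = K ^ 2 := by
        have : (w s ^ p) ^ 2 = X ^ p := by
          rw [sq_rpow (hw s hs0.le).le, ← Real.rpow_natCast, ← Real.rpow_mul (hw s hs0.le).le]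
          congr 1
          push_cast
          ring
        rw [show α ^ 2 = K ^ 2 * (w s ^ p) ^ 2 by simp only [α]; ring, this, mul_assoc,
          ← Real.rpow_add hX, add_neg_cancel, Real.rpow_zero, mul_one]
      have hQ1 : Q' ≤ -(ν / 4) * Q + 2 * α ^ 2 := by nlinarith
      have hX' : -(2 * (G₁ - z s ^ 2)) ≤ 6 * δ * X := by
        rw [← hQX] at h8
        rw [← hQX]
        nlinarith
      have hYX : X ^ (-p - 1) * X = X ^ (-p) := by
        rw [Real.rpow_sub_one hX.ne']
        field_simp
      have hterm : 2 * (G₁ - z s ^ 2) * -p * X ^ (-p - 1) ≤ ν / 8 * X ^ (-p) := by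
        rw [← hYX, ← hpδ]
        have := mul_le_mul_of_nonneg_left hX'
          (mul_nonneg hp.le (Real.rpow_nonneg hX.le (-p - 1)))
        linarith
      calc Q' * X ^ (-p) + Q * (2 * (G₁ - z s ^ 2) * -p * X ^ (-p - 1))
          ≤ (-(ν / 4) * Q + 2 * α ^ 2) * X ^ (-p) + Q * (ν / 8 * X ^ (-p)) :=
            add_le_add (mul_le_mul_of_nonneg_right hQ1 hY.le)
              (mul_le_mul_of_nonneg_left hterm hQ0)
        _ = -(ν / 8) * (Q * X ^ (-p)) + 2 * (α ^ 2 * X ^ (-p)) := by ring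
        _ = _ := by rw [hαY])
  set L := quot w z S * (w S ^ 2) ^ (-p)
  set m := 2 * K ^ 2 / (ν / 8) with hm
  have hm0 : 0 ≤ m := by positivity
  have hL0 : 0 ≤ L := mul_nonneg (quot_nonneg S) (Real.rpow_nonneg (sq_nonneg _) _)
  refine ⟨√(m + L + 1), S, Real.sqrt_pos.2 (by positivity), hS0, fun t ht => ?_⟩
  have h4 : quot w z t * (w t ^ 2) ^ (-p) ≤ m + L + 1 := by
    refine (h3 t ht).trans ?_
    have h5 : Real.exp (-(ν / 8) * (t - S)) ≤ 1 := Real.exp_le_one_iff.2 (by nlinarith)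
    have h6 := Real.exp_pos (-(ν / 8) * (t - S))
    nlinarith
  have hwt := hw t (hS0.trans ht)
  have h5 : quot w z t ≤ (m + L + 1) * (w t ^ p) ^ 2 := by
    rw [sq_rpow hwt.le, show 2 * -p = -(p * 2) by ring, Real.rpow_neg hwt.le,
      Real.rpow_mul hwt.le, ← div_eq_mul_inv, div_le_iff₀ (by positivity)] at h4
    exact_mod_cast h4
  refine le_of_sq_le_sq ?_ (by positivity)
  rw [← quot_mul hwt, mul_pow, Real.sq_sqrt (by positivity), Real.rpow_one_add' hwt.le (by linarith),
    mul_pow, ← mul_assoc]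
  nlinarith [mul_le_mul_of_nonneg_right h5 (sq_nonneg (w t))]

/-- Slow solutions. -/
lemma slow (hF : ScalarFlow σ K p q w z) (hK : 0 ≤ K) (hp : 0 < p) (hq : 0 < q)
    (hw : ∀ t, 0 ≤ t → 0 < w t)
    (hw0 : Tendsto w atTop (𝓝 0)) (hz0 : Tendsto z atTop (𝓝 0)) {M S : ℝ} (hM : 0 < M)
    (hS : 0 ≤ S) (hz : ∀ t, S ≤ t → z t ≤ M * w t ^ (1 + p)) :
    ∃ M₁ M₂ : ℝ, 0 < M₁ ∧ 0 < M₂ ∧ (∀ t, 0 ≤ t → M₁ / (1 + t) ^ (1 / p) ≤ w t) ∧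
      (∀ t, 0 ≤ t → z t ≤ M₂ * w t ^ (1 + p)) := by
  obtain ⟨T₁, hT₁⟩ := eventually_atTop.1
    ((hw0.eventually (gt_mem_nhds one_pos)).and (hz0.eventually (gt_mem_nhds one_pos)))
  set T := max S T₁ with hT
  have hT0 : 0 ≤ T := hS.trans (le_max_left _ _)
  set C := M ^ 2 + K * (1 + M) with hC
  have hC0 : 0 < C := by positivity
  have hXpos : ∀ t, T ≤ t → 0 < w t ^ 2 := fun t ht => pow_pos (hw t (hT0.trans ht)) 2
  -- Since `-(w²)' ≤ 2C w^(2+p)`, the function `w^(-p) = (w²)^(-p/2)` has derivative at most `pC`.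
  have hanti := antitoneOn_of_deriv_nonpos
    (((hF.ac_w.mono hT0).rpow hXpos (-p / 2)).sub
      (locallyAC_of_contDiff (f := fun t => p * C * t) (by fun_prop) T)) (by
      filter_upwards [hF.flow] with s hs hmem
      have hs0 : 0 < s := hT0.trans_lt hmem
      obtain ⟨a, h, G₁, G₂, hf⟩ := hs hs0
      have hX := hXpos s hmem.le
      have hws := hw s hs0.le
      have hz' := hz s ((le_max_left _ _).trans hmem.le)
      obtain ⟨hw1, hz1⟩ := hT₁ s ((le_max_right _ _).trans hmem.le)
      refine ⟨_, (hf.deriv_w.rpow_const (Or.inl hX.ne')).sub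
        ((hasDerivAt_id s).const_mul (p * C)), ?_⟩
      have hzq : z s ^ (1 + q) ≤ z s := by
        have := Real.rpow_le_rpow_of_exponent_ge' (hF.z_nonneg s) hz1.le zero_le_one
          (show 1 ≤ 1 + q by linarith)
        simpa using this
      have hh : h ≤ K * (1 + M) * w s ^ (1 + p) := by
        refine hf.h_le.trans ?_
        rw [mul_assoc]
        refine mul_le_mul_of_nonneg_left ?_ hK
        linarith
      have hpow : w s ^ (1 + p) * w s = w s ^ (2 + p) := by
        rw [← Real.rpow_add_one hws.ne']
        ring_nf
      have hz2 : z s ^ 2 ≤ M ^ 2 * w s ^ (2 + p) := by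
        have h1 := pow_le_pow_left₀ (hF.z_nonneg s) hz' 2
        have h2 : (w s ^ (1 + p)) ^ 2 ≤ w s ^ (2 + p) := by
          rw [← hpow, pow_two]
          refine mul_le_mul_of_nonneg_left ?_ (by positivity)
          have := Real.rpow_le_rpow_of_exponent_ge hws hw1.le (show 1 ≤ 1 + p by linarith)
          simpa using this
        rw [mul_pow] at h1
        exact h1.trans (mul_le_mul_of_nonneg_left h2 (sq_nonneg _))
      have hX' : -(2 * (G₁ - z s ^ 2)) ≤ 2 * C * w s ^ (2 + p) := by
        have h1 := (abs_le.1 hf.abs_G₁_le).1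
        have h2 := mul_le_mul_of_nonneg_right hh hws.le
        rw [mul_assoc _ (w s ^ (1 + p)), hpow] at h2
        rw [hC]
        linarith
      have hone : w s ^ (2 + p) * (w s ^ 2) ^ (-p / 2 - 1) = 1 := by
        rw [sq_rpow hws.le, ← Real.rpow_add hws, show 2 + p + 2 * (-p / 2 - 1) = 0 by ring,
          Real.rpow_zero]
      have h3 := mul_le_mul_of_nonneg_left hX' (mul_nonneg (half_pos hp).le
        (Real.rpow_nonneg hX.le (-p / 2 - 1)))
      have h4 : p / 2 * (w s ^ 2) ^ (-p / 2 - 1) * (2 * C * w s ^ (2 + p)) = p * C := by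
        calc _ = p * C * (w s ^ (2 + p) * (w s ^ 2) ^ (-p / 2 - 1)) := by ring
          _ = _ := by rw [hone, mul_one]
      rw [h4] at h3
      linarith)
  have hcw : ContinuousOn w (Icc 0 T) := hF.continuousOn_w.mono Icc_subset_Ici_self
  have hcz : ContinuousOn z (Icc 0 T) := hF.continuousOn_z.mono Icc_subset_Ici_self
  obtain ⟨t₀, ht₀, hmin⟩ := isCompact_Icc.exists_isMinOn ⟨0, ⟨le_rfl, hT0⟩⟩ hcw
  obtain ⟨t₁, ht₁, hmax⟩ := isCompact_Icc.exists_isMaxOn ⟨0, ⟨le_rfl, hT0⟩⟩ hcz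
  have hw₀ : 0 < w t₀ := hw t₀ ht₀.1
  set D := w T ^ (-p) + p * C with hD
  have hwT := hw T hT0
  have hD0 : 0 < D := by positivity
  -- The estimates hold after `T`; on `[0, T]` the minimum of `w` and the maximum of `z` provide the
  -- constants.
  refine ⟨min (w t₀) (D ^ (-(1 / p))), M + z t₁ / w t₀ ^ (1 + p), lt_min hw₀ (by positivity),
    by have := hF.z_nonneg t₁; positivity, fun t ht => ?_, fun t ht => ?_⟩
  · have h1t : (0 : ℝ) < 1 + t := by linarith
    rw [div_le_iff₀ (by positivity)]
    rcases le_total t T with htT | htT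
    · refine (min_le_left _ _).trans ((show w t₀ ≤ w t from hmin ⟨ht, htT⟩).trans ?_)
      exact le_mul_of_one_le_right (hw t ht).le
        (Real.one_le_rpow (by linarith) (by positivity))
    · refine (min_le_right _ _).trans ?_
      have h1 := hanti (mem_Ici.2 le_rfl) (mem_Ici.2 htT) htT
      have h2 : ∀ s, 0 ≤ s → (w s ^ 2) ^ (-p / 2) = w s ^ (-p) := fun s hs => by
        rw [sq_rpow (hw s hs).le]; ring_nf
      simp only [h2 t ht, h2 T hT0] at h1
      have hwt := hw t ht
      have h3 : w t ^ (-p) ≤ D * (1 + t) := by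
        have h4 : 0 ≤ p * C * T := by positivity
        have h5 : 0 ≤ w T ^ (-p) * t := by positivity
        rw [hD]
        nlinarith [mul_pos hp hC0]
      have h4 := Real.rpow_le_rpow_of_nonpos (by positivity) h3
        (show -(1 / p) ≤ 0 by rw [neg_nonpos]; positivity)
      rw [← Real.rpow_mul hwt.le, show -p * -(1 / p) = 1 by field_simp, Real.rpow_one,
        Real.mul_rpow hD0.le h1t.le] at h4
      calc D ^ (-(1 / p)) = D ^ (-(1 / p)) * (1 + t) ^ (-(1 / p)) * (1 + t) ^ (1 / p) := by
            rw [mul_assoc, ← Real.rpow_add h1t, neg_add_cancel, Real.rpow_zero, mul_one]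
        _ ≤ _ := mul_le_mul_of_nonneg_right h4 (by positivity)
  · have hwt := hw t ht
    rw [add_mul]
    have hz1 := hF.z_nonneg t₁
    rcases le_total t T with htT | htT
    · have h1 : z t ≤ z t₁ := hmax ⟨ht, htT⟩
      have h2 : w t₀ ^ (1 + p) ≤ w t ^ (1 + p) :=
        Real.rpow_le_rpow hw₀.le (hmin ⟨ht, htT⟩) (by linarith)
      have h3 : z t₁ ≤ z t₁ / w t₀ ^ (1 + p) * w t ^ (1 + p) := by
        rw [div_mul_eq_mul_div, le_div_iff₀ (by positivity)]
        exact mul_le_mul_of_nonneg_left h2 hz1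
      have h4 : 0 ≤ M * w t ^ (1 + p) := by positivity
      linarith
    · have h1 := hz t ((le_max_left _ _).trans htT)
      have h2 : 0 ≤ z t₁ / w t₀ ^ (1 + p) * w t ^ (1 + p) := by positivity
      linarith

lemma exists_tendsto_of_antitoneOn {f : ℝ → ℝ} {a m : ℝ} (hf : AntitoneOn f (Ici a))
    (hm : ∀ t, a ≤ t → m ≤ f t) : ∃ l, Tendsto f atTop (𝓝 l) := by
  have hanti : Antitone fun t => f (max a t) := fun x y hxy =>
    hf (mem_Ici.2 (le_max_left _ _)) (mem_Ici.2 (le_max_left _ _)) (max_le_max le_rfl hxy)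
  have hbdd : BddBelow (range fun t => f (max a t)) :=
    ⟨m, by rintro _ ⟨t, rfl⟩; exact hm _ (le_max_left _ _)⟩
  refine ⟨_, (tendsto_atTop_ciInf hanti hbdd).congr' ?_⟩
  filter_upwards [eventually_ge_atTop a] with t ht
  rw [max_eq_right ht]

/-- In the fast regime the Dirichlet quotient tends to a positive element of the spectrum. -/
lemma fast (hF : ScalarFlow σ K p q w z) (hp : 0 < p) (hq : 0 < q) (hν : 0 < ν)
    (hσ : ∀ x ∈ σ, x ≤ 0 ∨ ν ≤ x) (hcl : IsClosed σ) (hw : ∀ t, 0 ≤ t → 0 < w t) {T : ℝ}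
    (hT : 0 ≤ T)
    (hα : ∀ t, T ≤ t → (K * w t ^ p) ^ 2 ≤ ν ^ 2 / 32)
    (hβ : ∀ t, T ≤ t → (K * z t ^ q) ^ 2 ≤ ν / 12) (h0 : ∀ t, T ≤ t → ν / 2 < quot w z t) :
    ∃ r ∈ σ, 0 < r ∧ Tendsto (quot w z) atTop (𝓝 r) := by
  have hXZ : ∀ t, T ≤ t → w t ^ 2 ≤ 2 / ν * z t ^ 2 := fun t ht => by
    have h1 := quot_mul (z := z) (hw t (hT.trans ht))
    have h2 := mul_le_mul_of_nonneg_right (h0 t ht).le (sq_nonneg (w t))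
    rw [h1] at h2
    rw [div_mul_eq_mul_div, le_div_iff₀ hν]
    linarith
  -- Here `(z²)' ≤ -a² + h² ≤ -(ν - ν/8 - ν/6) z²`, because `w² ≤ (2/ν) z²` when `Q > ν/2`.
  have hZ := gronwall (c := ν / 2) (d := 0) (m := 0) (by positivity) (hF.ac_z.mono hT) (by
      filter_upwards [hF.ae_flow hp hq] with s hs hmem
      obtain ⟨a, h, G₁, G₂, hf, hh⟩ := hs (hT.trans_lt hmem)
      refine ⟨_, hf.deriv_z, ?_⟩
      have h1 := hf.deriv_z_le
      have h2 := sq_h_le hf.h_nonneg hh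
      have h3 := hf.le_sq_a hν.le hσ
      have h4 : 2 * (K * w s ^ p) ^ 2 * w s ^ 2 ≤ 2 * (ν ^ 2 / 32) * (2 / ν * z s ^ 2) := by
        have := hα s hmem.le
        have := hXZ s hmem.le
        gcongr
      have h5 : 2 * (K * z s ^ q) ^ 2 * z s ^ 2 ≤ 2 * (ν / 12) * z s ^ 2 := by
        have := hβ s hmem.le
        gcongr
      have h6 : 2 * (ν ^ 2 / 32) * (2 / ν * z s ^ 2) = ν / 8 * z s ^ 2 := by
        field_simp
        ring
      rw [zero_mul, add_zero]
      nlinarith [mul_nonneg hν.le (sq_nonneg (z s))])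
  simp only [zero_div, zero_mul, sub_zero] at hZ
  set Z₀ := z T ^ 2 * Real.exp (ν / 2 * T) with hZ₀
  have hZ₀0 : 0 ≤ Z₀ := by positivity
  have hzexp : ∀ t, T ≤ t → z t ^ 2 ≤ Z₀ * Real.exp (-(ν / 2) * t) := fun t ht => by
    have h1 := hZ (mem_Ici.2 le_rfl) (mem_Ici.2 ht) ht
    have h2 : Real.exp (-(ν / 2) * t) = (Real.exp (ν / 2 * t))⁻¹ := by
      rw [← Real.exp_neg]; ring_nf
    rw [h2, ← div_eq_mul_inv, le_div_iff₀ (Real.exp_pos _)]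
    exact h1
  set c := min (ν / 2 * p) (ν / 2 * q) with hc
  have hc0 : 0 < c := by positivity
  set C := 2 * K ^ 2 * (2 / ν * Z₀) ^ p + 2 * K ^ 2 * Z₀ ^ q with hC
  have hpow : ∀ x y r : ℝ, 0 ≤ x → 0 ≤ y → 0 < r → c ≤ ν / 2 * r → ∀ t, 0 ≤ t →
      x ^ 2 ≤ y * Real.exp (-(ν / 2) * t) →
      2 * (K * x ^ r) ^ 2 ≤ 2 * K ^ 2 * y ^ r * Real.exp (-c * t) := by
    intro x y r hx hy hr hcr t ht hle
    have h1 : (x ^ r) ^ 2 = (x ^ 2) ^ r := by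
      rw [sq_rpow hx, ← Real.rpow_natCast, ← Real.rpow_mul hx]
      ring_nf
    have h2 : (x ^ 2) ^ r ≤ y ^ r * Real.exp (-c * t) := by
      refine (Real.rpow_le_rpow (sq_nonneg x) hle hr.le).trans ?_
      rw [Real.mul_rpow hy (Real.exp_pos _).le, ← Real.exp_mul]
      refine mul_le_mul_of_nonneg_left (Real.exp_le_exp.2 ?_) (by positivity)
      nlinarith [mul_le_mul_of_nonneg_right hcr ht]
    rw [mul_pow, h1]
    nlinarith [mul_le_mul_of_nonneg_left h2 (by positivity : 0 ≤ 2 * K ^ 2)]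
  have hηα : ∀ t, T ≤ t →
      2 * (K * w t ^ p) ^ 2 ≤ 2 * K ^ 2 * (2 / ν * Z₀) ^ p * Real.exp (-c * t) := fun t ht => by
    refine hpow _ _ _ (hF.w_nonneg t) (by positivity) hp (min_le_left _ _) t (hT.trans ht) ?_
    rw [mul_assoc]
    exact (hXZ t ht).trans (mul_le_mul_of_nonneg_left (hzexp t ht) (by positivity))
  have hηβ : ∀ t, T ≤ t → 2 * (K * z t ^ q) ^ 2 ≤ 2 * K ^ 2 * Z₀ ^ q * Real.exp (-c * t) :=
    fun t ht => hpow _ _ _ (hF.z_nonneg t) hZ₀0 hq (min_le_right _ _) t (hT.trans ht) (hzexp t ht)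
  have hC0 : 0 ≤ C := by positivity
  have hexp : ∀ t, HasDerivAt (fun t => Real.exp (C / c * Real.exp (-c * t)))
      (Real.exp (C / c * Real.exp (-c * t)) * (-C * Real.exp (-c * t))) t := fun t => by
    have h1 : HasDerivAt (fun t => Real.exp (-c * t)) (Real.exp (-c * t) * -c) t := by
      simpa using ((hasDerivAt_id t).const_mul (-c)).exp
    convert (h1.const_mul (C / c)).exp using 1
    field_simp
  -- The coefficients of the forcing decay like `exp (-c t)`, so `Q' ≤ -s + C exp (-c t) (1 + Q)`.
  -- The derivative of the extra factor absorbs the last term, and the factor tends to 1.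
  have hQ' : ∀ᵐ t, T < t → ∃ G' s : ℝ,
      HasDerivAt (fun t => (1 + quot w z t) * Real.exp (C / c * Real.exp (-c * t))) G' t ∧
      G' ≤ -s ∧ 0 ≤ s ∧ (∀ d : ℝ, 0 ≤ d → (∀ x ∈ σ, d ≤ |x - quot w z t|) → d ^ 2 ≤ s) := by
    filter_upwards [hF.ae_flow hp hq] with s hs hmem
    have hs0 := hT.trans_lt hmem
    obtain ⟨a, h, G₁, G₂, hf, hh⟩ := hs hs0
    obtain ⟨Q', r, hQ', hle, hr, -⟩ := hf.quot_deriv (hw s hs0.le) hh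
    have hr0 : 0 ≤ r := by simpa using hr 0 le_rfl fun _ _ => abs_nonneg _
    refine ⟨_, r, (hQ'.const_add 1).mul (hexp s), ?_, hr0, hr⟩
    set e := Real.exp (C / c * Real.exp (-c * s))
    have he : 1 ≤ e := Real.one_le_exp (by positivity)
    have h1 := hηα s hmem.le
    have h2 := hηβ s hmem.le
    have hQ0 := quot_nonneg (w := w) (z := z) s
    have h3 : Q' ≤ -r + C * Real.exp (-c * s) * (1 + quot w z s) := by
      have h4 : 2 * (K * w s ^ p) ^ 2 ≤ C * Real.exp (-c * s) := by
        refine h1.trans (mul_le_mul_of_nonneg_right ?_ (Real.exp_pos _).le)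
        rw [hC]
        have : 0 ≤ 2 * K ^ 2 * Z₀ ^ q := by positivity
        linarith
      have h5 : 2 * (K * z s ^ q) ^ 2 ≤ C * Real.exp (-c * s) := by
        refine h2.trans (mul_le_mul_of_nonneg_right ?_ (Real.exp_pos _).le)
        rw [hC]
        have : 0 ≤ 2 * K ^ 2 * (2 / ν * Z₀) ^ p := by positivity
        linarith
      nlinarith [mul_le_mul_of_nonneg_right h5 hQ0]
    have h4 := mul_le_mul_of_nonneg_right h3 (zero_le_one.trans he)
    nlinarith
  have hac : LocallyAC
      (fun t => (1 + quot w z t) * Real.exp (C / c * Real.exp (-c * t))) T :=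
    ((locallyAC_of_contDiff contDiff_const T).add ((hF.locallyAC_quot hw).mono hT)).mul
      (locallyAC_of_contDiff (by fun_prop) T)
  have hanti := antitoneOn_of_deriv_nonpos hac (by
    filter_upwards [hQ'] with t ht hmem
    obtain ⟨G', s, h1, h2, h3, -⟩ := ht hmem
    exact ⟨G', h1, by linarith⟩)
  have hGpos : ∀ t, 0 ≤ (1 + quot w z t) * Real.exp (C / c * Real.exp (-c * t)) := fun t => by
    have := quot_nonneg (w := w) (z := z) t
    positivity
  obtain ⟨l, hl⟩ := exists_tendsto_of_antitoneOn hanti fun t _ => hGpos t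
  have hE : Tendsto (fun t => Real.exp (C / c * Real.exp (-c * t))) atTop (𝓝 1) := by
    have h1 : Tendsto (fun t => Real.exp (-c * t)) atTop (𝓝 0) :=
      Real.tendsto_exp_atBot.comp (tendsto_id.const_mul_atTop_of_neg (by linarith))
    simpa [Function.comp_def] using (Real.continuous_exp.tendsto _).comp (h1.const_mul (C / c))
  have hQl : Tendsto (quot w z) atTop (𝓝 (l - 1)) := by
    have h1 := (hl.div hE one_ne_zero).sub_const 1
    rw [div_one] at h1
    refine h1.congr fun t => ?_
    rw [Pi.div_apply, mul_div_assoc, div_self (Real.exp_pos _).ne', mul_one, add_sub_cancel_left]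
  refine ⟨l - 1, ?_, ?_, hQl⟩
  -- If the limit had a neighbourhood of radius `ε` free of spectrum, the dissipation would
  -- eventually be at least `(ε/2)²`, and a nonnegative function would decrease at least linearly.
  · by_contra hnot
    obtain ⟨ε, hε, hball⟩ := Metric.isOpen_iff.1 hcl.isOpen_compl (l - 1) hnot
    obtain ⟨T₁, hT₁⟩ := eventually_atTop.1 (hQl.eventually (Metric.ball_mem_nhds _ (half_pos hε)))
    set T₂ := max T T₁
    have hanti2 := antitoneOn_of_deriv_nonpos ((hac.mono (le_max_left T T₁)).add
      (locallyAC_of_contDiff (f := fun t => (ε / 2) ^ 2 * t) (by fun_prop) _)) (by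
      filter_upwards [hQ'] with t ht hmem
      obtain ⟨G', s, h1, h2, h3, h4⟩ := ht ((le_max_left T T₁).trans_lt hmem)
      refine ⟨_, h1.add ((hasDerivAt_id t).const_mul ((ε / 2) ^ 2)), ?_⟩
      have h5 := h4 (ε / 2) (half_pos hε).le fun x hx => by
        have h6 : ε ≤ dist x (l - 1) := by
          by_contra hlt
          exact hball (not_le.1 hlt) hx
        have h7 : dist (quot w z t) (l - 1) < ε / 2 := hT₁ t ((le_max_right T T₁).trans hmem.le)
        have h8 := dist_triangle x (quot w z t) (l - 1)
        rw [← Real.dist_eq]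
        linarith
      linarith)
    set B := (1 + quot w z T₂) * Real.exp (C / c * Real.exp (-c * T₂)) + (ε / 2) ^ 2 * T₂ with hB
    have h1 : ∀ t, T₂ ≤ t → (ε / 2) ^ 2 * t ≤ B := fun t ht => by
      have h2 := hanti2 (mem_Ici.2 le_rfl) (mem_Ici.2 ht) ht
      simp only at h2
      linarith [hGpos t]
    have h2 := h1 (max T₂ (B / (ε / 2) ^ 2 + 1)) (le_max_left _ _)
    have h3 := mul_le_mul_of_nonneg_left (le_max_right T₂ (B / (ε / 2) ^ 2 + 1))
      (sq_nonneg (ε / 2))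
    rw [mul_add, mul_div_cancel₀ _ (by positivity)] at h3
    have : 0 < (ε / 2) ^ 2 := by positivity
    linarith
  · have : ν / 2 ≤ l - 1 := ge_of_tendsto hQl (by
      filter_upwards [eventually_ge_atTop T] with t ht
      exact (h0 t ht).le)
    linarith

/-- Either the solution is slow, or its Dirichlet quotient tends to a positive eigenvalue. -/
theorem slow_or_fast (hF : ScalarFlow σ K p q w z) (hK : 0 ≤ K) (hp : 0 < p) (hq : 0 < q)
    (hν : 0 < ν) (hσ : ∀ x ∈ σ, x ≤ 0 ∨ ν ≤ x) (hcl : IsClosed σ)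
    (hw : ∀ t, 0 ≤ t → 0 < w t) (hw0 : Tendsto w atTop (𝓝 0)) (hz0 : Tendsto z atTop (𝓝 0)) :
    (∃ M₁ M₂ : ℝ, 0 < M₁ ∧ 0 < M₂ ∧ (∀ t, 0 ≤ t → M₁ / (1 + t) ^ (1 / p) ≤ w t) ∧
      (∀ t, 0 ≤ t → z t ≤ M₂ * w t ^ (1 + p))) ∨
    ∃ r ∈ σ, 0 < r ∧ Tendsto (quot w z) atTop (𝓝 r) := by
  have hsmall : ∀ (f : ℝ → ℝ) (r m : ℝ), 0 < r → 0 < m → Tendsto f atTop (𝓝 0) →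
      ∀ᶠ t in atTop, (K * f t ^ r) ^ 2 ≤ m := fun f r m hr hm hf => by
    have h1 := (tendsto_const_mul_rpow hf hr K).pow 2
    rw [zero_pow two_ne_zero] at h1
    exact (h1.eventually (gt_mem_nhds hm)).mono fun t ht => ht.le
  obtain ⟨T₁, hT₁⟩ := eventually_atTop.1 ((hsmall w p (ν ^ 2 / 32) hp (by positivity) hw0).and
    (hsmall z q (ν / 12) hq (by positivity) hz0))
  set T := max 0 T₁
  have hT : 0 ≤ T := le_max_left _ _
  have hα : ∀ t, T ≤ t → (K * w t ^ p) ^ 2 ≤ ν ^ 2 / 32 := fun t ht =>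
    (hT₁ t ((le_max_right _ _).trans ht)).1
  have hβ : ∀ t, T ≤ t → (K * z t ^ q) ^ 2 ≤ ν / 12 := fun t ht =>
    (hT₁ t ((le_max_right _ _).trans ht)).2
  -- The dichotomy: one late visit of `Q` below `ν / 2` already forces the slow regime.
  by_cases h : ∃ t₁, T ≤ t₁ ∧ quot w z t₁ ≤ ν / 2
  · left
    obtain ⟨t₁, ht₁, hq₁⟩ := h
    have h1 := hF.quot_le_half hp hq hν hσ hw (hT.trans ht₁) (fun t ht => hα t (ht₁.trans ht))
      (fun t ht => hβ t (ht₁.trans ht)) hq₁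
    obtain ⟨M, S, hM, hS, hz⟩ := hF.exists_z_le hp hq hν hσ hw hw0 hz0 (hT.trans ht₁)
      (fun t ht => hβ t (ht₁.trans ht)) h1
    exact hF.slow hK hp hq hw hw0 hz0 hM hS hz
  · right
    push Not at h
    exact hF.fast hp hq hν hσ hcl hw hT hα hβ h

end ScalarFlow

end ScalarAsymptotics

/-! ### Lower bounds for `A - c`, totality of the eigenvectors, orthogonal expansions. -/

section SpectralTheory

variable {𝕜 H : Type*} [RCLike 𝕜] [NormedAddCommGroup H] [InnerProductSpace 𝕜 H]

/-- A bounded symmetric operator vanishes if both `‖T‖` and `-‖T‖` fail to be approximate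
eigenvalues. -/
lemma eq_zero_of_bounded_below (T : H →L[𝕜] H)
    (hT : ∀ x y, inner 𝕜 (T x) y = inner 𝕜 x (T y))
    (hb : ∀ μ : ℝ, |μ| = ‖T‖ → μ ≠ 0 → ∃ C : ℝ, ∀ x, ‖x‖ ≤ C * ‖T x - (μ : 𝕜) • x‖) : T = 0 := by
  by_contra hne
  set m := ‖T‖ with hm
  have hm0 : 0 < m := norm_pos_iff.2 hne
  obtain ⟨C₁, h1⟩ := hb m (abs_of_pos hm0) hm0.ne'
  obtain ⟨C₂, h2⟩ := hb (-m) (by rw [abs_neg, abs_of_pos hm0]) (by linarith)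
  set C := |C₁| * |C₂| with hC
  -- Factor `T² - m² = (T + m)(T - m)`. By symmetry `|T²x - m²x|² ≤ m²(m²|x|² - |Tx|²)`, so a lower
  -- bound for `T² - m²` keeps `|Tx|` strictly below `m|x|`, uniformly, against `m = ‖T‖`.
  have h3 : ∀ x, ‖x‖ ≤ C * ‖T (T x) - ((m ^ 2 : ℝ) : 𝕜) • x‖ := by
    intro x
    have e : T (T x - (m : 𝕜) • x) - ((-m : ℝ) : 𝕜) • (T x - (m : 𝕜) • x) =
        T (T x) - ((m ^ 2 : ℝ) : 𝕜) • x := by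
      simp only [map_sub, map_smul, smul_sub, smul_smul]
      push_cast
      rw [neg_smul, neg_mul, neg_smul, pow_two]
      abel
    calc ‖x‖ ≤ C₁ * ‖T x - (m : 𝕜) • x‖ := h1 x
      _ ≤ |C₁| * ‖T x - (m : 𝕜) • x‖ := by gcongr; exact le_abs_self _
      _ ≤ |C₁| * (|C₂| * ‖T (T x) - ((m ^ 2 : ℝ) : 𝕜) • x‖) := by
          gcongr
          rw [← e]
          exact (h2 _).trans (by gcongr; exact le_abs_self _)
      _ = _ := by rw [hC]; ring
  have h4 : ∀ x, ‖T (T x) - ((m ^ 2 : ℝ) : 𝕜) • x‖ ^ 2 ≤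
      m ^ 2 * (m ^ 2 * ‖x‖ ^ 2 - ‖T x‖ ^ 2) := by
    intro x
    have e : RCLike.re (inner 𝕜 (T (T x)) (((m ^ 2 : ℝ) : 𝕜) • x)) = m ^ 2 * ‖T x‖ ^ 2 := by
      rw [inner_smul_right, hT, RCLike.re_ofReal_mul, inner_self_eq_norm_sq]
    rw [@norm_sub_sq 𝕜, e, norm_smul, RCLike.norm_ofReal, mul_pow, sq_abs]
    have h5 : ‖T (T x)‖ ^ 2 ≤ (m * ‖T x‖) ^ 2 :=
      pow_le_pow_left₀ (norm_nonneg _) (T.le_opNorm _) 2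
    nlinarith
  have hCpos : 0 < C := by
    refine lt_of_le_of_ne (by positivity) fun h => hne ?_
    ext x
    have := h3 x
    rw [← h, zero_mul] at this
    simp [norm_le_zero_iff.1 this]
  have h5 : ∀ x, ‖T x‖ ^ 2 ≤ (m ^ 2 - 1 / (C ^ 2 * m ^ 2)) * ‖x‖ ^ 2 := by
    intro x
    have h6 := pow_le_pow_left₀ (norm_nonneg _) (h3 x) 2
    rw [mul_pow] at h6
    have h7 := h6.trans (mul_le_mul_of_nonneg_left (h4 x) (sq_nonneg C))
    have h8 : 1 / (C ^ 2 * m ^ 2) * ‖x‖ ^ 2 ≤ m ^ 2 * ‖x‖ ^ 2 - ‖T x‖ ^ 2 := by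
      rw [div_mul_eq_mul_div, one_mul, div_le_iff₀ (by positivity)]
      linarith
    linarith
  have h6 : m ≤ √(m ^ 2 - 1 / (C ^ 2 * m ^ 2)) := by
    refine T.opNorm_le_bound (Real.sqrt_nonneg _) fun x => ?_
    rw [← Real.sqrt_sq (norm_nonneg (T x)), ← Real.sqrt_sq (norm_nonneg x),
      ← Real.sqrt_mul' _ (sq_nonneg _)]
    exact Real.sqrt_le_sqrt (h5 x)
  have h7 := (Real.le_sqrt' hm0).1 h6
  have h8 : 0 < 1 / (C ^ 2 * m ^ 2) := by positivity
  linarith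

/-- With `A' = A x` and `x = (A - c)⁻¹ y`, one has `(A - c - μ⁻¹) x = -μ⁻¹ (x - μ y)`. So a lower
bound for `A - (c + μ⁻¹)` becomes one for the resolvent minus `μ`. -/
lemma norm_le_of_norm_le_sub {x y : H} {A' : H} {c μ C : ℝ} (hμ : μ ≠ 0)
    (hy : A' - (c : 𝕜) • x = y) (h : ‖x‖ ≤ C * ‖A' - ((c + μ⁻¹ : ℝ) : 𝕜) • x‖) :
    ‖y‖ ≤ |μ|⁻¹ * (|μ|⁻¹ * C + 1) * ‖x - (μ : 𝕜) • y‖ := by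
  have hμ' : (μ : 𝕜) ≠ 0 := RCLike.ofReal_ne_zero.2 hμ
  have e1 : A' - ((c + μ⁻¹ : ℝ) : 𝕜) • x = -((μ : 𝕜)⁻¹ • (x - (μ : 𝕜) • y)) := by
    rw [smul_sub, smul_smul, inv_mul_cancel₀ hμ', one_smul, ← hy]
    push_cast
    rw [add_smul]
    abel
  have e2 : y = (μ : 𝕜)⁻¹ • (x - (x - (μ : 𝕜) • y)) := by
    rw [sub_sub_cancel, smul_smul, inv_mul_cancel₀ hμ', one_smul]
  rw [e1, norm_neg, norm_smul, norm_inv, RCLike.norm_ofReal] at h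
  calc ‖y‖ = |μ|⁻¹ * ‖x - (x - (μ : 𝕜) • y)‖ := by
        conv_lhs => rw [e2, norm_smul, norm_inv, RCLike.norm_ofReal]
    _ ≤ |μ|⁻¹ * (‖x‖ + ‖x - (μ : 𝕜) • y‖) := by gcongr; exact norm_sub_le _ _
    _ ≤ |μ|⁻¹ * (C * (|μ|⁻¹ * ‖x - (μ : 𝕜) • y‖) + ‖x - (μ : 𝕜) • y‖) := by gcongr
    _ = _ := by ring

/-- The operator `A - r`, as a linear map on the domain of `A`. -/
noncomputable def shift (A : H →ₗ.[𝕜] H) (r : ℝ) : A.domain →ₗ[𝕜] H :=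
  A.toFun - (r : 𝕜) • A.domain.subtype

lemma shift_apply (A : H →ₗ.[𝕜] H) (r : ℝ) (x : A.domain) :
    shift A r x = A x - (r : 𝕜) • (x : H) := rfl

/-- The kernel of `A - r`, defined as the orthogonal complement of its range. -/
noncomputable def eigenspace (A : H →ₗ.[𝕜] H) (r : ℝ) : Submodule 𝕜 H :=
  (LinearMap.range (shift A r))ᗮ

variable [CompleteSpace H] {A : H →ₗ.[𝕜] H}

lemma mem_graph_iff_of_isSelfAdjoint (hA : IsSelfAdjoint A) (x y : H) :
    (x, y) ∈ A.graph ↔ ∀ a : A.domain, inner 𝕜 (A a) x = inner 𝕜 (a : H) y := by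
  have h := LinearPMap.adjoint_graph_eq_graph_adjoint hA.dense_domain
  rw [LinearPMap.isSelfAdjoint_def.1 hA] at h
  conv_lhs => rw [h]
  rw [Submodule.mem_adjoint_iff]
  constructor
  · exact fun h a => sub_eq_zero.1 (h a (A a) (A.mem_graph a))
  · rintro h a b hab
    obtain ⟨a', rfl, rfl⟩ := A.mem_graph_iff.1 hab
    exact sub_eq_zero.2 (h a')

lemma inner_symm (hA : IsSelfAdjoint A) (x y : A.domain) :
    inner 𝕜 (A x) (y : H) = inner 𝕜 (x : H) (A y) :=
  (mem_graph_iff_of_isSelfAdjoint hA _ _).1 (A.mem_graph y) x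

/-- Orthogonality to the range is the weak form of `A v = r v`; self-adjointness upgrades it,
including membership in the domain. -/
lemma mem_eigenspace_iff (hA : IsSelfAdjoint A) {r : ℝ} {v : H} :
    v ∈ eigenspace A r ↔ ∃ h : v ∈ A.domain, A ⟨v, h⟩ = (r : 𝕜) • v := by
  have h1 : v ∈ eigenspace A r ↔ (v, (r : 𝕜) • v) ∈ A.graph := by
    rw [mem_graph_iff_of_isSelfAdjoint hA, eigenspace, Submodule.mem_orthogonal]
    simp only [LinearMap.mem_range, forall_exists_index, forall_apply_eq_imp_iff, shift_apply,
      inner_sub_left, inner_smul_left, inner_smul_right, RCLike.conj_ofReal, sub_eq_zero]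
  rw [h1, LinearPMap.mem_graph_iff]
  constructor
  · rintro ⟨⟨y, hy⟩, h2, h3⟩
    obtain rfl : y = v := h2
    exact ⟨hy, h3⟩
  · rintro ⟨h, h2⟩
    exact ⟨⟨v, h⟩, rfl, h2⟩

lemma resolvent_symm (hA : IsSelfAdjoint A) {c : ℝ} {R : H →L[𝕜] H}
    (hR : ∀ y : H, ∃ h : R y ∈ A.domain, A ⟨R y, h⟩ - (c : 𝕜) • R y = y) (x y : H) :
    inner 𝕜 (R x) y = inner 𝕜 x (R y) := by
  obtain ⟨hx, ex⟩ := hR x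
  obtain ⟨hy, ey⟩ := hR y
  conv_lhs => rw [← ey]
  conv_rhs => rw [← ex]
  rw [inner_sub_left, inner_sub_right, inner_smul_left, inner_smul_right, RCLike.conj_ofReal]
  congr 1
  exact (inner_symm hA ⟨R x, hx⟩ ⟨R y, hy⟩).symm

/-- The distance of a number to the spectrum bounds `A - c` from below. -/
lemma gap_bound (hA : IsSelfAdjoint A) {c d : ℝ} (hd : 0 < d)
    (h : ∀ s : ℝ, |s - c| < d → InResolventSet A (s : 𝕜)) (x : A.domain) :
    d * ‖(x : H)‖ ≤ ‖A x - (c : 𝕜) • (x : H)‖ := by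
  obtain ⟨R, hR1, hR2⟩ := h c (by simpa using hd)
  have hnorm : ‖R‖ ≤ d⁻¹ := by
    by_contra hcon
    rw [not_le] at hcon
    have hR0 : R = 0 := by
      -- If `|μ| = ‖R‖ > 1/d`, then `c + μ⁻¹` is within `d` of `c`, hence in the resolvent set, and
      -- `μ` is not an approximate eigenvalue of `R`.
      refine eq_zero_of_bounded_below R (resolvent_symm hA hR2) fun μ hμ hμ0 => ?_
      obtain ⟨S, hS, -⟩ := h (c + μ⁻¹) (by
        rw [add_sub_cancel_left, abs_inv, hμ]
        exact inv_lt_of_inv_lt₀ hd hcon)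
      refine ⟨_, fun y => norm_le_of_norm_le_sub (C := ‖S‖) hμ0 (hR2 y).choose_spec ?_⟩
      obtain ⟨hy, ey⟩ := hR2 y
      have := S.le_opNorm (A ⟨R y, hy⟩ - ((c + μ⁻¹ : ℝ) : 𝕜) • R y)
      rwa [hS ⟨R y, hy⟩] at this
    rw [hR0, norm_zero] at hcon
    exact absurd hcon (not_lt.2 (inv_pos.2 hd).le)
  have h1 := R.le_of_opNorm_le hnorm (A x - (c : 𝕜) • (x : H))
  rw [hR1 x] at h1
  rwa [inv_mul_eq_div, le_div_iff₀ hd, mul_comm] at h1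

/-- If `r` is isolated from the rest of the spectrum, then `A - r` is bounded from below on the
orthogonal complement of its kernel. -/
lemma isolated_bound (hA : IsSelfAdjoint A) {r δ : ℝ} (hδ : 0 < δ)
    (h : ∀ s : ℝ, s ≠ r → |s - r| < δ → InResolventSet A (s : 𝕜)) (x : A.domain)
    (hx : (x : H) ∈ (eigenspace A r)ᗮ) :
    δ * ‖(x : H)‖ ≤ ‖A x - (r : 𝕜) • (x : H)‖ := by
  set D := shift A r with hD
  have hsymm : ∀ a b : A.domain, inner 𝕜 (D a) (b : H) = inner 𝕜 (a : H) (D b) := fun a b => by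
    rw [hD, shift_apply, shift_apply, inner_sub_left, inner_sub_right, inner_smul_left,
      inner_smul_right, RCLike.conj_ofReal, inner_symm hA]
  -- The points `r ± δ/2` are at distance at least `δ/2` from the spectrum, so `±δ Re ⟨Da, a⟩ ≤
  -- |Da|²`. Polarization gives `hpol`, an inequality in which `b` occurs only through `Db`.
  have hgap : ∀ ε : ℝ, |ε| = δ / 2 → ∀ a : A.domain,
      2 * ε * RCLike.re (inner 𝕜 (D a) (a : H)) ≤ ‖D a‖ ^ 2 := by
    intro ε hε a
    have h1 := gap_bound hA (c := r + ε) (d := δ / 2) (by positivity) (fun s hs => by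
      refine h s ?_ ?_
      · rintro rfl
        rw [show s - (s + ε) = -ε by ring, abs_neg, hε] at hs
        exact lt_irrefl _ hs
      · calc |s - r| = |s - (r + ε) + ε| := by ring_nf
          _ ≤ |s - (r + ε)| + |ε| := abs_add_le _ _
          _ < δ := by linarith) a
    have e : A a - ((r + ε : ℝ) : 𝕜) • (a : H) = D a - (ε : 𝕜) • (a : H) := by
      rw [hD, shift_apply]
      push_cast
      rw [add_smul]
      abel
    rw [e] at h1
    have h2 := pow_le_pow_left₀ (by positivity) h1 2
    rw [@norm_sub_sq 𝕜, inner_smul_right, RCLike.re_ofReal_mul, norm_smul, RCLike.norm_ofReal, hε]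
      at h2
    nlinarith
  have hpol : ∀ a b : A.domain,
      2 * δ * RCLike.re (inner 𝕜 (a : H) (D b)) ≤ ‖D a‖ ^ 2 + ‖D b‖ ^ 2 := by
    intro a b
    have h1 := hgap (δ / 2) (abs_of_pos (by positivity)) (a + b)
    have h2 := hgap (-(δ / 2)) (by rw [abs_neg, abs_of_pos (by positivity)]) (a - b)
    simp only [map_add, map_sub, Submodule.coe_add, Submodule.coe_sub, inner_add_left,
      inner_add_right, inner_sub_left, inner_sub_right] at h1 h2
    rw [@norm_add_sq 𝕜] at h1
    rw [@norm_sub_sq 𝕜] at h2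
    have e1 : RCLike.re (inner 𝕜 (D a) (b : H)) = RCLike.re (inner 𝕜 (a : H) (D b)) := by
      rw [hsymm]
    have e2 : RCLike.re (inner 𝕜 (D b) (a : H)) = RCLike.re (inner 𝕜 (a : H) (D b)) := by
      rw [← inner_conj_symm, RCLike.conj_re]
    rw [e1, e2] at h1 h2
    nlinarith
  -- `x` is orthogonal to the kernel, hence a limit of vectors `D b`. Putting `δ • b` in `hpol` and
  -- letting `D b → x` yields `2δ²|x|² ≤ |Dx|² + δ²|x|²`.
  have hclosed : IsClosed {v : H |
      2 * δ * RCLike.re (inner 𝕜 (x : H) ((δ : 𝕜) • v)) ≤ ‖D x‖ ^ 2 + ‖(δ : 𝕜) • v‖ ^ 2} := by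
    refine isClosed_le ?_ ?_
    · exact continuous_const.mul (RCLike.continuous_re.comp
        (continuous_const.inner (continuous_id.const_smul _)))
    · exact continuous_const.add ((continuous_id.const_smul _).norm.pow 2)
  have hsub : ((LinearMap.range D : Submodule 𝕜 H) : Set H) ⊆ {v : H |
      2 * δ * RCLike.re (inner 𝕜 (x : H) ((δ : 𝕜) • v)) ≤ ‖D x‖ ^ 2 + ‖(δ : 𝕜) • v‖ ^ 2} := by
    rintro _ ⟨b, rfl⟩
    have := hpol x ((δ : 𝕜) • b)
    rwa [map_smul] at this
  have hmem : (x : H) ∈ closure ((LinearMap.range D : Submodule 𝕜 H) : Set H) := by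
    rw [← Submodule.topologicalClosure_coe, ← Submodule.orthogonal_orthogonal_eq_closure]
    exact hx
  have h1 : 2 * δ * RCLike.re (inner 𝕜 (x : H) ((δ : 𝕜) • (x : H))) ≤
      ‖D x‖ ^ 2 + ‖(δ : 𝕜) • (x : H)‖ ^ 2 := closure_minimal hsub hclosed hmem
  rw [inner_smul_right, RCLike.re_ofReal_mul, inner_self_eq_norm_sq, norm_smul, RCLike.norm_ofReal,
    mul_pow, sq_abs] at h1
  refine le_of_sq_le_sq ?_ (norm_nonneg _)
  rw [← shift_apply, ← hD, mul_pow]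
  linarith

/-- If the points of the spectrum are isolated, then the eigenvectors span a dense subspace. -/
lemma iSup_eigenspace_orthogonal (hA : IsSelfAdjoint A) {c : ℝ} (hc : InResolventSet A (c : 𝕜))
    (hiso : ∀ r : ℝ, ∃ δ : ℝ, 0 < δ ∧
      ∀ s : ℝ, s ≠ r → |s - r| < δ → InResolventSet A (s : 𝕜)) :
    (⨆ r, eigenspace A r)ᗮ = ⊥ := by
  set N := (⨆ r, eigenspace A r)ᗮ with hN
  obtain ⟨R, hR1, hR2⟩ := hc
  have hRs := resolvent_symm hA hR2
  have hmaps : ∀ x ∈ N, R x ∈ N := by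
    intro x hx
    rw [hN, ← Submodule.iInf_orthogonal, Submodule.mem_iInf] at hx ⊢
    intro r
    rw [Submodule.mem_orthogonal]
    intro v hv
    obtain ⟨hvd, hAv⟩ := (mem_eigenspace_iff hA).1 hv
    have h1 := hR1 ⟨v, hvd⟩
    rw [hAv] at h1
    simp only [← sub_smul, map_smul] at h1
    have h2 := congrArg (fun y => inner 𝕜 y (R x)) h1
    simp only [inner_smul_left, ← RCLike.ofReal_sub, RCLike.conj_ofReal] at h2
    by_cases hrc : r = c
    · rw [← h2, hrc, sub_self, RCLike.ofReal_zero, zero_mul]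
    · have h3 : R v ∈ eigenspace A r := by
        have h4 : ((r - c : ℝ) : 𝕜) ≠ 0 := RCLike.ofReal_ne_zero.2 (sub_ne_zero.2 hrc)
        have h5 : R v = ((r - c : ℝ) : 𝕜)⁻¹ • v := by
          rw [eq_inv_smul_iff₀ h4, RCLike.ofReal_sub]
          exact h1
        rw [h5]
        exact Submodule.smul_mem _ _ hv
      rw [← hRs]
      exact (Submodule.mem_orthogonal _ _).1 (hx r) _ h3
  -- On `N` no `μ ≠ 0` is an approximate eigenvalue of the resolvent, since `N` is orthogonal to the
  -- eigenspace of `c + μ⁻¹`. So the resolvent vanishes on `N`; being injective, it forces `N = 0`.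
  let V : N →L[𝕜] N := (R.comp N.subtypeL).codRestrict N fun x => hmaps x x.2
  have hV : V = 0 := by
    refine eq_zero_of_bounded_below V (fun x y => hRs x y) fun μ _ hμ0 => ?_
    obtain ⟨δ, hδ, hs⟩ := hiso (c + μ⁻¹)
    refine ⟨_, fun y => norm_le_of_norm_le_sub (𝕜 := 𝕜) (H := H) (C := δ⁻¹) hμ0
      (hR2 y).choose_spec ?_⟩
    obtain ⟨hy, ey⟩ := hR2 (y : H)
    have h1 := isolated_bound hA hδ hs ⟨R y, hy⟩
      (Submodule.orthogonal_le (le_iSup (eigenspace A) _) (hmaps y y.2))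
    rwa [inv_mul_eq_div, le_div_iff₀ hδ, mul_comm]
  rw [Submodule.eq_bot_iff]
  intro x hx
  obtain ⟨hy, ey⟩ := hR2 x
  have h0 : V ⟨x, hx⟩ = 0 := by rw [hV, _root_.zero_apply]
  have h1 : R x = 0 := congrArg Subtype.val h0
  have h2 : A ⟨R x, hy⟩ = 0 := by
    rw [show (⟨R x, hy⟩ : A.domain) = 0 from Subtype.ext h1, LinearPMap.map_zero]
  rw [← ey, h2, h1, smul_zero, sub_zero]

/-- The projection onto the kernel of `A - r`. -/
noncomputable def proj (A : H →ₗ.[𝕜] H) (r : ℝ) : H →L[𝕜] H :=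
  haveI : (eigenspace A r).HasOrthogonalProjection := by unfold eigenspace; infer_instance
  (eigenspace A r).starProjection

instance (r : ℝ) : (eigenspace A r).HasOrthogonalProjection := by
  unfold eigenspace; infer_instance

instance (r : ℝ) : CompleteSpace (eigenspace A r) := by
  unfold eigenspace; infer_instance

lemma proj_mem (r : ℝ) (x : H) : proj A r x ∈ eigenspace A r :=
  Submodule.starProjection_apply_mem _ _

lemma proj_of_mem {r : ℝ} {v : H} (hv : v ∈ eigenspace A r) : proj A r v = v :=
  Submodule.starProjection_eq_self_iff.2 hv

lemma inner_proj_of_mem {r : ℝ} {v : H} (hv : v ∈ eigenspace A r) (x : H) :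
    inner 𝕜 v (proj A r x) = inner 𝕜 v x := by
  rw [proj, ← Submodule.inner_starProjection_left_eq_right, Submodule.starProjection_eq_self_iff.2 hv]

lemma inner_proj_left (r : ℝ) (x y : H) :
    inner 𝕜 (proj A r x) y = inner 𝕜 (proj A r x) (proj A r y) :=
  (inner_proj_of_mem (proj_mem r x) y).symm

lemma norm_proj_le (r : ℝ) (x : H) : ‖proj A r x‖ ≤ ‖x‖ :=
  Submodule.norm_starProjection_apply_le _ _

lemma eq_proj_of_inner {r : ℝ} {x v : H} (hv : v ∈ eigenspace A r)
    (h : ∀ y ∈ eigenspace A r, inner 𝕜 y v = inner 𝕜 y x) : proj A r x = v :=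
  (Submodule.eq_starProjection_of_mem_of_inner_eq_zero hv fun y hy => by
    rw [← inner_conj_symm, inner_sub_right, h y hy, sub_self, map_zero])

lemma inner_eq_zero_of_mem (hA : IsSelfAdjoint A) {r s : ℝ} (hrs : r ≠ s) {v w : H}
    (hv : v ∈ eigenspace A r) (hw : w ∈ eigenspace A s) : inner 𝕜 v w = 0 := by
  obtain ⟨h1, e1⟩ := (mem_eigenspace_iff hA).1 hv
  obtain ⟨h2, e2⟩ := (mem_eigenspace_iff hA).1 hw
  have h := inner_symm hA ⟨v, h1⟩ ⟨w, h2⟩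
  rw [e1, e2, inner_smul_left, inner_smul_right, RCLike.conj_ofReal, ← sub_eq_zero, ← sub_mul,
    ← RCLike.ofReal_sub] at h
  exact (mul_eq_zero.1 h).resolve_left (RCLike.ofReal_ne_zero.2 (sub_ne_zero.2 hrs))

lemma orthogonalFamily_eigenspace (hA : IsSelfAdjoint A) :
    OrthogonalFamily 𝕜 (fun r => eigenspace A r) fun r => (eigenspace A r).subtypeₗᵢ :=
  fun _ _ hrs v w => inner_eq_zero_of_mem hA hrs v.2 w.2

lemma proj_proj_of_ne (hA : IsSelfAdjoint A) {r s : ℝ} (hrs : r ≠ s) (x : H) :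
    proj A r (proj A s x) = 0 :=
  eq_proj_of_inner (Submodule.zero_mem _) fun y hy => by
    rw [inner_zero_right, inner_eq_zero_of_mem hA hrs hy (proj_mem s x)]

/-- The index runs over all real numbers, which avoids enumerating eigenvalues: the other terms are
zero. The Hilbert sum gives some expansion of `x`, and pairing it with eigenvectors identifies the
terms. -/
lemma hasSum_proj (hA : IsSelfAdjoint A) (hE : (⨆ r, eigenspace A r)ᗮ = ⊥) (x : H) :
    HasSum (fun r => proj A r x) x := by
  have hdense : ⊤ ≤ (⨆ r, eigenspace A r).topologicalClosure := by
    rw [top_le_iff, Submodule.topologicalClosure_eq_top_iff, hE]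
  have hsum := IsHilbertSum.mkInternal _ (orthogonalFamily_eigenspace hA) hdense
  have h1 := hsum.hasSum_linearIsometryEquiv_symm (hsum.linearIsometryEquiv x)
  rw [LinearIsometryEquiv.symm_apply_apply] at h1
  convert h1 using 2 with r
  refine eq_proj_of_inner (Subtype.mem _) fun y hy => ?_
  have h2 := h1.mapL (innerSL 𝕜 y)
  refine HasSum.unique (hasSum_single r fun s hs => ?_) h2
  exact inner_eq_zero_of_mem hA (Ne.symm hs) hy (Subtype.mem _)

lemma hasSum_inner_proj (hA : IsSelfAdjoint A) (hE : (⨆ r, eigenspace A r)ᗮ = ⊥) (x y : H) :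
    HasSum (fun r => inner 𝕜 (proj A r x) (proj A r y)) (inner 𝕜 x y) := by
  have h := (hasSum_proj hA hE y).mapL (innerSL 𝕜 x)
  have e : ∀ r, inner 𝕜 (proj A r x) (proj A r y) = inner 𝕜 x (proj A r y) := fun r => by
    rw [← inner_conj_symm, inner_proj_of_mem (proj_mem r y), inner_conj_symm]
  simp only [e]
  exact h

lemma hasSum_norm_sq_proj (hA : IsSelfAdjoint A) (hE : (⨆ r, eigenspace A r)ᗮ = ⊥) (x : H) :
    HasSum (fun r => ‖proj A r x‖ ^ 2) (‖x‖ ^ 2) := by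
  have h := (hasSum_inner_proj hA hE x x).mapL (RCLike.reCLM (K := 𝕜))
  simpa only [RCLike.reCLM_apply, inner_self_eq_norm_sq] using h

end SpectralTheory

/-! ### Consequences of discreteness: local finiteness, isolation, gaps. -/

section DiscreteSpectrum

variable {𝕜 H : Type*} [RCLike 𝕜] [NormedAddCommGroup H] [InnerProductSpace 𝕜 H]
  {A : H →ₗ.[𝕜] H}

lemma not_inResolventSet {z : 𝕜} (h : IsEigenvalue A z) : ¬ InResolventSet A z := by
  rintro ⟨R, hR, -⟩
  obtain ⟨v, hv, hd, e⟩ := h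
  have h1 := hR ⟨v, hd⟩
  rw [e, sub_self, map_zero] at h1
  exact hv h1.symm

lemma IsEigenvector.nonneg (hA : IsNonneg A) {r : ℝ} {v : H} (h : IsEigenvector A (r : 𝕜) v) :
    0 ≤ r := by
  obtain ⟨hv, hd, e⟩ := h
  have h1 := hA ⟨v, hd⟩
  rw [e, inner_smul_left, RCLike.conj_ofReal, RCLike.re_ofReal_mul, inner_self_eq_norm_sq] at h1
  exact nonneg_of_mul_nonneg_left h1 (by positivity)

/-- The spectrum accumulates at most at `+∞`. -/
lemma finite_spec_le (hs : HasDiscreteSpectrum A) (M : ℝ) :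
    {r : ℝ | (r : 𝕜) ∈ spec A ∧ r ≤ M}.Finite := by
  rcases hs.2 with hfin | ⟨e, hmono, hrange⟩
  · exact (hfin.preimage RCLike.ofReal_injective.injOn).subset fun r hr => hr.1
  · have hatTop : Tendsto e atTop atTop := by
      rcases tendsto_atTop_of_monotone hmono.monotone with h | ⟨l, hl⟩
      · exact h
      · exfalso
        have hlt : ∀ n, e n < l := fun n =>
          (hmono (Nat.lt_succ_self n)).trans_le (hmono.monotone.ge_of_tendsto hl _)
        have hres : InResolventSet A (l : 𝕜) := by
          by_contra hcon
          have : (l : 𝕜) ∈ spec A := hcon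
          rw [hrange] at this
          obtain ⟨n, hn⟩ := this
          exact (hlt n).ne (RCLike.ofReal_injective hn)
        obtain ⟨R, hR, -⟩ := hres
        -- A finite limit `l` exceeds every `e n`, so it is in the resolvent set; but eigenvalues
        -- approaching `l` make the resolvent unbounded.
        have hbound : ∀ n, 1 ≤ ‖R‖ * |e n - l| := by
          intro n
          have hmem : ((e n : ℝ) : 𝕜) ∈ spec A := by rw [hrange]; exact ⟨n, rfl⟩
          obtain ⟨v, hv, hd, ev⟩ := hs.1 _ hmem
          have h1 := R.le_opNorm (A ⟨v, hd⟩ - (l : 𝕜) • v)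
          rw [hR ⟨v, hd⟩, ev, ← sub_smul, ← RCLike.ofReal_sub, norm_smul, RCLike.norm_ofReal,
            ← mul_assoc] at h1
          exact (le_mul_iff_one_le_left (norm_pos_iff.2 hv)).1 h1
        have hlim : Tendsto (fun n => ‖R‖ * |e n - l|) atTop (𝓝 (‖R‖ * |l - l|)) :=
          ((hl.sub_const l).abs).const_mul _
        have := ge_of_tendsto' hlim hbound
        simp only [sub_self, abs_zero, mul_zero] at this
        linarith
    obtain ⟨N, hN⟩ := eventually_atTop.1 (hatTop.eventually_gt_atTop M)
    refine ((finite_lt_nat N).image e).subset ?_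
    rintro r ⟨hr, hrM⟩
    rw [hrange] at hr
    obtain ⟨n, hn⟩ := hr
    have hn' : e n = r := RCLike.ofReal_injective hn
    refine ⟨n, ?_, hn'⟩
    by_contra hcon
    have := hN n (not_lt.1 hcon)
    rw [hn'] at this
    linarith

/-- The points of the spectrum are isolated. -/
lemma exists_isolated (hs : HasDiscreteSpectrum A) (r : ℝ) :
    ∃ δ : ℝ, 0 < δ ∧ ∀ s : ℝ, s ≠ r → |s - r| < δ → InResolventSet A (s : 𝕜) := by
  have hfin : ({s : ℝ | (s : 𝕜) ∈ spec A ∧ s ≤ r + 1} \ {r}).Finite :=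
    (finite_spec_le hs (r + 1)).sdiff
  obtain ⟨δ, hδ, hball⟩ := Metric.isOpen_iff.1 hfin.isClosed.isOpen_compl r (by simp)
  refine ⟨min δ 1, lt_min hδ one_pos, fun s hsr hlt => ?_⟩
  by_contra hcon
  have hmem : s ∈ Metric.ball r δ :=
    (Real.dist_eq s r).trans_lt (hlt.trans_le (min_le_left _ _))
  refine hball hmem ⟨⟨hcon, ?_⟩, hsr⟩
  linarith [(abs_lt.1 (hlt.trans_le (min_le_right _ _))).2]

lemma isClosed_spec (hs : HasDiscreteSpectrum A) : IsClosed {r : ℝ | (r : 𝕜) ∈ spec A} := by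
  rw [← isOpen_compl_iff, Metric.isOpen_iff]
  intro r hr
  obtain ⟨δ, hδ, h⟩ := exists_isolated hs r
  refine ⟨δ, hδ, fun s hsr => ?_⟩
  by_cases hsr' : s = r
  · rwa [hsr']
  · exact fun hcon => hcon (h s hsr' hsr)

/-- For every real number there is a gap in the spectrum on its right. -/
lemma exists_gap (hs : HasDiscreteSpectrum A) (r : ℝ) :
    ∃ b : ℝ, r < b ∧ ∀ s : ℝ, (s : 𝕜) ∈ spec A → s ≤ r ∨ b ≤ s := by
  obtain ⟨δ, hδ, h⟩ := exists_isolated hs r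
  refine ⟨r + δ, by linarith, fun s hmem => ?_⟩
  by_contra! hcon
  exact hmem (h s hcon.1.ne' (by rw [abs_of_pos (by linarith)]; linarith))

lemma inResolventSet_neg_one (hA : IsNonneg A) (hs : HasDiscreteSpectrum A) :
    InResolventSet A ((-1 : ℝ) : 𝕜) := by
  by_contra hcon
  obtain ⟨v, hv⟩ := hs.1 _ hcon
  have := hv.nonneg hA
  linarith

end DiscreteSpectrum

/-! ### Diagonal form of `A`, existence of the square root and its action on eigenspaces. -/

section DiagonalOperators

variable {𝕜 H : Type*} [RCLike 𝕜] [NormedAddCommGroup H] [InnerProductSpace 𝕜 H] [CompleteSpace H]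
  {A : H →ₗ.[𝕜] H}

/-- Pair with `v` in the eigenspace and move `B` onto `v`. The operator `B` is arbitrary so that the
lemma serves both `A` and its square roots. -/
lemma proj_eq_smul_of_mem_graph {B : H →ₗ.[𝕜] H} (hB : IsSelfAdjoint B)
    {r k : ℝ} (hk : ∀ v ∈ eigenspace A r, (v, (k : 𝕜) • v) ∈ B.graph) {x y : H}
    (h : (x, y) ∈ B.graph) : proj A r y = (k : 𝕜) • proj A r x := by
  refine eq_proj_of_inner (Submodule.smul_mem _ _ (proj_mem r x)) fun v hv => ?_
  obtain ⟨v', h1, h2⟩ := B.mem_graph_iff.1 (hk v hv)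
  have h3 := (mem_graph_iff_of_isSelfAdjoint hB x y).1 h v'
  simp only at h1 h2
  rw [h1, h2, inner_smul_left, RCLike.conj_ofReal] at h3
  rw [inner_smul_right, inner_proj_of_mem hv, h3]

lemma mem_graph_of_mem_eigenspace (hA : IsSelfAdjoint A) {r : ℝ} {v : H}
    (hv : v ∈ eigenspace A r) : (v, (r : 𝕜) • v) ∈ A.graph := by
  obtain ⟨h, e⟩ := (mem_eigenspace_iff hA).1 hv
  exact A.mem_graph_iff.2 ⟨⟨v, h⟩, rfl, e⟩

lemma inner_eq_inner_of_proj (hA : IsSelfAdjoint A) (hE : (⨆ r, eigenspace A r)ᗮ = ⊥)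
    {φ : ℝ → ℝ} {a b x y : H} (hab : ∀ r, proj A r b = (φ r : 𝕜) • proj A r a)
    (hxy : ∀ r, proj A r y = (φ r : 𝕜) • proj A r x) : inner 𝕜 b x = inner 𝕜 a y := by
  refine (hasSum_inner_proj hA hE b x).unique ?_
  convert hasSum_inner_proj hA hE a y using 2 with r
  rw [hab, hxy, inner_smul_left, inner_smul_right, RCLike.conj_ofReal]

/-- In the decomposition along the eigenspaces, `A` is diagonal. -/
lemma mem_graph_iff_proj (hA : IsSelfAdjoint A) (hE : (⨆ r, eigenspace A r)ᗮ = ⊥) (x y : H) :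
    (x, y) ∈ A.graph ↔ ∀ r : ℝ, proj A r y = (r : 𝕜) • proj A r x := by
  refine ⟨fun h r => proj_eq_smul_of_mem_graph hA
    (fun v hv => mem_graph_of_mem_eigenspace hA hv) h, fun h => ?_⟩
  rw [mem_graph_iff_of_isSelfAdjoint hA]
  exact fun a => inner_eq_inner_of_proj hA hE (φ := id) (fun r => proj_eq_smul_of_mem_graph hA
    (fun v hv => mem_graph_of_mem_eigenspace hA hv) (A.mem_graph a)) h

/-- The graph of the operator which multiplies the component along the eigenspace of `r`
by `φ r`. -/
noncomputable def diagGraph (A : H →ₗ.[𝕜] H) (φ : ℝ → ℝ) : Submodule 𝕜 (H × H) where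
  carrier := {p | ∀ r, proj A r p.2 = (φ r : 𝕜) • proj A r p.1}
  zero_mem' r := by simp
  add_mem' {a b} ha hb r := by simp [ha r, hb r]
  smul_mem' c a ha r := by simp [ha r, smul_comm c]

lemma mem_diagGraph {φ : ℝ → ℝ} {x y : H} :
    (x, y) ∈ diagGraph A φ ↔ ∀ r, proj A r y = (φ r : 𝕜) • proj A r x := Iff.rfl

noncomputable def diagOp (A : H →ₗ.[𝕜] H) (φ : ℝ → ℝ) : H →ₗ.[𝕜] H := (diagGraph A φ).toLinearPMap

lemma eq_zero_of_proj (hA : IsSelfAdjoint A) (hE : (⨆ r, eigenspace A r)ᗮ = ⊥) {x : H}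
    (h : ∀ r, proj A r x = 0) : x = 0 := by
  have h1 := hasSum_proj hA hE x
  simp only [h] at h1
  exact h1.unique hasSum_zero

lemma diagOp_graph (hA : IsSelfAdjoint A) (hE : (⨆ r, eigenspace A r)ᗮ = ⊥) (φ : ℝ → ℝ) :
    (diagOp A φ).graph = diagGraph A φ :=
  Submodule.toLinearPMap_graph_eq _ fun x hx h0 =>
    eq_zero_of_proj hA hE fun r => by rw [hx r, h0, map_zero, smul_zero]

lemma mem_diagGraph_of_mem_eigenspace (hA : IsSelfAdjoint A) (φ : ℝ → ℝ) {r : ℝ} {v : H}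
    (hv : v ∈ eigenspace A r) : (v, (φ r : 𝕜) • v) ∈ diagGraph A φ := by
  intro s
  by_cases hrs : s = r
  · rw [hrs, map_smul]
  · have : proj A s v = 0 := by rw [← proj_of_mem hv, proj_proj_of_ne hA hrs]
    simp only [map_smul, this, smul_zero]

/-- The domain contains every eigenspace, so it is dense, and testing the adjoint relation on
eigenvectors recovers the diagonal relation. -/
lemma diagOp_isSelfAdjoint (hA : IsSelfAdjoint A) (hE : (⨆ r, eigenspace A r)ᗮ = ⊥) (φ : ℝ → ℝ) :
    IsSelfAdjoint (diagOp A φ) := by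
  have hdom : Dense ((diagOp A φ).domain : Set H) := by
    rw [Submodule.dense_iff_topologicalClosure_eq_top, Submodule.topologicalClosure_eq_top_iff,
      eq_bot_iff, ← hE]
    refine Submodule.orthogonal_le (iSup_le fun r v hv => ?_)
    have h1 := mem_diagGraph_of_mem_eigenspace hA φ hv
    rw [← diagOp_graph hA hE] at h1
    exact LinearPMap.mem_domain_of_mem_graph h1
  rw [LinearPMap.isSelfAdjoint_def]
  refine LinearPMap.eq_of_eq_graph ?_
  rw [LinearPMap.adjoint_graph_eq_graph_adjoint hdom, diagOp_graph hA hE]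
  ext ⟨x, y⟩
  rw [Submodule.mem_adjoint_iff]
  constructor
  · intro h r
    refine eq_proj_of_inner (Submodule.smul_mem _ _ (proj_mem r x)) fun v hv => ?_
    have h1 := sub_eq_zero.1 (h v _ (mem_diagGraph_of_mem_eigenspace hA φ hv))
    simp only [inner_smul_left, RCLike.conj_ofReal] at h1
    rw [inner_smul_right, inner_proj_of_mem hv, h1]
  · exact fun h a b hab => sub_eq_zero.2 (inner_eq_inner_of_proj hA hE hab h)

lemma eigenspace_nonneg (hA : IsSelfAdjoint A) (hn : IsNonneg A) {r : ℝ} {v : H}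
    (hv : v ∈ eigenspace A r) (hv0 : v ≠ 0) : 0 ≤ r :=
  IsEigenvector.nonneg hn ⟨hv0, (mem_eigenspace_iff hA).1 hv⟩

/-- For `r < 0`, where `√r` is 0 by convention, the projection vanishes. -/
lemma smul_proj_eq_sqrt (hA : IsSelfAdjoint A) (hn : IsNonneg A) (r : ℝ) (x : H) :
    (r : 𝕜) • proj A r x = (√r : 𝕜) • (√r : 𝕜) • proj A r x := by
  by_cases h0 : proj A r x = 0
  · rw [h0, smul_zero, smul_zero, smul_zero]
  · rw [smul_smul, ← RCLike.ofReal_mul,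
      Real.mul_self_sqrt (eigenspace_nonneg hA hn (proj_mem r x) h0)]

lemma exists_isNonnegSqrt (hA : IsSelfAdjoint A) (hn : IsNonneg A)
    (hE : (⨆ r, eigenspace A r)ᗮ = ⊥) : ∃ B : H →ₗ.[𝕜] H, IsNonnegSqrt A B := by
  refine ⟨diagOp A Real.sqrt, diagOp_isSelfAdjoint hA hE _, fun x => ?_, fun x z => ?_⟩
  · have hx := (diagOp A Real.sqrt).mem_graph x
    rw [diagOp_graph hA hE, mem_diagGraph] at hx
    have h1 := (hasSum_inner_proj hA hE (diagOp A Real.sqrt x) x).mapL (RCLike.reCLM (K := 𝕜))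
    refine h1.nonneg fun r => ?_
    rw [RCLike.reCLM_apply, hx, inner_smul_left, RCLike.conj_ofReal, RCLike.re_ofReal_mul,
      inner_self_eq_norm_sq]
    positivity
  · rw [mem_graph_iff_proj hA hE, diagOp_graph hA hE]
    simp only [mem_diagGraph]
    constructor
    · intro h
      -- The intermediate vector is `∑ √r P_r x`. It converges because `(√r)² ≤ 1 + r²`, while `P_r
      -- x` and `r P_r x = P_r z` are square summable.
      let f : ∀ r : ℝ, eigenspace A r := fun r =>
        ⟨(√r : 𝕜) • proj A r x, Submodule.smul_mem _ _ (proj_mem r x)⟩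
      have hsum : Summable fun r => ‖f r‖ ^ 2 := by
        refine Summable.of_nonneg_of_le (fun r => sq_nonneg _) (fun r => ?_)
          ((hasSum_norm_sq_proj hA hE x).summable.add (hasSum_norm_sq_proj hA hE z).summable)
        have h1 : ‖f r‖ ^ 2 = √r ^ 2 * ‖proj A r x‖ ^ 2 := by
          change ‖(√r : 𝕜) • proj A r x‖ ^ 2 = _
          rw [norm_smul, RCLike.norm_ofReal, mul_pow, sq_abs]
        rw [h1, h, norm_smul, RCLike.norm_ofReal, mul_pow, sq_abs]
        have h2 : √r ^ 2 ≤ 1 + r ^ 2 := by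
          rcases le_total 0 r with h | h
          · rw [Real.sq_sqrt h]; nlinarith [sq_nonneg (r - 1)]
          · rw [Real.sqrt_eq_zero_of_nonpos h]; nlinarith
        nlinarith [sq_nonneg ‖proj A r x‖]
      have hS := ((orthogonalFamily_eigenspace hA).summable_iff_norm_sq_summable f).2 hsum
      have hy : ∀ r, proj A r (∑' i, ((f i : eigenspace A i) : H)) = (√r : 𝕜) • proj A r x := by
        intro r
        refine eq_proj_of_inner (Submodule.smul_mem _ _ (proj_mem r x)) fun v hv => ?_
        have h2 := hS.hasSum.mapL (innerSL 𝕜 v)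
        refine HasSum.unique (hasSum_single r fun s hs => ?_) h2
        exact inner_eq_zero_of_mem hA (Ne.symm hs) hv (f s).2
      exact ⟨_, hy, fun r => by rw [h, hy, smul_proj_eq_sqrt hA hn]⟩
    · rintro ⟨y, h1, h2⟩ r
      rw [h2, h1, smul_proj_eq_sqrt hA hn]

lemma sqrtOp_isNonnegSqrt (hA : IsSelfAdjoint A) (hn : IsNonneg A)
    (hE : (⨆ r, eigenspace A r)ᗮ = ⊥) : IsNonnegSqrt A (sqrtOp A) := by
  have h := exists_isNonnegSqrt hA hn hE
  rw [sqrtOp, dif_pos h]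
  exact h.choose_spec

/-- This is the uniqueness needed for `sqrtOp`, which is obtained by choice. If `d = B v - √r v`,
then `B d = -√r d`, so `d = 0` by nonnegativity when `r > 0`; when `r = 0`, `|B v|² = ⟨v, B² v⟩ =
0`. -/
lemma IsNonnegSqrt.mem_graph_of_mem_eigenspace (hA : IsSelfAdjoint A) (hn : IsNonneg A)
    {B : H →ₗ.[𝕜] H} (hB : IsNonnegSqrt A B) {r : ℝ} {v : H} (hv : v ∈ eigenspace A r) :
    (v, (√r : 𝕜) • v) ∈ B.graph := by
  by_cases hv0 : v = 0
  · rw [hv0, smul_zero]; exact B.graph.zero_mem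
  have hr := eigenspace_nonneg hA hn hv hv0
  obtain ⟨y, h1, h2⟩ := (hB.sq _ _).1 (DecayRates.mem_graph_of_mem_eigenspace hA hv)
  have hsq : (√r : 𝕜) * (√r : 𝕜) = (r : 𝕜) := by
    rw [← RCLike.ofReal_mul, Real.mul_self_sqrt hr]
  have h3 : (y - (√r : 𝕜) • v, -((√r : 𝕜) • (y - (√r : 𝕜) • v))) ∈ B.graph := by
    have := B.graph.sub_mem h2 (B.graph.smul_mem (√r : 𝕜) h1)
    convert this using 1
    rw [Prod.smul_mk, Prod.mk_sub_mk, smul_sub, smul_smul, hsq, neg_sub]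
  obtain ⟨a, ha1, ha2⟩ := B.mem_graph_iff.1 h3
  obtain ⟨b, hb1, hb2⟩ := B.mem_graph_iff.1 h2
  obtain ⟨c, hc1, hc2⟩ := B.mem_graph_iff.1 h1
  simp only at ha1 ha2 hb1 hb2 hc1 hc2
  have hy : y = (√r : 𝕜) • v := by
    rcases hr.eq_or_lt with h0 | h0
    · have h4 := inner_symm hB.selfAdjoint c b
      rw [hc2, hb1, hb2, ← h0, RCLike.ofReal_zero, zero_smul, inner_zero_right] at h4
      rw [inner_self_eq_zero.1 h4, ← h0]
      simp
    · have h4 := hB.nonneg a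
      rw [ha2, ha1, inner_neg_left, inner_smul_left, RCLike.conj_ofReal, map_neg,
        RCLike.re_ofReal_mul, inner_self_eq_norm_sq] at h4
      have h5 : 0 < √r := Real.sqrt_pos.2 h0
      have h6 : ‖y - (√r : 𝕜) • v‖ ^ 2 ≤ 0 := by
        by_contra hcon
        nlinarith [mul_pos h5 (not_le.1 hcon)]
      exact sub_eq_zero.1 (norm_eq_zero.1 (pow_eq_zero_iff two_ne_zero |>.1
        (le_antisymm h6 (sq_nonneg _))))
  rwa [hy] at h1

lemma IsNonnegSqrt.proj_apply (hA : IsSelfAdjoint A) (hn : IsNonneg A)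
    {B : H →ₗ.[𝕜] H} (hB : IsNonnegSqrt A B) {x y : H} (h : (x, y) ∈ B.graph) (r : ℝ) :
    proj A r y = (√r : 𝕜) • proj A r x :=
  proj_eq_smul_of_mem_graph hB.selfAdjoint
    (fun _ hv => hB.mem_graph_of_mem_eigenspace hA hn hv) h

end DiagonalOperators

/-! ### Calculus with `val` and the quadratic form of `A`. -/

section Val

variable {𝕜 H : Type*} [RCLike 𝕜] [NormedAddCommGroup H] [InnerProductSpace 𝕜 H]
  {A : H →ₗ.[𝕜] H}

lemma val_of_mem {x : H} (h : x ∈ A.domain) : val A x = A ⟨x, h⟩ := dif_pos h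

lemma mem_graph_val {x : H} (h : x ∈ A.domain) : (x, val A x) ∈ A.graph := by
  rw [val_of_mem h]
  exact A.mem_graph ⟨x, h⟩

lemma val_eq_of_mem_graph {x y : H} (h : (x, y) ∈ A.graph) : val A x = y := by
  obtain ⟨x', h1, h2⟩ := A.mem_graph_iff.1 h
  obtain rfl : (x' : H) = x := h1
  rw [val_of_mem x'.2]
  exact h2

lemma val_sub {x y : H} (hx : x ∈ A.domain) (hy : y ∈ A.domain) :
    val A (x - y) = val A x - val A y :=
  val_eq_of_mem_graph (A.graph.sub_mem (mem_graph_val hx) (mem_graph_val hy))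

variable [CompleteSpace H]

namespace IsNonnegSqrt

variable {B : H →ₗ.[𝕜] H}

lemma mem_domain (hB : IsNonnegSqrt A B) {x : H} (hx : x ∈ A.domain) :
    x ∈ B.domain ∧ val B x ∈ B.domain ∧ val B (val B x) = val A x := by
  obtain ⟨y, h1, h2⟩ := (hB.sq _ _).1 (mem_graph_val hx)
  rw [val_eq_of_mem_graph h1]
  exact ⟨LinearPMap.mem_domain_of_mem_graph h1, LinearPMap.mem_domain_of_mem_graph h2,
    val_eq_of_mem_graph h2⟩

lemma inner_val (hB : IsNonnegSqrt A B) {x y : H} (hx : x ∈ A.domain) (hy : y ∈ B.domain) :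
    inner 𝕜 (val B y) (val B x) = inner 𝕜 y (val A x) := by
  obtain ⟨h1, h2, h3⟩ := hB.mem_domain hx
  have h := inner_symm hB.selfAdjoint ⟨y, hy⟩ ⟨val B x, h2⟩
  rwa [← val_of_mem hy, ← val_of_mem h2, h3] at h

lemma re_inner_val_self (hB : IsNonnegSqrt A B) {x : H} (hx : x ∈ A.domain) :
    RCLike.re (inner 𝕜 x (val A x)) = ‖val B x‖ ^ 2 := by
  rw [← hB.inner_val hx (hB.mem_domain hx).1, inner_self_eq_norm_sq]

lemma norm_val_sub_smul_sq (hB : IsNonnegSqrt A B) {x : H} (hx : x ∈ A.domain) (c : ℝ) :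
    ‖val A x - (c : 𝕜) • x‖ ^ 2 = ‖val A x‖ ^ 2 - 2 * c * ‖val B x‖ ^ 2 + c ^ 2 * ‖x‖ ^ 2 := by
  rw [@norm_sub_sq 𝕜, inner_smul_right, RCLike.re_ofReal_mul, ← inner_conj_symm, RCLike.conj_re,
    hB.re_inner_val_self hx, norm_smul, RCLike.norm_ofReal, mul_pow, sq_abs]
  ring

end IsNonnegSqrt

end Val

/-! ### Derivatives of `|u|²` and `|A^{1/2} u|²`. -/

section Derivatives

variable {𝕜 H : Type*} [RCLike 𝕜] [NormedAddCommGroup H] [InnerProductSpace 𝕜 H]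
  [NormedSpace ℝ H]

lemma hasDerivAt_re_inner {u : ℝ → H} {u' : H} {t : ℝ} (hu : HasDerivAt u u' t) (y : H) :
    HasDerivAt (fun s => RCLike.re (inner 𝕜 y (u s))) (RCLike.re (inner 𝕜 y u')) t := by
  have h1 := (hasDerivAt_const t y).inner 𝕜 hu
  rw [inner_zero_left, add_zero] at h1
  exact (RCLike.reCLM (K := 𝕜)).hasFDerivAt.comp_hasDerivAt t h1

lemma hasDerivAt_norm_sq {u : ℝ → H} {u' : H} {t : ℝ} (hu : HasDerivAt u u' t) :
    HasDerivAt (fun s => ‖u s‖ ^ 2) (2 * RCLike.re (inner 𝕜 u' (u t))) t := by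
  have h1 := (RCLike.reCLM (K := 𝕜)).hasFDerivAt.comp_hasDerivAt t (hu.inner 𝕜 hu)
  have e : RCLike.re (inner 𝕜 (u t) u' + inner 𝕜 u' (u t)) =
      2 * RCLike.re (inner 𝕜 u' (u t)) := by
    rw [map_add, ← inner_conj_symm, RCLike.conj_re]
    ring
  rw [RCLike.reCLM_apply, e] at h1
  refine h1.congr_of_eventuallyEq (Eventually.of_forall fun s => ?_)
  exact (inner_self_eq_norm_sq (𝕜 := 𝕜) (u s)).symm

/-- The chain rule for `‖A^{1/2} u‖²`. -/
lemma hasDerivAt_norm_val_sq [CompleteSpace H] {A B : H →ₗ.[𝕜] H} (hB : IsNonnegSqrt A B)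
    {u : ℝ → H} {u' : H} {t : ℝ} (hu : HasDerivAt u u' t) (hA : u t ∈ A.domain)
    (hdom : ∀ᶠ s in 𝓝 t, u s ∈ B.domain)
    (hdiff : DifferentiableAt ℝ (fun s => ‖val B (u s)‖ ^ 2) t) :
    HasDerivAt (fun s => ‖val B (u s)‖ ^ 2) (2 * RCLike.re (inner 𝕜 u' (val A (u t)))) t := by
  have h1 := hdiff.hasDerivAt.sub
    ((hasDerivAt_re_inner (𝕜 := 𝕜) hu (val A (u t))).const_mul 2)
  -- Nothing is known about the derivative of `B u`. However, this function of `s` is `|B(u(s) -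
  -- u(t))|²` plus a constant, hence minimal at `t`, and its derivative there is zero.
  have hmin : IsLocalMin (fun s => ‖val B (u s)‖ ^ 2 -
      2 * RCLike.re (inner 𝕜 (val A (u t)) (u s))) t := by
    filter_upwards [hdom] with s hs
    have hBt := (hB.mem_domain hA).1
    have h2 : val B (u s) = val B (u s - u t) + val B (u t) := by
      rw [val_sub hs hBt, sub_add_cancel]
    have h3 := hB.inner_val hA (B.domain.sub_mem hs hBt)
    have h4 : RCLike.re (inner 𝕜 (u s - u t) (val A (u t))) =
        RCLike.re (inner 𝕜 (val A (u t)) (u s)) - RCLike.re (inner 𝕜 (val A (u t)) (u t)) := by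
      rw [← inner_conj_symm, RCLike.conj_re, inner_sub_right, map_sub]
    rw [h2, @norm_add_sq 𝕜, h3, h4]
    linarith [sq_nonneg ‖val B (u s - u t)‖]
  have h2 := hmin.hasDerivAt_eq_zero h1
  have e : deriv (fun s => ‖val B (u s)‖ ^ 2) t = 2 * RCLike.re (inner 𝕜 u' (val A (u t))) := by
    rw [← inner_conj_symm, RCLike.conj_re]
    linarith
  rw [← e]
  exact hdiff.hasDerivAt

lemma absolutelyContinuousOnInterval_of_integral {u v : ℝ → H} {T : ℝ} (hT : 0 ≤ T)
    (hv : IntegrableOn v (Ioo 0 T)) (h : ∀ t ∈ Icc 0 T, u t = u 0 + ∫ s in (0 : ℝ)..t, v s) :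
    AbsolutelyContinuousOnInterval u 0 T := by
  have hint : IntervalIntegrable v volume 0 T :=
    (intervalIntegrable_iff_integrableOn_Ioo_of_le hT).2 hv
  have hsub : ∀ x ∈ uIcc 0 T, IntervalIntegrable v volume 0 x := fun x hx =>
    hint.mono_set (uIcc_subset_uIcc_left hx)
  have hac := hint.norm.absolutelyContinuousOnInterval_intervalIntegral (c := 0) (by simp)
  refine absolutelyContinuousOnInterval_of_dist_le (C := 1) hac fun x hx y hy => ?_
  rw [uIcc_of_le hT] at hx hy
  have hx' := hsub x (by rwa [uIcc_of_le hT])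
  have hy' := hsub y (by rwa [uIcc_of_le hT])
  rw [h x hx, h y hy, dist_add_left, dist_eq_norm, Real.dist_eq, one_mul,
    intervalIntegral.integral_interval_sub_left hx' hy',
    intervalIntegral.integral_interval_sub_left hx'.norm hy'.norm]
  exact intervalIntegral.norm_integral_le_abs_integral_norm

end Derivatives

/-! ### From strong solutions to the scalar inequalities. -/

section Solutions

variable {𝕜 H : Type*} [RCLike 𝕜] [NormedAddCommGroup H] [InnerProductSpace 𝕜 H]
  [CompleteSpace H] [NormedSpace ℝ H]

/-- A global solution of `u' + A u = g` with `g` bounded by powers of `u`, and the properties of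
the operators `A` and `B = A^{1/2}` that its study requires. -/
structure SolutionSetting (A B : H →ₗ.[𝕜] H) (g u : ℝ → H) (K p q : ℝ) : Prop where
  selfAdjoint : IsSelfAdjoint A
  nonneg : IsNonneg A
  discrete : HasDiscreteSpectrum A
  sqrt : IsNonnegSqrt A B
  total : (⨆ r, eigenspace A r)ᗮ = ⊥
  mem_sqrt : ∀ t, 0 ≤ t → u t ∈ B.domain
  ac : ∀ T, 0 < T → AbsolutelyContinuousOnInterval u 0 T
  ac_sqrt : LocallyAC (fun t => ‖val B (u t)‖ ^ 2) 0
  equation : ∀ᵐ t, 0 < t → u t ∈ A.domain ∧ HasDerivAt u (g t - val A (u t)) t ∧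
    HasDerivAt (fun s => ‖val B (u s)‖ ^ 2)
      (2 * RCLike.re (inner 𝕜 (g t - val A (u t)) (val A (u t)))) t
  hK : 0 ≤ K
  hp : 0 < p
  hq : 0 < q
  bound : ∀ t, 0 ≤ t → ‖g t‖ ≤ K * (‖u t‖ ^ (1 + p) + ‖val B (u t)‖ ^ (1 + q))

lemma solutionSetting {A : H →ₗ.[𝕜] H} (hself : IsSelfAdjoint A)
    (hnonneg : IsNonneg A) (hspec : HasDiscreteSpectrum A) {g u : ℝ → H}
    (hu : IsGlobalSolution A g u) {p q K : ℝ} (hp : 0 < p) (hq : 0 < q) (hK : 0 ≤ K)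
    (hineq : ∀ t : ℝ, 0 ≤ t → ‖g t‖ ≤
      K * (‖u t‖ ^ (1 + p) + ‖val (sqrtOp A) (u t)‖ ^ (1 + q))) :
    SolutionSetting A (sqrtOp A) g u K p q := by
  have hE := iSup_eigenspace_orthogonal hself (inResolventSet_neg_one hnonneg hspec)
    (exists_isolated hspec)
  have hB := sqrtOp_isNonnegSqrt hself hnonneg hE
  have hmem : ∀ t, 0 ≤ t → u t ∈ (sqrtOp A).domain := fun t ht =>
    (hu (t + 1) (by linarith)).mem_sqrt t ⟨ht, by linarith⟩
  refine ⟨hself, hnonneg, hspec, hB, hE, hmem, fun T hT => ?_, fun b c h1 h2 =>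
    absolutelyContinuousOnInterval_mono_nonneg (fun T hT => (hu T hT).absCont) h1 h2, ?_,
    hK, hp, hq, hineq⟩
  · obtain ⟨v, hv, h⟩ := (hu T hT).sobolev
    exact absolutelyContinuousOnInterval_of_integral hT.le (hv.integrable one_le_two) h
  -- The exceptional null set depends on the interval; countably many intervals cover the half-line.
  · have key : ∀ n : ℕ, ∀ᵐ t, t ∈ Ioo (0 : ℝ) (n + 1) → u t ∈ A.domain ∧
        HasDerivAt u (g t - val A (u t)) t ∧
        HasDerivAt (fun s => ‖val (sqrtOp A) (u s)‖ ^ 2)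
          (2 * RCLike.re (inner 𝕜 (g t - val A (u t)) (val A (u t)))) t := by
      intro n
      have hn : (0 : ℝ) < n + 1 := by positivity
      have hs := hu (n + 1) hn
      have h1 := (ae_restrict_iff' measurableSet_Ioo).1 hs.mem_ae
      have h2 := (ae_restrict_iff' measurableSet_Ioo).1 hs.equation
      filter_upwards [h1, h2, hs.absCont.ae_differentiableAt] with t ht1 ht2 ht3 hmt
      obtain ⟨u', hu', he⟩ := ht2 hmt
      have hd : HasDerivAt u (g t - val A (u t)) t := by
        rwa [← he, add_sub_cancel_right]
      refine ⟨ht1 hmt, hd, hasDerivAt_norm_val_sq hB hd (ht1 hmt) ?_ (ht3 ?_)⟩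
      · filter_upwards [Ioi_mem_nhds hmt.1] with s hs
        exact hmem s (le_of_lt hs)
      · rw [uIcc_of_le hn.le]
        exact Ioo_subset_Icc_self hmt
    filter_upwards [ae_all_iff.2 key] with t ht hpos
    obtain ⟨n, hn⟩ := exists_nat_gt t
    exact ht n ⟨hpos, by linarith⟩

namespace SolutionSetting

variable {A B : H →ₗ.[𝕜] H} {g u : ℝ → H} {K p q : ℝ}

lemma scalarFlow (S : SolutionSetting A B g u K p q) :
    ScalarFlow {r : ℝ | (r : 𝕜) ∈ spec A} K p q (fun t => ‖u t‖) (fun t => ‖val B (u t)‖) where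
  w_nonneg _ := norm_nonneg _
  z_nonneg _ := norm_nonneg _
  ac_w := locallyAC_norm_sq S.ac
  ac_z := S.ac_sqrt
  flow := by
    filter_upwards [S.equation] with t ht hpos
    obtain ⟨hA, hd, hd2⟩ := ht hpos
    refine ⟨‖val A (u t)‖, ‖g t‖, RCLike.re (inner 𝕜 (g t) (u t)),
      RCLike.re (inner 𝕜 (g t) (val A (u t))), norm_nonneg _, norm_nonneg _, S.bound t hpos.le,
      ?_, ?_, ?_, fun c => ?_, fun c d hd0 hdist => ?_⟩
    · convert hasDerivAt_norm_sq (𝕜 := 𝕜) hd using 1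
      rw [inner_sub_left, map_sub, ← inner_conj_symm (val A (u t)), RCLike.conj_re,
        S.sqrt.re_inner_val_self hA]
    · convert hd2 using 1
      rw [inner_sub_left, map_sub, inner_self_eq_norm_sq]
    · exact (RCLike.abs_re_le_norm _).trans (norm_inner_le_norm _ _)
    · rw [← S.sqrt.norm_val_sub_smul_sq hA, Real.sqrt_sq (norm_nonneg _)]
      have e : RCLike.re (inner 𝕜 (g t) (val A (u t))) - c * RCLike.re (inner 𝕜 (g t) (u t)) =
          RCLike.re (inner 𝕜 (g t) (val A (u t) - (c : 𝕜) • u t)) := by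
        rw [inner_sub_right, map_sub, inner_smul_right, RCLike.re_ofReal_mul]
      rw [e]
      exact (RCLike.abs_re_le_norm _).trans (norm_inner_le_norm _ _)
    · rw [← S.sqrt.norm_val_sub_smul_sq hA, ← mul_pow]
      rcases hd0.eq_or_lt with rfl | hd0
      · rw [zero_mul, zero_pow two_ne_zero]
        positivity
      · refine pow_le_pow_left₀ (by positivity) ?_ 2
        have h1 := gap_bound S.selfAdjoint hd0 (c := c) (fun s hs => by
          by_contra hcon
          exact absurd (hdist s hcon) (not_le.2 hs)) ⟨u t, hA⟩
        rwa [← val_of_mem hA] at h1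

end SolutionSetting

end Solutions

/-! ### Exponential rates when `Q` tends to `r`. -/

section ScalarDecay

variable {σ : Set ℝ} {K p q r : ℝ} {w z : ℝ → ℝ}

namespace ScalarFlow

/-- If the Dirichlet quotient tends to `r`, then `w` decays essentially as `e^{-rt}`. -/
lemma exists_exp_bounds (hF : ScalarFlow σ K p q w z) (hK : 0 ≤ K) (hp : 0 < p) (hq : 0 < q)
    (hw : ∀ t, 0 ≤ t → 0 < w t) (hw0 : Tendsto w atTop (𝓝 0)) (hz0 : Tendsto z atTop (𝓝 0))
    (hQ : Tendsto (quot w z) atTop (𝓝 r)) {ε : ℝ} (hε : 0 < ε) :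
    ∃ c C T : ℝ, 0 < c ∧ 0 < C ∧ 0 ≤ T ∧ ∀ t, T ≤ t →
      w t ^ 2 ≤ C * Real.exp (-(2 * (r - ε)) * t) ∧ c * Real.exp (-(2 * (r + ε)) * t) ≤ w t ^ 2 := by
  -- By `2zw ≤ (1 + Q) w²`, this bounds `2|G₁| / w²`. Hence `(w²)' = 2G₁ - 2Q w²` has logarithmic
  -- rate tending to `-2r`.
  have hη : Tendsto (fun t => 2 * (K * w t ^ p) + K * z t ^ q * (1 + quot w z t)) atTop (𝓝 0) := by
    simpa using ((tendsto_const_mul_rpow hw0 hp K).const_mul 2).add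
      ((tendsto_const_mul_rpow hz0 hq K).mul (hQ.const_add 1))
  have hQ' := hQ.eventually (Metric.ball_mem_nhds r (half_pos hε))
  obtain ⟨T₁, hT₁⟩ := eventually_atTop.1 ((hη.eventually (gt_mem_nhds hε)).and hQ')
  set T := max 0 T₁
  have hT : 0 ≤ T := le_max_left _ _
  have hd : ∀ᵐ t, T < t → ∃ X' : ℝ, HasDerivAt (fun s => w s ^ 2) X' t ∧
      X' ≤ -(2 * (r - ε)) * w t ^ 2 ∧ -(2 * (r + ε)) * w t ^ 2 ≤ X' := by
    filter_upwards [hF.ae_flow hp hq] with t ht hmem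
    have ht0 := hT.trans_lt hmem
    obtain ⟨a, h, G₁, G₂, hf, hh⟩ := ht ht0
    obtain ⟨h1, h2⟩ := hT₁ t ((le_max_right _ _).trans hmem.le)
    have hQX := quot_mul (z := z) (hw t ht0.le)
    have h3 := abs_lt.1 ((Real.dist_eq _ _).symm.trans_lt h2)
    have hβ : 0 ≤ K * z t ^ q := mul_nonneg hK (Real.rpow_nonneg (hF.z_nonneg t) q)
    have h4 := hf.abs_G₁_le.trans (mul_le_mul_of_nonneg_right hh (hw t ht0.le).le)
    have h5 : 2 * |G₁| ≤ ε * w t ^ 2 := by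
      have h6 := mul_le_mul_of_nonneg_right h1.le (sq_nonneg (w t))
      have h7 : K * z t ^ q * (2 * (z t * w t)) ≤
          K * z t ^ q * ((1 + quot w z t) * w t ^ 2) := by
        refine mul_le_mul_of_nonneg_left ?_ hβ
        rw [add_mul, hQX]
        nlinarith [sq_nonneg (z t - w t)]
      nlinarith
    have h6 := abs_le.1 (show |G₁| ≤ ε / 2 * w t ^ 2 by linarith)
    have h7 := mul_le_mul_of_nonneg_right h3.1.le (sq_nonneg (w t))
    have h8 := mul_le_mul_of_nonneg_right h3.2.le (sq_nonneg (w t))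
    refine ⟨_, hf.deriv_w, ?_, ?_⟩ <;> rw [← hQX] <;> nlinarith
  have hac := hF.ac_w.mono hT
  have hup := gronwall (c := 2 * (r - ε)) (d := 2 * (r - ε) + 1) (m := 0) (by linarith) hac (by
    filter_upwards [hd] with t ht hmem
    obtain ⟨X', h1, h2, -⟩ := ht hmem
    exact ⟨X', h1, by linarith⟩)
  have hlow := gronwall (f := fun t => -1 * w t ^ 2) (c := 2 * (r + ε)) (d := 2 * (r + ε) + 1)
    (m := 0) (by linarith) ((locallyAC_of_contDiff contDiff_const T).mul hac) (by
    filter_upwards [hd] with t ht hmem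
    obtain ⟨X', h1, -, h2⟩ := ht hmem
    exact ⟨_, h1.const_mul (-1), by linarith⟩)
  simp only [zero_div, zero_mul, sub_zero] at hup hlow
  have hwT := hw T hT
  refine ⟨w T ^ 2 * Real.exp (2 * (r + ε) * T), w T ^ 2 * Real.exp (2 * (r - ε) * T), T,
    by positivity, by positivity, hT, fun t ht => ⟨?_, ?_⟩⟩
  · have h1 := hup (mem_Ici.2 le_rfl) (mem_Ici.2 ht) ht
    rw [neg_mul, Real.exp_neg, ← div_eq_mul_inv, le_div_iff₀ (Real.exp_pos _)]
    exact h1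
  · have h1 := hlow (mem_Ici.2 le_rfl) (mem_Ici.2 ht) ht
    simp only at h1
    rw [neg_mul, Real.exp_neg, ← div_eq_mul_inv, div_le_iff₀ (Real.exp_pos _)]
    linarith

/-- Exponential decay of the forcing term. -/
lemma exists_forcing_bound (hF : ScalarFlow σ K p q w z) (hK : 0 ≤ K) (hp : 0 < p) (hq : 0 < q)
    (hw : ∀ t, 0 ≤ t → 0 < w t) (hw0 : Tendsto w atTop (𝓝 0)) (hz0 : Tendsto z atTop (𝓝 0))
    (hQ : Tendsto (quot w z) atTop (𝓝 r)) {γ : ℝ} (hγp : γ < (1 + p) * r)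
    (hγq : γ < (1 + q) * r) :
    ∃ C T : ℝ, 0 ≤ C ∧ 0 ≤ T ∧ ∀ t, T ≤ t →
      K * (w t ^ (1 + p) + z t ^ (1 + q)) ≤ C * Real.exp (-γ * t) := by
  have hp1 : 0 < 1 + p := by linarith
  have hq1 : 0 < 1 + q := by linarith
  -- The largest loss for which `(1 + p)(r - ε)` and `(1 + q)(r - ε)` are still at least `γ`.
  set ε := min (r - γ / (1 + p)) (r - γ / (1 + q)) with hε
  have hε0 : 0 < ε := lt_min (sub_pos.2 ((div_lt_iff₀' hp1).2 hγp))
    (sub_pos.2 ((div_lt_iff₀' hq1).2 hγq))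
  obtain ⟨c, C, T₁, hc, hC, hT₁, hX⟩ := hF.exists_exp_bounds hK hp hq hw hw0 hz0 hQ hε0
  obtain ⟨T₂, hT₂⟩ := eventually_atTop.1 (hQ.eventually (ge_mem_nhds (lt_add_one r)))
  have hr1 : 0 ≤ r + 1 :=
    (quot_nonneg (w := w) (z := z) T₂).trans (hT₂ T₂ le_rfl)
  have key : ∀ x y s : ℝ, 0 ≤ x → 0 ≤ y → 0 < s → γ ≤ s * (r - ε) → ∀ t, 0 ≤ t →
      x ^ 2 ≤ y * Real.exp (-(2 * (r - ε)) * t) → x ^ s ≤ y ^ (s / 2) * Real.exp (-γ * t) := by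
    intro x y s hx hy hs hγs t ht hle
    have h1 : x ^ s = (x ^ 2) ^ (s / 2) := by rw [sq_rpow hx]; ring_nf
    rw [h1]
    refine (Real.rpow_le_rpow (sq_nonneg x) hle (by positivity)).trans ?_
    rw [Real.mul_rpow hy (Real.exp_pos _).le, ← Real.exp_mul]
    refine mul_le_mul_of_nonneg_left (Real.exp_le_exp.2 ?_) (by positivity)
    nlinarith [mul_le_mul_of_nonneg_right hγs ht]
  have hγ1 : γ ≤ (1 + p) * (r - ε) := by
    have : γ / (1 + p) ≤ r - ε := by linarith [min_le_left (r - γ / (1 + p)) (r - γ / (1 + q))]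
    rwa [div_le_iff₀' hp1] at this
  have hγ2 : γ ≤ (1 + q) * (r - ε) := by
    have : γ / (1 + q) ≤ r - ε := by linarith [min_le_right (r - γ / (1 + p)) (r - γ / (1 + q))]
    rwa [div_le_iff₀' hq1] at this
  refine ⟨K * (C ^ ((1 + p) / 2) + ((r + 1) * C) ^ ((1 + q) / 2)), max T₁ T₂, by positivity,
    hT₁.trans (le_max_left _ _), fun t ht => ?_⟩
  have ht1 : T₁ ≤ t := (le_max_left _ _).trans ht
  have ht0 : 0 ≤ t := hT₁.trans ht1
  have h1 := (hX t ht1).1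
  have h2 : z t ^ 2 ≤ (r + 1) * C * Real.exp (-(2 * (r - ε)) * t) := by
    rw [← quot_mul (hw t ht0), mul_assoc]
    exact mul_le_mul (hT₂ t ((le_max_right _ _).trans ht)) h1 (sq_nonneg _) hr1
  have h3 := key _ _ _ (hF.w_nonneg t) hC.le hp1 hγ1 t ht0 h1
  have h4 := key _ _ _ (hF.z_nonneg t) (by positivity) hq1 hγ2 t ht0 h2
  rw [mul_assoc, add_mul]
  exact mul_le_mul_of_nonneg_left (add_le_add h3 h4) hK

end ScalarFlow

end ScalarDecay

/-! ### Splitting off finitely many eigenspaces. -/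

section Modes

variable {𝕜 H : Type*} [RCLike 𝕜] [NormedAddCommGroup H] [InnerProductSpace 𝕜 H]
  [CompleteSpace H]

/-- The component of `x` along the eigenspaces of the numbers which are not in `F`. -/
noncomputable def compl (A : H →ₗ.[𝕜] H) (F : Finset ℝ) (x : H) : H := x - ∑ s ∈ F, proj A s x

variable {A B : H →ₗ.[𝕜] H}

lemma proj_compl (hA : IsSelfAdjoint A) (F : Finset ℝ) (x : H) (r : ℝ) :
    proj A r (compl A F x) = if r ∈ F then 0 else proj A r x := by
  rw [compl, map_sub, map_sum]
  split_ifs with hr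
  · rw [Finset.sum_eq_single_of_mem r hr fun s _ hs => proj_proj_of_ne hA hs.symm x,
      proj_of_mem (proj_mem r x), sub_self]
  · rw [Finset.sum_eq_zero fun s hs => proj_proj_of_ne hA (fun h => hr (by rwa [h])) x, sub_zero]

lemma inner_compl (hA : IsSelfAdjoint A) (F : Finset ℝ) (x : H) :
    inner 𝕜 x (compl A F x) = inner 𝕜 (compl A F x) (compl A F x) := by
  have h : ∀ s ∈ F, inner 𝕜 (proj A s x) (compl A F x) = (0 : 𝕜) := fun s hs => by
    rw [inner_proj_left, proj_compl hA, if_pos hs, inner_zero_right]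
  nth_rw 2 [compl]
  rw [inner_sub_left, sum_inner, Finset.sum_eq_zero h, sub_zero]

lemma hasSum_norm_sq_compl (hA : IsSelfAdjoint A) (hE : (⨆ r, eigenspace A r)ᗮ = ⊥)
    (F : Finset ℝ) (x : H) :
    HasSum (fun r => if r ∈ F then 0 else ‖proj A r x‖ ^ 2) (‖compl A F x‖ ^ 2) := by
  convert hasSum_norm_sq_proj hA hE (compl A F x) using 2 with r
  rw [proj_compl hA]
  split_ifs <;> simp

lemma norm_compl_sq (hA : IsSelfAdjoint A) (hE : (⨆ r, eigenspace A r)ᗮ = ⊥) (F : Finset ℝ)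
    (x : H) : ‖compl A F x‖ ^ 2 = ‖x‖ ^ 2 - ∑ s ∈ F, ‖proj A s x‖ ^ 2 := by
  refine (hasSum_norm_sq_compl hA hE F x).unique ?_
  have h := (hasSum_norm_sq_proj hA hE x).sub
    (hasSum_sum_of_ne_finset_zero (f := fun r => if r ∈ F then ‖proj A r x‖ ^ 2 else 0) (s := F)
      fun r hr => if_neg hr)
  rw [Finset.sum_congr rfl fun r hr => if_pos hr] at h
  refine h.congr_fun fun r => ?_
  split_ifs <;> simp

lemma proj_val (hA : IsSelfAdjoint A) {x : H} (hx : x ∈ A.domain) (r : ℝ) :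
    proj A r (val A x) = (r : 𝕜) • proj A r x :=
  proj_eq_smul_of_mem_graph hA (fun _ hv => mem_graph_of_mem_eigenspace hA hv) (mem_graph_val hx)

lemma proj_val_sqrt (hA : IsSelfAdjoint A) (hn : IsNonneg A) (hB : IsNonnegSqrt A B) {x : H}
    (hx : x ∈ B.domain) (r : ℝ) : proj A r (val B x) = (√r : 𝕜) • proj A r x :=
  hB.proj_apply hA hn (mem_graph_val hx) r

lemma norm_proj_val_sqrt_sq (hA : IsSelfAdjoint A) (hn : IsNonneg A) (hB : IsNonnegSqrt A B)
    {x : H} (hx : x ∈ B.domain) (r : ℝ) :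
    ‖proj A r (val B x)‖ ^ 2 = r * ‖proj A r x‖ ^ 2 := by
  rw [proj_val_sqrt hA hn hB hx, norm_smul, RCLike.norm_ofReal, mul_pow, sq_abs]
  by_cases h0 : proj A r x = 0
  · rw [h0, norm_zero]; ring
  · rw [Real.sq_sqrt (eigenspace_nonneg hA hn (proj_mem r x) h0)]

lemma mem_spec_of_proj_ne_zero (hA : IsSelfAdjoint A) {r : ℝ} {x : H} (h : proj A r x ≠ 0) :
    (r : 𝕜) ∈ spec A :=
  not_inResolventSet ⟨_, h, (mem_eigenspace_iff hA).1 (proj_mem r x)⟩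

/-- Termwise in the expansion: a nonzero component outside `F` belongs to an eigenvalue at least
`b`. -/
lemma le_norm_compl_val_sqrt (hA : IsSelfAdjoint A) (hn : IsNonneg A) (hB : IsNonnegSqrt A B)
    (hE : (⨆ r, eigenspace A r)ᗮ = ⊥) {F : Finset ℝ} {b : ℝ}
    (hF : ∀ r : ℝ, (r : 𝕜) ∈ spec A → r ∈ F ∨ b ≤ r) {x : H} (hx : x ∈ B.domain) :
    b * ‖compl A F x‖ ^ 2 ≤ ‖compl A F (val B x)‖ ^ 2 := by
  refine hasSum_le (fun r => ?_) ((hasSum_norm_sq_compl hA hE F x).mul_left b)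
    (hasSum_norm_sq_compl hA hE F (val B x))
  split_ifs with hr
  · simp
  · rw [norm_proj_val_sqrt_sq hA hn hB hx]
    by_cases h0 : proj A r x = 0
    · simp [h0]
    · exact mul_le_mul_of_nonneg_right
        ((hF r (mem_spec_of_proj_ne_zero hA h0)).resolve_left hr) (sq_nonneg _)

lemma le_norm_compl_val (hA : IsSelfAdjoint A) (hn : IsNonneg A) (hB : IsNonnegSqrt A B)
    (hE : (⨆ r, eigenspace A r)ᗮ = ⊥) {F : Finset ℝ} {b : ℝ}
    (hF : ∀ r : ℝ, (r : 𝕜) ∈ spec A → r ∈ F ∨ b ≤ r) {x : H} (hx : x ∈ A.domain) :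
    b * ‖compl A F (val B x)‖ ^ 2 ≤ ‖compl A F (val A x)‖ ^ 2 := by
  obtain ⟨-, h2, h3⟩ := hB.mem_domain hx
  rw [← h3]
  exact le_norm_compl_val_sqrt hA hn hB hE hF h2

end Modes

/-! ### Convergence of the single modes and decay of the high ones. -/

section Expansion

variable {𝕜 H : Type*} [RCLike 𝕜] [NormedAddCommGroup H] [InnerProductSpace 𝕜 H]
  [CompleteSpace H] [NormedSpace ℝ H]

namespace SolutionSetting

variable {A B : H →ₗ.[𝕜] H} {g u : ℝ → H} {K p q : ℝ}

/-- Estimate for the variation of the rescaled component of `u` along an eigenspace. -/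
lemma mode_estimate (S : SolutionSetting A B g u K p q) {s γ C T : ℝ} (hsγ : s < γ) (hT : 0 ≤ T)
    (hg : ∀ t, T ≤ t → ‖g t‖ ≤ C * Real.exp (-γ * t)) {a b : ℝ} (ha : T ≤ a) (hab : a ≤ b) :
    ‖((Real.exp (s * b) : ℝ) : 𝕜) • proj A s (u b) - ((Real.exp (s * a) : ℝ) : 𝕜) • proj A s (u a)‖ ≤
      C / (γ - s) * Real.exp (-(γ - s) * a) := by
  -- The increment itself serves as test vector: `Re ⟨D, u⟩` obeys a scalar linear inequality with
  -- rate `s`, and its rescaled increment from `a` to `b` is exactly `|D|²`.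
  set D := ((Real.exp (s * b) : ℝ) : 𝕜) • proj A s (u b) -
    ((Real.exp (s * a) : ℝ) : 𝕜) • proj A s (u a) with hD
  have hC : 0 ≤ C := nonneg_of_mul_nonneg_left ((norm_nonneg _).trans (hg T le_rfl))
    (Real.exp_pos _)
  have hDmem : D ∈ eigenspace A s := Submodule.sub_mem _
    (Submodule.smul_mem _ _ (proj_mem _ _)) (Submodule.smul_mem _ _ (proj_mem _ _))
  have hac : AbsolutelyContinuousOnInterval (fun t => RCLike.re (inner 𝕜 D (u t))) a b := by
    refine absolutelyContinuousOnInterval_of_dist_le (C := ‖D‖)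
      (absolutelyContinuousOnInterval_mono_nonneg S.ac (hT.trans ha) hab) fun x _ y _ => ?_
    rw [Real.dist_eq, ← map_sub, ← inner_sub_right, dist_eq_norm]
    exact (RCLike.abs_re_le_norm _).trans (norm_inner_le_norm _ _)
  have h1 := gronwall_Icc (c := s) (d := γ) (m := ‖D‖ * C) hsγ.ne hab hac (by
    filter_upwards [S.equation] with t ht hmem
    have hTt : T ≤ t := ha.trans hmem.1.le
    obtain ⟨hA, hd, -⟩ := ht ((hT.trans ha).trans_lt hmem.1)
    refine ⟨_, hasDerivAt_re_inner hd D, ?_⟩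
    have h2 : inner 𝕜 D (val A (u t)) = (s : 𝕜) * inner 𝕜 D (u t) := by
      rw [← inner_proj_of_mem hDmem, proj_val S.selfAdjoint hA, inner_smul_right,
        inner_proj_of_mem hDmem]
    have h3 : RCLike.re (inner 𝕜 D (g t)) ≤ ‖D‖ * (C * Real.exp (-γ * t)) :=
      (RCLike.re_le_norm _).trans ((norm_inner_le_norm _ _).trans
        (mul_le_mul_of_nonneg_left (hg t hTt) (norm_nonneg _)))
    rw [inner_sub_right, map_sub, h2, RCLike.re_ofReal_mul]
    linarith)
  have h2 : RCLike.re (inner 𝕜 D (u b)) * Real.exp (s * b) -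
      RCLike.re (inner 𝕜 D (u a)) * Real.exp (s * a) = ‖D‖ ^ 2 := by
    rw [← inner_self_eq_norm_sq (𝕜 := 𝕜)]
    nth_rw 4 [hD]
    rw [inner_sub_right, inner_smul_right, inner_smul_right, map_sub, RCLike.re_ofReal_mul,
      RCLike.re_ofReal_mul, inner_proj_of_mem hDmem, inner_proj_of_mem hDmem]
    ring
  have hsg : 0 < γ - s := sub_pos.2 hsγ
  have e : Real.exp (-γ * a) * Real.exp (s * a) = Real.exp (-(γ - s) * a) := by
    rw [← Real.exp_add]; ring_nf
  have e2 : ‖D‖ * C / (s - γ) = -(‖D‖ * (C / (γ - s))) := by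
    rw [← neg_sub γ s, div_neg, mul_div_assoc]
  rw [e2] at h1
  have h3 : ‖D‖ ^ 2 ≤ ‖D‖ * (C / (γ - s) * Real.exp (-(γ - s) * a)) := by
    have h4 : 0 ≤ ‖D‖ * (C / (γ - s)) * Real.exp (-γ * b) * Real.exp (s * b) := by positivity
    calc ‖D‖ ^ 2 ≤ ‖D‖ * (C / (γ - s)) * (Real.exp (-γ * a) * Real.exp (s * a)) := by
          nlinarith
      _ = _ := by rw [e]; ring
  rcases (norm_nonneg D).eq_or_lt with h0 | h0
  · rw [← h0]
    positivity
  · rw [pow_two] at h3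
    exact le_of_mul_le_mul_left h3 h0

/-- Let `b → ∞` in `mode_estimate` and undo the rescaling. Even for `s` much smaller than `γ` the
error has the full rate `γ`. -/
lemma mode_limit_estimate (S : SolutionSetting A B g u K p q) {s γ C T : ℝ} (hsγ : s < γ)
    (hT : 0 ≤ T) (hg : ∀ t, T ≤ t → ‖g t‖ ≤ C * Real.exp (-γ * t)) {v : H}
    (hv : Tendsto (fun t => ((Real.exp (s * t) : ℝ) : 𝕜) • proj A s (u t)) atTop (𝓝 v)) {a : ℝ}
    (ha : T ≤ a) :
    ‖proj A s (u a) - ((Real.exp (-s * a) : ℝ) : 𝕜) • v‖ ≤ C / (γ - s) * Real.exp (-γ * a) := by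
  have h1 : ‖v - ((Real.exp (s * a) : ℝ) : 𝕜) • proj A s (u a)‖ ≤
      C / (γ - s) * Real.exp (-(γ - s) * a) := by
    refine le_of_tendsto (hv.sub_const _).norm ?_
    filter_upwards [eventually_ge_atTop a] with b hb
    exact S.mode_estimate hsγ hT hg ha hb
  have e : proj A s (u a) - ((Real.exp (-s * a) : ℝ) : 𝕜) • v =
      -(((Real.exp (-s * a) : ℝ) : 𝕜) • (v - ((Real.exp (s * a) : ℝ) : 𝕜) • proj A s (u a))) := by
    rw [smul_sub, smul_smul, ← RCLike.ofReal_mul, ← Real.exp_add]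
    simp
  rw [e, norm_neg, norm_smul, RCLike.norm_ofReal, abs_of_pos (Real.exp_pos _)]
  calc Real.exp (-s * a) * ‖v - ((Real.exp (s * a) : ℝ) : 𝕜) • proj A s (u a)‖
      ≤ Real.exp (-s * a) * (C / (γ - s) * Real.exp (-(γ - s) * a)) := by gcongr
    _ = C / (γ - s) * (Real.exp (-s * a) * Real.exp (-(γ - s) * a)) := by ring
    _ = _ := by rw [← Real.exp_add]; ring_nf

lemma exists_mode_limit (S : SolutionSetting A B g u K p q) {s γ C T : ℝ} (hsγ : s < γ)
    (hT : 0 ≤ T) (hg : ∀ t, T ≤ t → ‖g t‖ ≤ C * Real.exp (-γ * t)) :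
    ∃ v ∈ eigenspace A s,
      Tendsto (fun t => ((Real.exp (s * t) : ℝ) : 𝕜) • proj A s (u t)) atTop (𝓝 v) := by
  have hlim : Tendsto (fun a => C / (γ - s) * Real.exp (-(γ - s) * a)) atTop (𝓝 0) := by
    have h : Tendsto (fun a => Real.exp (-(γ - s) * a)) atTop (𝓝 0) :=
      Real.tendsto_exp_atBot.comp (tendsto_id.const_mul_atTop_of_neg (by linarith))
    simpa using h.const_mul (C / (γ - s))
  have hc : CauchySeq fun t => ((Real.exp (s * t) : ℝ) : 𝕜) • proj A s (u t) := by
    rw [Metric.cauchySeq_iff']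
    intro ε hε
    obtain ⟨N, hN⟩ := eventually_atTop.1 (hlim.eventually (gt_mem_nhds hε))
    refine ⟨max T N, fun n hn => ?_⟩
    rw [dist_eq_norm]
    exact (S.mode_estimate hsγ hT hg (le_max_left _ _) hn).trans_lt (hN _ (le_max_right _ _))
  obtain ⟨v, hv⟩ := cauchySeq_tendsto_of_complete hc
  have hcl : IsClosed (eigenspace A s : Set H) := Submodule.isClosed_orthogonal _
  exact ⟨v, hcl.mem_of_tendsto hv (Eventually.of_forall fun t =>
    Submodule.smul_mem _ _ (proj_mem _ _)), hv⟩

/-- Decay of the high modes. -/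
lemma high_modes [IsScalarTower ℝ 𝕜 H] (S : SolutionSetting A B g u K p q) {F : Finset ℝ}
    {b γ C T : ℝ} (hγ0 : 0 < γ) (hγb : γ < b)
    (hF : ∀ r : ℝ, (r : 𝕜) ∈ spec A → r ∈ F ∨ b ≤ r)
    (hT : 0 ≤ T) (hg : ∀ t, T ≤ t → ‖g t‖ ≤ C * Real.exp (-γ * t)) :
    ∃ M : ℝ, 0 ≤ M ∧ ∀ t, T ≤ t →
      ‖compl A F (val B (u t))‖ ^ 2 ≤ M * Real.exp (-(2 * γ) * t) := by
  have hb : 0 < b := hγ0.trans hγb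
  have hE : ∀ t, 0 ≤ t → ‖compl A F (val B (u t))‖ ^ 2 =
      ‖val B (u t)‖ ^ 2 - ∑ s ∈ F, s * ‖proj A s (u t)‖ ^ 2 := fun t ht => by
    rw [norm_compl_sq S.selfAdjoint S.total]
    congr 1
    exact Finset.sum_congr rfl fun s _ =>
      norm_proj_val_sqrt_sq S.selfAdjoint S.nonneg S.sqrt (S.mem_sqrt t ht) s
  have hacP : ∀ s, LocallyAC (fun t => ‖proj A s (u t)‖ ^ 2) 0 := fun s =>
    locallyAC_norm_sq fun T hT => absolutelyContinuousOnInterval_of_dist_le (C := 1) (S.ac T hT)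
      fun x _ y _ => by
        rw [dist_eq_norm, dist_eq_norm, ← map_sub, one_mul]
        exact norm_proj_le _ _
  have hacS : ∀ G : Finset ℝ, LocallyAC (fun t => ∑ s ∈ G, s * ‖proj A s (u t)‖ ^ 2) 0 := by
    intro G
    induction G using Finset.induction_on with
    | empty => simpa using locallyAC_of_contDiff contDiff_const 0
    | insert s G hs ih =>
      simp only [Finset.sum_insert hs]
      exact ((locallyAC_of_contDiff contDiff_const 0).mul (hacP s)).add ih
  -- The energy of the high modes, written as the total minus finitely many terms, so that
  -- regularity and derivative come for free.
  set E : ℝ → ℝ := fun t => ‖val B (u t)‖ ^ 2 - ∑ s ∈ F, s * ‖proj A s (u t)‖ ^ 2 with hEdef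
  have hacE : LocallyAC E T := (S.ac_sqrt.sub (hacS F)).mono hT
  -- The dissipation is split: the fraction `θ = γ₂/b` yields decay at rate `2γ₂ > 2γ`, and the
  -- fraction `1 - θ` absorbs the forcing by Young's inequality.
  set γ₂ := (γ + b) / 2 with hγ₂
  have hγγ₂ : γ < γ₂ := by rw [hγ₂]; linarith
  set θ := γ₂ / b with hθ
  have hθ1 : 0 < 1 - θ := by
    rw [hθ, sub_pos, div_lt_one hb, hγ₂]
    linarith
  have hθ0 : 0 < θ := by rw [hθ, hγ₂]; positivity
  have hθb : θ * b = γ₂ := div_mul_cancel₀ _ hb.ne'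
  have hgr := gronwall (c := 2 * γ₂) (d := 2 * γ) (m := C ^ 2 / (2 * (1 - θ))) (by linarith) hacE (by
    filter_upwards [S.equation] with t ht hmem
    have ht0 : 0 < t := hT.trans_lt hmem
    obtain ⟨hA, hd, hd2⟩ := ht ht0
    have hdP : ∀ s, HasDerivAt (fun t => ‖proj A s (u t)‖ ^ 2)
        (2 * RCLike.re (inner 𝕜 (g t - val A (u t)) (proj A s (u t)))) t := fun s => by
      have h1 : HasDerivAt (fun t => proj A s (u t)) (proj A s (g t - val A (u t))) t :=
        ((proj A s).restrictScalars ℝ).hasFDerivAt.comp_hasDerivAt t hd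
      convert hasDerivAt_norm_sq (𝕜 := 𝕜) h1 using 3
      rw [← inner_proj_left, ← inner_conj_symm, inner_proj_left, inner_conj_symm, ← inner_proj_left]
    have hdS := HasDerivAt.fun_sum (u := F) fun s _ => (hdP s).const_mul s
    refine ⟨_, hd2.sub hdS, ?_⟩
    have e1 : compl A F (val A (u t)) = val A (u t) - ∑ s ∈ F, (s : 𝕜) • proj A s (u t) := by
      rw [compl]
      congr 1
      exact Finset.sum_congr rfl fun s _ => proj_val S.selfAdjoint hA s
    have e2 : 2 * RCLike.re (inner 𝕜 (g t - val A (u t)) (val A (u t))) -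
        ∑ s ∈ F, s * (2 * RCLike.re (inner 𝕜 (g t - val A (u t)) (proj A s (u t)))) =
        2 * RCLike.re (inner 𝕜 (g t - val A (u t)) (compl A F (val A (u t)))) := by
      rw [e1, inner_sub_right _ (val A (u t)), map_sub, inner_sum, map_sum, mul_sub, Finset.mul_sum]
      congr 1
      refine Finset.sum_congr rfl fun s _ => ?_
      rw [inner_smul_right, RCLike.re_ofReal_mul]
      ring
    rw [e2, inner_sub_left, map_sub, inner_compl S.selfAdjoint, inner_self_eq_norm_sq]
    have h3 : RCLike.re (inner 𝕜 (g t) (compl A F (val A (u t)))) ≤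
        C * Real.exp (-γ * t) * ‖compl A F (val A (u t))‖ :=
      (RCLike.re_le_norm _).trans ((norm_inner_le_norm _ _).trans
        (mul_le_mul_of_nonneg_right (hg t hmem.le) (norm_nonneg _)))
    have h4 := le_norm_compl_val S.selfAdjoint S.nonneg S.sqrt S.total hF hA
    rw [hE t ht0.le] at h4
    change b * E t ≤ _ at h4
    set a := ‖compl A F (val A (u t))‖
    set h := C * Real.exp (-γ * t) with hh
    have h5 : C ^ 2 / (2 * (1 - θ)) * Real.exp (-(2 * γ) * t) = h ^ 2 / (2 * (1 - θ)) := by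
      rw [hh, mul_pow, ← Real.exp_nat_mul]
      push_cast
      ring_nf
    have h6 : 2 * (h * a) ≤ 2 * (1 - θ) * a ^ 2 + h ^ 2 / (2 * (1 - θ)) := by
      have h7 : 0 ≤ (2 * (1 - θ) * a - h) ^ 2 / (2 * (1 - θ)) := by positivity
      have h8 : (2 * (1 - θ) * a - h) ^ 2 / (2 * (1 - θ)) =
          2 * (1 - θ) * a ^ 2 - 2 * (h * a) + h ^ 2 / (2 * (1 - θ)) := by
        field_simp
        ring
      linarith
    rw [h5]
    have h7 : γ₂ * E t ≤ θ * a ^ 2 := by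
      rw [← hθb, mul_assoc]
      exact mul_le_mul_of_nonneg_left h4 hθ0.le
    linarith)
  set m := C ^ 2 / (2 * (1 - θ)) / (2 * γ₂ - 2 * γ) with hm
  have hm0 : 0 ≤ m := by
    have : 0 < 2 * γ₂ - 2 * γ := by linarith
    positivity
  have hET : 0 ≤ E T := by rw [hEdef]; simp only; rw [← hE T hT]; positivity
  set D := E T * Real.exp (2 * γ₂ * T) with hD
  have hD0 : 0 ≤ D := by positivity
  refine ⟨m + D, by positivity, fun t ht => ?_⟩
  have ht0 : 0 ≤ t := hT.trans ht
  have h1 := hgr (mem_Ici.2 le_rfl) (mem_Ici.2 ht) ht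
  simp only at h1
  rw [hE t ht0]
  change E t ≤ _
  have h2 : (E t - m * Real.exp (-(2 * γ) * t)) * Real.exp (2 * γ₂ * t) ≤ D := by
    refine h1.trans ?_
    rw [hD]
    refine mul_le_mul_of_nonneg_right ?_ (Real.exp_pos _).le
    have : 0 ≤ m * Real.exp (-(2 * γ) * T) := by positivity
    linarith
  rw [← le_div_iff₀ (Real.exp_pos _), div_eq_mul_inv, ← Real.exp_neg] at h2
  have h3 : Real.exp (-(2 * γ₂ * t)) ≤ Real.exp (-(2 * γ) * t) :=
    Real.exp_le_exp.2 (by nlinarith)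
  have h4 := mul_le_mul_of_nonneg_left h3 hD0
  rw [add_mul]
  linarith

end SolutionSetting

end Expansion

/-! ### The expansion of fast solutions and the mutual exclusion of the alternatives. -/

section Classification

variable {𝕜 H : Type*} [RCLike 𝕜] [NormedAddCommGroup H] [InnerProductSpace 𝕜 H]

lemma coe_lt_nextEigenvalue {A : H →ₗ.[𝕜] H} (hs : HasDiscreteSpectrum A) (r : ℝ) :
    (r : EReal) < nextEigenvalue A r := by
  obtain ⟨b, hb, h⟩ := exists_gap hs r
  refine (EReal.coe_lt_coe_iff.2 hb).trans_le (le_sInf ?_)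
  rintro _ ⟨m, hm, he, rfl⟩
  exact EReal.coe_le_coe_iff.2 ((h m (not_inResolventSet he)).resolve_left (not_le.2 hm))

/-- The exponent `γ = r` is admissible for fast solutions, so the expansion sees the leading term.
-/
lemma coe_lt_min_nextEigenvalue {A : H →ₗ.[𝕜] H} (hs : HasDiscreteSpectrum A) {p q r : ℝ}
    (hp : 0 < p) (hq : 0 < q) (hr : 0 < r) :
    (r : EReal) < min (nextEigenvalue A r)
      (min (((1 + p) * r : ℝ) : EReal) (((1 + q) * r : ℝ) : EReal)) :=
  lt_min (coe_lt_nextEigenvalue hs r) (lt_min (EReal.coe_lt_coe_iff.2 (by nlinarith))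
    (EReal.coe_lt_coe_iff.2 (by nlinarith)))

lemma tendsto_exp_neg_mul {k : ℝ} (hk : 0 < k) : Tendsto (fun t => Real.exp (-k * t)) atTop (𝓝 0) :=
  Real.tendsto_exp_atBot.comp (tendsto_id.const_mul_atTop_of_neg (by linarith))

variable [CompleteSpace H]

lemma norm_le_normSqrt (A : H →ₗ.[𝕜] H) (x : H) : ‖x‖ ≤ normSqrt A x :=
  Real.le_sqrt_of_sq_le (by linarith [sq_nonneg ‖val (sqrtOp A) x‖])

lemma norm_val_le_normSqrt (A : H →ₗ.[𝕜] H) (x : H) : ‖val (sqrtOp A) x‖ ≤ normSqrt A x :=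
  Real.le_sqrt_of_sq_le (by linarith [sq_nonneg ‖x‖])

lemma normSqrt_le (A : H →ₗ.[𝕜] H) (x : H) : normSqrt A x ≤ ‖x‖ + ‖val (sqrtOp A) x‖ := by
  refine Real.sqrt_le_iff.2 ⟨by positivity, ?_⟩
  nlinarith [mul_nonneg (norm_nonneg x) (norm_nonneg (val (sqrtOp A) x))]

lemma IsSlow.not_isNull {A : H →ₗ.[𝕜] H} {p : ℝ} {u : ℝ → H} (h : IsSlow A p u) : ¬ IsNull u := by
  intro h0
  obtain ⟨M₁, -, hM₁, -, h1, -⟩ := h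
  have h2 := h1 0 le_rfl
  rw [h0 0 le_rfl, norm_zero, add_zero, Real.one_rpow, div_one] at h2
  linarith

variable [NormedSpace ℝ H]

namespace SolutionSetting

variable {A B : H →ₗ.[𝕜] H} {g u : ℝ → H} {K p q : ℝ}

/-- `|P_s u| ≤ |u|`, and `|u|` decays faster than `e^{-st}` because its rate is arbitrarily close to
`r`. -/
lemma tendsto_low_mode (S : SolutionSetting A B g u K p q) {r s : ℝ} (hsr : s < r)
    (hw : ∀ t, 0 ≤ t → 0 < ‖u t‖) (hw0 : Tendsto (fun t => ‖u t‖) atTop (𝓝 0))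
    (hz0 : Tendsto (fun t => ‖val B (u t)‖) atTop (𝓝 0))
    (hQ : Tendsto (quot (fun t => ‖u t‖) fun t => ‖val B (u t)‖) atTop (𝓝 r)) :
    Tendsto (fun t => ((Real.exp (s * t) : ℝ) : 𝕜) • proj A s (u t)) atTop (𝓝 0) := by
  obtain ⟨c, C, T, -, hC, hT, h⟩ := S.scalarFlow.exists_exp_bounds S.hK S.hp S.hq hw hw0 hz0 hQ
    (half_pos (sub_pos.2 hsr))
  have hlim : Tendsto (fun t => √(C * Real.exp (-(r - s) * t))) atTop (𝓝 0) := by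
    simpa using ((tendsto_exp_neg_mul (sub_pos.2 hsr)).const_mul C).sqrt
  refine squeeze_zero_norm' ?_ hlim
  filter_upwards [eventually_ge_atTop T] with t ht
  refine Real.le_sqrt_of_sq_le ?_
  rw [norm_smul, RCLike.norm_ofReal, mul_pow, sq_abs]
  have h1 := (h t ht).1
  have h2 : ‖proj A s (u t)‖ ^ 2 ≤ ‖u t‖ ^ 2 :=
    pow_le_pow_left₀ (norm_nonneg _) (norm_proj_le _ _) 2
  calc Real.exp (s * t) ^ 2 * ‖proj A s (u t)‖ ^ 2
      ≤ Real.exp (s * t) ^ 2 * (C * Real.exp (-(2 * (r - (r - s) / 2)) * t)) :=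
        mul_le_mul_of_nonneg_left (h2.trans h1) (sq_nonneg _)
    _ = C * (Real.exp (s * t) ^ 2 * Real.exp (-(2 * (r - (r - s) / 2)) * t)) := by ring
    _ = _ := by
      rw [← Real.exp_nat_mul, ← Real.exp_add]
      push_cast
      ring_nf

/-- The asymptotic expansion of a fast solution. -/
lemma expansion [IsScalarTower ℝ 𝕜 H] (S : SolutionSetting A B g u K p q) {r γ b : ℝ} (hr : 0 < r)
    (hrs : (r : 𝕜) ∈ spec A) (hw : ∀ t, 0 ≤ t → 0 < ‖u t‖)
    (hw0 : Tendsto (fun t => ‖u t‖) atTop (𝓝 0))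
    (hz0 : Tendsto (fun t => ‖val B (u t)‖) atTop (𝓝 0))
    (hQ : Tendsto (quot (fun t => ‖u t‖) fun t => ‖val B (u t)‖) atTop (𝓝 r))
    (hrγ : r < γ) (hγp : γ < (1 + p) * r) (hγq : γ < (1 + q) * r) (hγb : γ < b)
    (hb : ∀ s : ℝ, (s : 𝕜) ∈ spec A → s ≤ r ∨ b ≤ s) {v₀ : H} (hv₀ : v₀ ∈ eigenspace A r)
    (hlim : Tendsto (fun t => ((Real.exp (r * t) : ℝ) : 𝕜) • proj A r (u t)) atTop (𝓝 v₀)) :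
    ∃ M T : ℝ, 0 ≤ M ∧ 0 ≤ T ∧ ∀ t, T ≤ t →
      ‖u t - Real.exp (-r * t) • v₀‖ ≤ M * Real.exp (-γ * t) ∧
      ‖val B (u t - Real.exp (-r * t) • v₀)‖ ≤ M * Real.exp (-γ * t) := by
  have hγ0 := hr.trans hrγ
  have hb0 := hγ0.trans hγb
  obtain ⟨C, T, hC, hT, hCT⟩ :=
    S.scalarFlow.exists_forcing_bound S.hK S.hp S.hq hw hw0 hz0 hQ hγp hγq
  have hg : ∀ t, T ≤ t → ‖g t‖ ≤ C * Real.exp (-γ * t) := fun t ht =>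
    (S.bound t (hT.trans ht)).trans (hCT t ht)
  set F := (finite_spec_le S.discrete r).toFinset with hFdef
  have hmemF : ∀ s, s ∈ F ↔ (s : 𝕜) ∈ spec A ∧ s ≤ r := fun s => by
    rw [hFdef, Set.Finite.mem_toFinset]
    rfl
  have hrF : r ∈ F := (hmemF r).2 ⟨hrs, le_rfl⟩
  have hF : ∀ s : ℝ, (s : 𝕜) ∈ spec A → s ∈ F ∨ b ≤ s := fun s hs =>
    (hb s hs).imp_left fun h => (hmemF s).2 ⟨hs, h⟩
  obtain ⟨M, hM, hhigh⟩ := S.high_modes hγ0 hγb hF hT hg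
  -- The limits of the rescaled low modes: only the eigenvalue `r` contributes at leading order.
  set v : ℝ → H := fun s => if s = r then v₀ else 0 with hv
  have hvlim : ∀ s ∈ F, Tendsto (fun t => ((Real.exp (s * t) : ℝ) : 𝕜) • proj A s (u t)) atTop
      (𝓝 (v s)) := fun s hs => by
    rcases ((hmemF s).1 hs).2.eq_or_lt with rfl | hlt
    · simpa [hv] using hlim
    · simpa [hv, hlt.ne] using S.tendsto_low_mode hlt hw hw0 hz0 hQ
  set d : ℝ → ℝ → H := fun t s => proj A s (u t) - ((Real.exp (-s * t) : ℝ) : 𝕜) • v s with hd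
  have hmode : ∀ t, T ≤ t → ∀ s ∈ F, ‖d t s‖ ≤ C / (γ - s) * Real.exp (-γ * t) :=
    fun t ht s hs => S.mode_limit_estimate (((hmemF s).1 hs).2.trans_lt hrγ) hT hg (hvlim s hs) ht
  have hsumv : ∀ (t : ℝ) (k : ℝ → 𝕜), ∑ s ∈ F, k s • ((Real.exp (-s * t) : ℝ) : 𝕜) • v s =
      k r • ((Real.exp (-r * t) : ℝ) : 𝕜) • v₀ := fun t k => by
    rw [Finset.sum_eq_single_of_mem r hrF fun s _ hs => by simp [hv, hs]]
    simp [hv]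
  have hR : ∀ t, u t - Real.exp (-r * t) • v₀ = compl A F (u t) + ∑ s ∈ F, d t s := fun t => by
    have h1 := hsumv t fun _ => 1
    simp only [one_smul] at h1
    simp only [hd, Finset.sum_sub_distrib, h1, compl, RCLike.real_smul_eq_coe_smul (K := 𝕜)]
    abel
  have hBR : ∀ t, 0 ≤ t → val B (u t - Real.exp (-r * t) • v₀) =
      compl A F (val B (u t)) + ∑ s ∈ F, (√s : 𝕜) • d t s := fun t ht => by
    have h1 := hsumv t fun s => (√s : 𝕜)
    have h2 := S.sqrt.mem_graph_of_mem_eigenspace S.selfAdjoint S.nonneg hv₀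
    have h3 : (u t - ((Real.exp (-r * t) : ℝ) : 𝕜) • v₀,
        val B (u t) - ((Real.exp (-r * t) : ℝ) : 𝕜) • (√r : 𝕜) • v₀) ∈ B.graph :=
      B.graph.sub_mem (mem_graph_val (S.mem_sqrt t ht)) (B.graph.smul_mem _ h2)
    rw [RCLike.real_smul_eq_coe_smul (K := 𝕜), val_eq_of_mem_graph h3]
    simp only [hd, smul_sub, Finset.sum_sub_distrib, h1, compl,
      proj_val_sqrt S.selfAdjoint S.nonneg S.sqrt (S.mem_sqrt t ht)]
    rw [smul_comm]
    abel
  have hexp : ∀ t, Real.exp (-(2 * γ) * t) = Real.exp (-γ * t) ^ 2 := fun t => by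
    rw [← Real.exp_nat_mul]
    push_cast
    ring_nf
  have hcB : ∀ t, T ≤ t → ‖compl A F (val B (u t))‖ ≤ √M * Real.exp (-γ * t) := fun t ht => by
    refine le_of_sq_le_sq ?_ (by positivity)
    rw [mul_pow, Real.sq_sqrt hM, ← hexp]
    exact hhigh t ht
  have hc : ∀ t, T ≤ t → ‖compl A F (u t)‖ ≤ √(M / b) * Real.exp (-γ * t) := fun t ht => by
    refine le_of_sq_le_sq ?_ (by positivity)
    rw [mul_pow, Real.sq_sqrt (by positivity), ← hexp, div_mul_eq_mul_div, le_div_iff₀' hb0]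
    exact (le_norm_compl_val_sqrt S.selfAdjoint S.nonneg S.sqrt S.total hF
      (S.mem_sqrt t (hT.trans ht))).trans (hhigh t ht)
  have hCs : ∀ s ∈ F, 0 ≤ C / (γ - s) := fun s hs =>
    div_nonneg hC (sub_nonneg.2 (((hmemF s).1 hs).2.trans hrγ.le))
  set M₁ := √(M / b) + ∑ s ∈ F, C / (γ - s)
  set M₂ := √M + ∑ s ∈ F, √s * (C / (γ - s))
  have hM₁ : 0 ≤ M₁ := add_nonneg (Real.sqrt_nonneg _) (Finset.sum_nonneg hCs)
  refine ⟨max M₁ M₂, T, le_max_of_le_left hM₁, hT, fun t ht => ⟨?_, ?_⟩⟩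
  · rw [hR]
    refine le_trans ?_ (mul_le_mul_of_nonneg_right (le_max_left M₁ M₂) (Real.exp_pos _).le)
    rw [add_mul, Finset.sum_mul]
    exact (norm_add_le _ _).trans (add_le_add (hc t ht)
      (norm_sum_le_of_le _ fun s hs => hmode t ht s hs))
  · rw [hBR t (hT.trans ht)]
    refine le_trans ?_ (mul_le_mul_of_nonneg_right (le_max_right M₁ M₂) (Real.exp_pos _).le)
    rw [add_mul, Finset.sum_mul]
    refine (norm_add_le _ _).trans (add_le_add (hcB t ht) (norm_sum_le_of_le _ fun s hs => ?_))
    rw [norm_smul, RCLike.norm_ofReal, abs_of_nonneg (Real.sqrt_nonneg _), mul_assoc]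
    exact mul_le_mul_of_nonneg_left (hmode t ht s hs) (Real.sqrt_nonneg _)

/-- If the Dirichlet quotient tends to a positive eigenvalue, then the solution is fast. -/
lemma isSpectralFast [IsScalarTower ℝ 𝕜 H] (S : SolutionSetting A (sqrtOp A) g u K p q)
    {r : ℝ} (hr : 0 < r)
    (hrs : (r : 𝕜) ∈ spec A) (hw : ∀ t, 0 ≤ t → 0 < ‖u t‖)
    (hw0 : Tendsto (fun t => ‖u t‖) atTop (𝓝 0))
    (hz0 : Tendsto (fun t => ‖val (sqrtOp A) (u t)‖) atTop (𝓝 0))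
    (hQ : Tendsto (quot (fun t => ‖u t‖) fun t => ‖val (sqrtOp A) (u t)‖) atTop (𝓝 r)) :
    IsSpectralFast A p q u := by
  obtain ⟨b₀, hb₀, hgap⟩ := exists_gap S.discrete r
  -- An auxiliary rate just above `r`, enough to define `v₀` and to show that it is nonzero; it is
  -- unrelated to the final `γ`.
  obtain ⟨γ₀, hrγ₀, hγ₀⟩ := exists_between (show r < min b₀ (min ((1 + p) * r) ((1 + q) * r)) from
    lt_min hb₀ (lt_min (by nlinarith [S.hp]) (by nlinarith [S.hq])))
  obtain ⟨hγb, hγp, hγq⟩ : γ₀ < b₀ ∧ γ₀ < (1 + p) * r ∧ γ₀ < (1 + q) * r := by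
    simpa only [lt_min_iff] using hγ₀
  obtain ⟨v₀, hv₀, hlim⟩ : ∃ v ∈ eigenspace A r,
      Tendsto (fun t => ((Real.exp (r * t) : ℝ) : 𝕜) • proj A r (u t)) atTop (𝓝 v) := by
    obtain ⟨C, T, -, hT, hCT⟩ :=
      S.scalarFlow.exists_forcing_bound S.hK S.hp S.hq hw hw0 hz0 hQ hγp hγq
    exact S.exists_mode_limit hrγ₀ hT fun t ht => (S.bound t (hT.trans ht)).trans (hCT t ht)
  have hne : v₀ ≠ 0 := by
    intro h0
    obtain ⟨M, T₁, hM, hT₁, h1⟩ :=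
      S.expansion hr hrs hw hw0 hz0 hQ hrγ₀ hγp hγq hγb hgap hv₀ hlim
    -- With `v₀ = 0` the expansion gives `|u| ≤ M e^{-γ₀ t}`, against the lower bound at the rate `r
    -- + (γ₀ - r)/2 < γ₀`.
    obtain ⟨c, C, T₂, hc, -, hT₂, h2⟩ := S.scalarFlow.exists_exp_bounds S.hK S.hp S.hq hw hw0 hz0 hQ
      (half_pos (sub_pos.2 hrγ₀))
    have h3 : ∀ᶠ t in atTop, c ≤ M ^ 2 * Real.exp (-(γ₀ - r) * t) := by
      filter_upwards [eventually_ge_atTop T₁, eventually_ge_atTop T₂] with t ht1 ht2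
      have h4 := (h1 t ht1).1
      rw [h0, smul_zero, sub_zero] at h4
      have h5 := (h2 t ht2).2.trans (pow_le_pow_left₀ (norm_nonneg _) h4 2)
      rw [mul_pow, ← Real.exp_nat_mul, neg_mul (2 * _), Real.exp_neg, ← div_eq_mul_inv,
        div_le_iff₀ (Real.exp_pos _), mul_assoc, ← Real.exp_add] at h5
      have h6 : -(γ₀ - r) * t = (2 : ℕ) * (-γ₀ * t) + 2 * (r + (γ₀ - r) / 2) * t := by
        push_cast
        ring
      rwa [h6]
    have h4 := le_of_tendsto_of_tendsto tendsto_const_nhds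
      ((tendsto_exp_neg_mul (sub_pos.2 hrγ₀)).const_mul (M ^ 2)) h3
    rw [mul_zero] at h4
    linarith
  refine ⟨r, v₀, hr, ⟨hne, (mem_eigenspace_iff S.selfAdjoint).1 hv₀⟩, fun γ hγ => ?_⟩
  -- The expansion needs a rate above `r`, whereas `γ` is arbitrary; any `γ'` beyond both works, and
  -- the surplus `γ' - γ` gives the limit 0.
  have hmax : ((max γ r : ℝ) : EReal) < min (nextEigenvalue A r)
      (min (((1 + p) * r : ℝ) : EReal) (((1 + q) * r : ℝ) : EReal)) := by
    rcases max_choice γ r with h | h <;> rw [h]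
    · exact hγ
    · exact coe_lt_min_nextEigenvalue S.discrete S.hp S.hq hr
  obtain ⟨γ', h1, h2⟩ := EReal.lt_iff_exists_real_btwn.1 hmax
  rw [EReal.coe_lt_coe_iff, max_lt_iff] at h1
  rw [lt_min_iff, lt_min_iff, EReal.coe_lt_coe_iff, EReal.coe_lt_coe_iff] at h2
  obtain ⟨hnext, hγ'p, hγ'q⟩ := h2
  obtain ⟨b, hb, hgap'⟩ := exists_gap S.discrete γ'
  obtain ⟨M, T, hM, hT, hMT⟩ := S.expansion hr hrs hw hw0 hz0 hQ h1.2 hγ'p hγ'q hb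
    (fun s hs => (hgap' s hs).imp_left fun hsγ => by
      by_contra hcon
      have h3 : nextEigenvalue A r ≤ (s : EReal) :=
        sInf_le ⟨s, not_le.1 hcon, S.discrete.1 _ hs, rfl⟩
      exact absurd (hnext.trans_le h3) (not_lt.2 (EReal.coe_le_coe_iff.2 hsγ))) hv₀ hlim
  have hlim0 : Tendsto (fun t => 2 * M * Real.exp (-(γ' - γ) * t)) atTop (𝓝 0) := by
    simpa using (tendsto_exp_neg_mul (sub_pos.2 h1.1)).const_mul (2 * M)
  refine squeeze_zero' (Eventually.of_forall fun t => by unfold normSqrt; positivity) ?_ hlim0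
  filter_upwards [eventually_ge_atTop T] with t ht
  obtain ⟨h3, h4⟩ := hMT t ht
  calc _ ≤ (2 * M * Real.exp (-γ' * t)) * Real.exp (γ * t) :=
        mul_le_mul_of_nonneg_right ((normSqrt_le _ _).trans (by linarith)) (Real.exp_pos _).le
    _ = 2 * M * Real.exp (-(γ' - γ) * t) := by
        rw [mul_assoc, ← Real.exp_add]
        ring_nf

end SolutionSetting

lemma IsSpectralFast.not_isNull {A : H →ₗ.[𝕜] H} (hs : HasDiscreteSpectrum A) {p q : ℝ}
    (hp : 0 < p) (hq : 0 < q) {u : ℝ → H} (h : IsSpectralFast A p q u) : ¬ IsNull u := by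
  intro h0
  obtain ⟨r, v₀, hr, hv, hlim⟩ := h
  have h1 := hlim r (coe_lt_min_nextEigenvalue hs hp hq hr)
  have h2 : ‖v₀‖ ≤ 0 := by
    refine ge_of_tendsto h1 ?_
    filter_upwards [eventually_ge_atTop 0] with t ht
    calc ‖v₀‖ = ‖u t - Real.exp (-r * t) • v₀‖ * Real.exp (r * t) := by
          rw [h0 t ht, zero_sub, norm_neg, norm_smul, Real.norm_eq_abs, Real.abs_exp,
            mul_right_comm, ← Real.exp_add]
          simp
      _ ≤ _ := mul_le_mul_of_nonneg_right (norm_le_normSqrt A _) (Real.exp_pos _).le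
  exact hv.1 (norm_le_zero_iff.1 h2)

/-- The exponent `γ = r/2` is admissible, so `|u| e^{rt/2}` tends to 0, which no power lower bound
allows. -/
lemma IsSpectralFast.not_isSlow {A : H →ₗ.[𝕜] H} (hs : HasDiscreteSpectrum A) {p q : ℝ}
    (hp : 0 < p) (hq : 0 < q) {u : ℝ → H} (h : IsSpectralFast A p q u) : ¬ IsSlow A p u := by
  rintro ⟨M₁, -, hM₁, -, hslow, -⟩
  obtain ⟨r, v₀, hr, hv, hlim⟩ := h
  have hr2 := half_pos hr
  have h1 := hlim (r / 2) ((EReal.coe_lt_coe_iff.2 (half_lt_self hr)).trans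
    (coe_lt_min_nextEigenvalue hs hp hq hr))
  have h2 := h1.add ((tendsto_exp_neg_mul hr2).const_mul ‖v₀‖)
  rw [mul_zero, add_zero] at h2
  have h3 : Tendsto (fun t : ℝ => M₁ * Real.exp (-(r / 2)) *
      (Real.exp (r / 2 * (1 + t)) / (1 + t) ^ (1 / p))) atTop atTop :=
    ((tendsto_exp_mul_div_rpow_atTop (1 / p) (r / 2) hr2).comp
      (tendsto_atTop_add_const_left _ 1 tendsto_id)).const_mul_atTop (by positivity)
  obtain ⟨t, ht1, ht2, ht0⟩ := ((h2.eventually (gt_mem_nhds one_pos)).and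
    ((h3.eventually_gt_atTop 1).and (eventually_ge_atTop 0))).exists
  have h4 : M₁ * Real.exp (-(r / 2)) * (Real.exp (r / 2 * (1 + t)) / (1 + t) ^ (1 / p)) =
      M₁ / (1 + t) ^ (1 / p) * Real.exp (r / 2 * t) := by
    rw [mul_add, mul_one, Real.exp_add, Real.exp_neg]
    field_simp
  have h5 : ‖u t‖ ≤ normSqrt A (u t - Real.exp (-r * t) • v₀) + ‖v₀‖ * Real.exp (-r * t) := by
    calc ‖u t‖ = ‖(u t - Real.exp (-r * t) • v₀) + Real.exp (-r * t) • v₀‖ := by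
          rw [sub_add_cancel]
      _ ≤ _ := (norm_add_le _ _).trans (add_le_add (norm_le_normSqrt A _) (by
          rw [norm_smul, Real.norm_eq_abs, Real.abs_exp, mul_comm]))
  have h6 := mul_le_mul_of_nonneg_right ((hslow t ht0).trans h5) (Real.exp_pos (r / 2 * t)).le
  rw [add_mul, mul_assoc ‖v₀‖, ← Real.exp_add] at h6
  have h7 : Real.exp (-r * t + r / 2 * t) = Real.exp (-(r / 2) * t) := by ring_nf
  rw [h7] at h6
  linarith

end Classification

end DecayRates

theorem theorem2p1 {𝕜 H : Type*} [RCLike 𝕜] [NormedAddCommGroup H] [InnerProductSpace 𝕜 H]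
    [CompleteSpace H] [NormedSpace ℝ H] [IsScalarTower ℝ 𝕜 H]
    (A : H →ₗ.[𝕜] H) (hdense : Dense (A.domain : Set H)) (hself : IsSelfAdjoint A)
    (hnonneg : DecayRates.IsNonneg A) (hspec : DecayRates.HasDiscreteSpectrum A)
    (g u : ℝ → H)
    (hg : ∀ T : ℝ, 0 < T → MemLp g 2 (volume.restrict (Ioo 0 T)))
    (hu : DecayRates.IsGlobalSolution A g u)
    (hlim : Tendsto (fun t => DecayRates.normSqrt A (u t)) atTop (𝓝 0))
    (p q K₀ : ℝ) (hp : 0 < p) (hq : 0 < q) (hK₀ : 0 ≤ K₀)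
    (hineq : ∀ t : ℝ, 0 ≤ t → ‖g t‖ ≤
      K₀ * (‖u t‖ ^ (1 + p) + ‖DecayRates.val (DecayRates.sqrtOp A) (u t)‖ ^ (1 + q))) :
    (DecayRates.IsNull u ∧ ¬ DecayRates.IsSlow A p u ∧ ¬ DecayRates.IsSpectralFast A p q u) ∨
    (¬ DecayRates.IsNull u ∧ DecayRates.IsSlow A p u ∧ ¬ DecayRates.IsSpectralFast A p q u) ∨
    (¬ DecayRates.IsNull u ∧ ¬ DecayRates.IsSlow A p u ∧ DecayRates.IsSpectralFast A p q u) := by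
  have S := DecayRates.solutionSetting hself hnonneg hspec hu hp hq hK₀ hineq
  have hF := S.scalarFlow
  by_cases hnull : DecayRates.IsNull u
  · exact Or.inl ⟨hnull, fun h => h.not_isNull hnull, fun h => h.not_isNull hspec hp hq hnull⟩
  right
  -- A solution that is nonzero at `t₀` is nonzero later by `pos_of_pos`, and earlier because a zero
  -- would persist.
  have hw : ∀ t, 0 ≤ t → 0 < ‖u t‖ := by
    unfold DecayRates.IsNull at hnull
    push Not at hnull
    obtain ⟨t₀, ht₀, hne⟩ := hnull
    intro t ht
    rcases le_total t₀ t with h | h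
    · exact hF.pos_of_pos hK₀ hp hq ht₀ h (norm_pos_iff.2 hne)
    · refine norm_pos_iff.2 fun h0 => hne ?_
      exact norm_eq_zero.1 (hF.eq_zero_of_eq_zero hK₀ hp hq ht h (norm_eq_zero.2 h0))
  have hw0 : Tendsto (fun t => ‖u t‖) atTop (𝓝 0) :=
    squeeze_zero (fun _ => norm_nonneg _) (fun _ => DecayRates.norm_le_normSqrt A _) hlim
  have hz0 : Tendsto (fun t => ‖DecayRates.val (DecayRates.sqrtOp A) (u t)‖) atTop (𝓝 0) :=
    squeeze_zero (fun _ => norm_nonneg _) (fun _ => DecayRates.norm_val_le_normSqrt A _) hlim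
  -- The gap to the right of 0 separates the slow regime from the fast one.
  obtain ⟨ν, hν, hgap⟩ := DecayRates.exists_gap hspec 0
  rcases hF.slow_or_fast hK₀ hp hq hν hgap (DecayRates.isClosed_spec hspec) hw hw0 hz0 with
    hslow | ⟨r, hrs, hr, hQ⟩
  · have hs : DecayRates.IsSlow A p u := hslow
    exact Or.inl ⟨hnull, hs, fun h => h.not_isSlow hspec hp hq hs⟩
  · have hf := S.isSpectralFast hr hrs hw hw0 hz0 hQ
    exact Or.inr ⟨hnull, hf.not_isSlow hspec hp hq, hf⟩
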